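/- **Model.** Fix $\lambda>0$, $\alpha\in(0,1)$ and $T\in(0,\infty)$. Let $Q=\{q\in[0,1]^{\mathbb N}: q(i+1)\le q(i)\le q(0)=1 \text{ for all } i\ge 1\}$ and $Q_n=\{q\in Q: nq(i)\in\mathbb N \text{ for all } i\}$, where $\mathbb N=\{0,1,\dots\}$. Let $(\Omega,\mathbb P)$ be the product of three probability spaces that carry, respectively: independent Poisson processes $\mathcal N_\lambda$ (rate $\lambda$) and $\mathcal N_1^i$, $i\ge1$ (rate $1$); independent random variables $U_j$, $j\ge1$, uniform on $[0,1)$; random elements $q_n(0)\in Q_n$ and $\ell_n(0)\in\mathbb N$, $n\ge 1$, and random elements $q(0)\in Q$ and $\ell(0)\in\mathbb N$. Let $\sigma_{nj}$ be the $j$-th jump time of $t\mapsto\mathcal N_\lambda(nt)$. For $q\in Q$, $\ell\in\mathbb N$ and $i\ge 1$ let $r_{ij}(q,\ell)$ be * $\mathbf 1\{q(\ell)<1,\ U_j\in[\frac{1-q(i-1)}{1-q(\ell)},\frac{1-q(i)}{1-q(\ell)})\}$ if $i\le\ell$, * $\mathbf 1\{q(\ell)=1,\ q(\ell+1)<1\}$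 if $i=\ell+1$, * $\mathbf 1\{q(\ell+1)=1,\ U_j\in[1-q(i-1),1-q(i))\}$ if $i>\ell+1$. For $n\ge1$ let $s_n=(q_n,\ell_n)$ be càdlàg processes on $[0,\infty)$ with values in $Q\times\mathbb N$ that almost surely solve, for all $t\ge0$ and $i\ge1$, $$q_n(t,i)=q_n(0,i)+\frac1n\sum_{j=1}^{\mathcal N_\lambda(nt)}r_{ij}\big(q_n(\sigma_{nj}^-),\ell_n(\sigma_{nj}^-)\big)-\frac1n\,\mathcal N_1^i\Big(n\int_0^t i\,[q_n(s,i)-q_n(s,i+1)]\,ds\Big),$$ $$\ell_n(t)=\ell_n(0)+\sum_{j=1}^{\mathcal N_\lambda(nt)}\Big[\mathbf 1\{q_n(\sigma_{nj}^-,\ell_n(\sigma_{nj}^-)+1)\ge 1-\tfrac1n\}-\mathbf 1\{q_n(\sigma_{nj}^-,\ell_n(\sigma_{nj}^-))\le\alpha\}\Big].$$ **Path space.** Let $S$ be the set of pairs of càdlàg functions on $[0,T]$ with values in $\mathbb R^{\mathbb N}$ and $\mathbb R$, with the metric $\varrho((p,x),(q,y))=\max\{\rho_u^\infty(p,q),\rho_s(x,y)\}$.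 Here $\rho_u^\infty(p,q)=\sup_{t\in[0,T]}\sum_{i\ge0}2^{-i}\min\{|p(t,i)-q(t,i)|,1\}$, and $\rho_s$ is the complete metric of the Skorokhod $J_1$-topology, $\rho_s(x,y)=\inf_\gamma\max\{\sup_{s<t}|\log\frac{\gamma(t)-\gamma(s)}{t-s}|,\ \sup_t|x(t)-y(\gamma(t))|\}$, with $\gamma$ ranging over the increasing bijections of $[0,T]$. **Fluid systems.** For $q\in Q$, $\ell\in\mathbb N$ and $h=\ell+1$ define $p_i(q,\ell)$, $i\ge1$, as follows. * If $q(\ell)<1$: $p_i=\frac{q(i-1)-q(i)}{1-q(\ell)}$ for $i\le\ell$, and $p_i=0$ for $i\ge h$. * If $q(\ell)=1$ and $q(h)<1$: $p_\ell=\frac\ell\lambda[1-q(h)]$ (if $\ell\ge1$), $p_h=1-\frac\ell\lambda[1-q(h)]$, and $p_i=0$ otherwise. * If $q(h)=1$: $p_h=\frac h\lambda[1-q(h+1)]$, $p_i=[1-\frac h\lambda(1-q(h+1))][q(i-1)-q(i)]$ for $i\ge h+1$, and $p_i=0$ for $i\le\ell$. A *fluid system* consists of $\eta\in\{1,2,\dots\}\cup\{\infty\}$,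 times $0=\tau_0<\tau_1<\cdots$ and thresholds $\ell_j\in\mathbb N$ for $0\le j<\eta$, and functions $q:[0,\tau_\eta)\to Q$ and $\ell:[0,\tau_\eta)\to\mathbb N$, where $\tau_\eta=\infty$ if $\eta<\infty$ and $\tau_\eta=\lim_j\tau_j$ if $\eta=\infty$, such that $\ell=\ell_j$ on $[\tau_j,\tau_{j+1})$ for $0\le j<\eta$ and * (a) $q(t,\ell(t))\ge\alpha$ for all $t\in[0,\tau_\eta)$, and $q(t,\ell(t)+1)<1$ for almost every $t\in[0,\tau_\eta)$; * (b) for $0\le j<\eta-1$, either $q(\tau_{j+1},\ell_j)=\alpha$ and $\ell_{j+1}=\ell_j-1$, or $q(\tau_{j+1},\ell_j+1)=1$ and $\ell_{j+1}=\ell_j+1$; * (c) the coordinates $q(\cdot,i)$ are absolutely continuous on the compact subintervals of $[0,\tau_\eta)$ and, for every $0\le j<\eta$, $\dot q(i)=\lambda p_i(q,\ell_j)-i[q(i)-q(i+1)]$ for all $i\ge1$ almost everywhere on $[\tau_j,\tau_{j+1})$. The times $\tau_{j}$ with $1\le j<\eta$ are its *update times*. It is *admissible* if $p_i(q(t),\ell(t))\in[0,1]$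 for all $i\ge1$ and almost every $t\in[0,\tau_\eta)$. **Theorem.** Suppose that, almost surely, $q_n(0)\to q(0)$ in the product topology, $\ell_n(0)\to\ell(0)$, $q(0,\ell(0))>\alpha$ and $q(0,\ell(0)+1)<1$. Then the following holds almost surely. 1. $\{q_n|_{[0,T]}:n\ge1\}$ is relatively compact with respect to $\rho_u^\infty$. 2. If a subsequence of $(s_n|_{[0,T]})$ converges to $s=(q,x)\in S$ with respect to $\varrho$, then some fluid system, defined on an interval that contains $[0,T]$, coincides with $s$ on $[0,T)$, and its occupancy coincides with $q$ also at $T$. 3. If $T$ is not an update time of any admissible fluid system that starts from $(q(0),\ell(0))$, then $\{s_n|_{[0,T]}:n\ge1\}$ is relatively compact with respect to $\varrho$, and the limit $s\in S$ of each convergent subsequence can be extended to a fluid system, i.e. it is the restriction to $[0,T]$ of a fluid system. -/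

import Mathlib

open MeasureTheory ProbabilityTheory Filter Topology Set
open scoped NNReal ENNReal

noncomputable section

namespace ThresholdBalancing

/-- The space `Q` of occupancy states: `q i` is the fraction of server pools with at least `i`
tasks. -/
def occupancySpace : Set (ℕ → ℝ) :=
  {q | q 0 = 1 ∧ (∀ i, q i ∈ Icc (0 : ℝ) 1) ∧ ∀ i, q (i + 1) ≤ q i}

/-- The occupancy states of a system with `n` server pools. -/
def discreteOccupancySpace (n : ℕ) : Set (ℕ → ℝ) :=
  {q | q ∈ occupancySpace ∧ ∀ i, ∃ k : ℕ, (n : ℝ) * q i = k}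

/-! ### Càdlàg functions and the metrics on path spaces -/

/-- `f` is càdlàg on the time set `s`: right-continuous with left limits. A function is regarded
as a path on `s`; its values outside `s` are irrelevant. -/
def IsCadlagOn {E : Type*} [TopologicalSpace E] (f : ℝ → E) (s : Set ℝ) : Prop :=
  ∀ t ∈ s, ContinuousWithinAt f (s ∩ Ici t) t ∧ ∃ l, Tendsto f (𝓝[s ∩ Iio t] t) (𝓝 l)

/-- The metric `d` of the product topology of `ℝ^ℕ`. -/
def productDist (a b : ℕ → ℝ) : ℝ := ∑' i : ℕ, min |a i - b i| 1 / 2 ^ i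

/-- Uniform distance over `[0, T]` of two `ℝ^ℕ`-valued paths. -/
def rhoUniform (T : ℝ) (x y : ℝ → ℕ → ℝ) : ℝ≥0∞ :=
  ⨆ t : Icc (0 : ℝ) T, ENNReal.ofReal (productDist (x t) (y t))

/-- The norm `sup_{s < t} |log ((f t - f s) / (t - s))|` of a time change, that is, of an
increasing bijection `f` of `[0, T]`. -/
def timeChangeNorm {T : ℝ} (f : Icc (0 : ℝ) T ≃o Icc (0 : ℝ) T) : ℝ≥0∞ :=
  ⨆ (s : Icc (0 : ℝ) T) (t : Icc (0 : ℝ) T) (_ : s < t),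
    ENNReal.ofReal |Real.log (((f t : ℝ) - f s) / ((t : ℝ) - s))|

/-- The complete metric of the Skorokhod `J₁`-topology on the real càdlàg functions on `[0, T]`. -/
def rhoSkorokhod (T : ℝ) (x y : ℝ → ℝ) : ℝ≥0∞ :=
  ⨅ f : Icc (0 : ℝ) T ≃o Icc (0 : ℝ) T,
    max (timeChangeNorm f) (⨆ t : Icc (0 : ℝ) T, ENNReal.ofReal |x t - y (f t)|)

/-- Pairs of an `ℝ^ℕ`-valued and a real path. -/
abbrev PathPair : Type := (ℝ → ℕ → ℝ) × (ℝ → ℝ)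

/-- The product metric `ϱ`. -/
def rhoProduct (T : ℝ) (x y : PathPair) : ℝ≥0∞ :=
  max (rhoUniform T x.1 y.1) (rhoSkorokhod T x.2 y.2)

/-- `x` belongs to `S = D_{ℝ^ℕ}[0, T] × D_ℝ[0, T]`. -/
def IsCadlagPair (T : ℝ) (x : PathPair) : Prop :=
  IsCadlagOn x.1 (Icc 0 T) ∧ IsCadlagOn x.2 (Icc 0 T)

/-- Relative compactness of a sequence in the space of the points that satisfy `mem`, with the
metric `dist`: every subsequence has a further subsequence that converges in the space. -/
def IsRelativelyCompactSeq {X : Type*} (mem : X → Prop) (dist : X → X → ℝ≥0∞) (x : ℕ → X) :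
    Prop :=
  ∀ φ : ℕ → ℕ, StrictMono φ → ∃ ψ : ℕ → ℕ, StrictMono ψ ∧ ∃ y, mem y ∧
    Tendsto (fun k => dist (x (φ (ψ k))) y) atTop (𝓝 0)

/-! ### The systems with `n` server pools -/

/-- A Poisson process of rate `r`. -/
structure IsPoissonProcess {Ω : Type*} [MeasurableSpace Ω] (N : ℝ≥0 → Ω → ℕ) (r : ℝ≥0)
    (P : Measure Ω) : Prop where
  measurable : ∀ t, Measurable (N t)
  zero : ∀ᵐ ω ∂P, N 0 ω = 0
  mono : ∀ᵐ ω ∂P, Monotone fun t => N t ω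
  rightCont : ∀ᵐ ω ∂P, ∀ t, ContinuousWithinAt (fun s => N s ω) (Ici t) t
  increments : ∀ s t, s ≤ t → P.map (fun ω => N t ω - N s ω) = poissonMeasure (r * (t - s))
  indep : HasIndepIncrements N P

/-- The number `𝒩(n t)` of arrivals up to time `t`, for the arrival clock `arr = 𝒩`. -/
def arrivalCount (arr : ℝ≥0 → ℕ) (n : ℕ) (t : ℝ) : ℕ := arr (Real.toNNReal (n * t))

/-- The `j`-th arrival epoch `σ_{nj}`, i.e. the `j`-th jump time of `t ↦ 𝒩(n t)`. -/
def arrivalTime (arr : ℝ≥0 → ℕ) (n j : ℕ) : ℝ := sInf {t : ℝ | 0 ≤ t ∧ j ≤ arrivalCount arr n t}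

open Classical in
/-- `routing u q ℓ i` is `1` if a task with selection variable `u`, arriving in state `q` with
threshold `ℓ`, is sent to a server pool with exactly `i - 1` tasks, and `0` otherwise (`1 ≤ i`). -/
def routing (u : ℝ) (q : ℕ → ℝ) (ℓ i : ℕ) : ℝ :=
  if i ≤ ℓ then
    if q ℓ < 1 ∧ u ∈ Ico ((1 - q (i - 1)) / (1 - q ℓ)) ((1 - q i) / (1 - q ℓ)) then 1 else 0
  else if i = ℓ + 1 then
    if q ℓ = 1 ∧ q (ℓ + 1) < 1 then 1 else 0
  else
    if q (ℓ + 1) = 1 ∧ u ∈ Ico (1 - q (i - 1)) (1 - q i) then 1 else 0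

/-- The process `𝒜_n(q, ℓ)`: scaled number of arrivals to server pools with exactly `i - 1` tasks. -/
def arrivals (n : ℕ) (arr : ℝ≥0 → ℕ) (u : ℕ → ℝ) (q : ℝ → ℕ → ℝ) (ℓ : ℝ → ℕ) (t : ℝ) (i : ℕ) : ℝ :=
  if i = 0 then 0 else
    (1 / n) * ∑ j ∈ Finset.Icc 1 (arrivalCount arr n t),
      routing (u j) (Function.leftLim q (arrivalTime arr n j))
        (Function.leftLim ℓ (arrivalTime arr n j)) i

/-- The process `𝒟_n(q)`: scaled number of departures from server pools with exactly `i` tasks. -/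
def departures (n : ℕ) (dep : ℕ → ℝ≥0 → ℕ) (q : ℝ → ℕ → ℝ) (t : ℝ) (i : ℕ) : ℝ :=
  if i = 0 then 0 else
    (1 / n) * dep i (Real.toNNReal (n * ∫ s in (0 : ℝ)..t, (i : ℝ) * (q s i - q s (i + 1))))

open Classical in
/-- The change of the threshold at an arrival, when `q` and `ℓ` are the occupancy state and the
threshold right before it. -/
def thresholdChange (α : ℝ) (n : ℕ) (q : ℕ → ℝ) (ℓ : ℕ) : ℤ :=
  (if 1 - 1 / (n : ℝ) ≤ q (ℓ + 1) then 1 else 0) - (if q ℓ ≤ α then 1 else 0)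

/-- `(q, ℓ)` is a sample path of the system with `n` server pools and control parameter `α`, driven
by the arrival clock `clock 0`, the departure clocks `clock i` (`i ≥ 1`) and the selection variables
`u j` (`j ≥ 1`), and started from `(q₀, ℓ₀)`. -/
structure IsDiscreteSystem (α : ℝ) (n : ℕ) (clock : ℕ → ℝ≥0 → ℕ) (u : ℕ → ℝ) (q₀ : ℕ → ℝ)
    (ℓ₀ : ℕ) (q : ℝ → ℕ → ℝ) (ℓ : ℝ → ℕ) : Prop where
  cadlag_occupancy : IsCadlagOn q (Ici 0)
  cadlag_threshold : IsCadlagOn ℓ (Ici 0)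
  mem : ∀ t, 0 ≤ t → q t ∈ occupancySpace
  occupancy : ∀ t, 0 ≤ t → ∀ i,
    q t i = q₀ i + arrivals n (clock 0) u q ℓ t i - departures n clock q t i
  threshold : ∀ t, 0 ≤ t →
    (ℓ t : ℤ) = ℓ₀ + ∑ j ∈ Finset.Icc 1 (arrivalCount (clock 0) n t),
      thresholdChange α n (Function.leftLim q (arrivalTime (clock 0) n j))
        (Function.leftLim ℓ (arrivalTime (clock 0) n j))

/-- A path of the `n`-th system as an element of the path space: the threshold becomes
real-valued. -/
def toPair (q : ℝ → ℕ → ℝ) (ℓ : ℝ → ℕ) : PathPair := (q, fun t => (ℓ t : ℝ))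

/-! ### Fluid systems -/

open Classical in
/-- The fluid routing probabilities `p_i(q, ℓ)`, for `i ≥ 1`. -/
def fluidRouting (lam : ℝ) (q : ℕ → ℝ) (ℓ i : ℕ) : ℝ :=
  if q ℓ < 1 then
    if i ≤ ℓ then (q (i - 1) - q i) / (1 - q ℓ) else 0
  else if q (ℓ + 1) < 1 then
    if i = ℓ then ℓ / lam * (1 - q (ℓ + 1))
    else if i = ℓ + 1 then 1 - ℓ / lam * (1 - q (ℓ + 1))
    else 0
  else
    if i = ℓ + 1 then ((ℓ : ℝ) + 1) / lam * (1 - q (ℓ + 2))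
    else if ℓ + 2 ≤ i then (1 - ((ℓ : ℝ) + 1) / lam * (1 - q (ℓ + 2))) * (q (i - 1) - q i)
    else 0

/-- The period `[τ_j, τ_{j+1})`, which is `[τ_j, ∞)` if `j + 1 = η`. -/
def fluidPeriod (η : ℕ∞) (τ : ℕ → ℝ) (j : ℕ) : Set ℝ :=
  {t | τ j ≤ t ∧ (((j + 1 : ℕ) : ℕ∞) < η → t < τ (j + 1))}

/-- The time domain `[0, τ_η)`: the union of the periods `j < η`. -/
def fluidDomain (η : ℕ∞) (τ : ℕ → ℝ) : Set ℝ :=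
  {t | ∃ j : ℕ, (j : ℕ∞) < η ∧ t ∈ fluidPeriod η τ j}

/-- Fluid systems with arrival rate `lam` and control parameter `α`. Here `η` is the (possibly
infinite) number of periods, `τ j` and `thr j` (for `j < η`) are the update times and the thresholds,
and `q`, `ℓ` are functions on the time domain. -/
structure FluidSystem (lam α : ℝ) where
  η : ℕ∞
  τ : ℕ → ℝ
  thr : ℕ → ℕ
  q : ℝ → ℕ → ℝ
  ℓ : ℝ → ℕ
  one_le_eta : 1 ≤ η
  tau_zero : τ 0 = 0
  tau_lt : ∀ j : ℕ, ((j + 1 : ℕ) : ℕ∞) < η → τ j < τ (j + 1)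
  threshold_eq : ∀ j : ℕ, (j : ℕ∞) < η → ∀ t ∈ fluidPeriod η τ j, ℓ t = thr j
  mem : ∀ t ∈ fluidDomain η τ, q t ∈ occupancySpace
  alpha_le : ∀ t ∈ fluidDomain η τ, α ≤ q t (ℓ t)
  lt_one : ∀ᵐ t : ℝ, t ∈ fluidDomain η τ → q t (ℓ t + 1) < 1
  update : ∀ j : ℕ, ((j + 1 : ℕ) : ℕ∞) < η →
    (q (τ (j + 1)) (thr j) = α ∨ q (τ (j + 1)) (thr j + 1) = 1) ∧
    (q (τ (j + 1)) (thr j) = α → (thr (j + 1) : ℤ) = thr j - 1) ∧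
    (q (τ (j + 1)) (thr j + 1) = 1 → thr (j + 1) = thr j + 1)
  abs_cont : ∀ t ∈ fluidDomain η τ, ∀ i, AbsolutelyContinuousOnInterval (fun s => q s i) 0 t
  dynamics : ∀ j : ℕ, (j : ℕ∞) < η → ∀ᵐ t : ℝ, t ∈ fluidPeriod η τ j → ∀ i : ℕ, 1 ≤ i →
    HasDerivAt (fun s => q s i)
      (lam * fluidRouting lam (q t) (thr j) i - i * (q t i - q t (i + 1))) t

namespace FluidSystem

variable {lam α : ℝ}

/-- The time domain `[0, τ_η)`. -/
def domain (F : FluidSystem lam α) : Set ℝ := fluidDomain F.η F.τ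

/-- `t` is one of the update times `τ_1, τ_2, …`. -/
def IsUpdateTime (F : FluidSystem lam α) (t : ℝ) : Prop :=
  ∃ j : ℕ, ((j + 1 : ℕ) : ℕ∞) < F.η ∧ F.τ (j + 1) = t

/-- The routing coefficients are probabilities at almost all times. -/
def IsAdmissible (F : FluidSystem lam α) : Prop :=
  ∀ᵐ t : ℝ, t ∈ F.domain → ∀ i : ℕ, 1 ≤ i → fluidRouting lam (F.q t) (F.ℓ t) i ∈ Icc (0 : ℝ) 1

/-- `F` extends the pair of paths `s` on `[0, T]`. -/
def Extends (F : FluidSystem lam α) (T : ℝ) (s : PathPair) : Prop :=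
  Icc 0 T ⊆ F.domain ∧ ∀ t ∈ Icc 0 T, F.q t = s.1 t ∧ (F.ℓ t : ℝ) = s.2 t

/-- `F` extends the pair of paths `s` on `[0, T]`, except perhaps for the threshold at the end
point `T`. -/
def ExtendsUpToEndpoint (F : FluidSystem lam α) (T : ℝ) (s : PathPair) : Prop :=
  Icc 0 T ⊆ F.domain ∧ (∀ t ∈ Icc 0 T, F.q t = s.1 t) ∧ ∀ t ∈ Ico 0 T, (F.ℓ t : ℝ) = s.2 t

end FluidSystem

end ThresholdBalancing

end

/-!
The randomness enters only through laws of large numbers. Almost surely the clocks grow linearly,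
the arrival clock jumps by one, and the empirical distribution functions of the selection
variables converge. A realization with these properties is called good (`GoodRun`), and everything
else is deterministic. Subsequences are replaced by ultrafilters `U` on `ℕ` that are finer than a
given subsequence: all limits of bounded quantities along `U` exist, and each alternative is
decided.

On a good realization the occupancy processes are asymptotically Lipschitz, so that they converge
along `U`, uniformly on compact intervals, to a Lipschitz path `x` (`GoodRun.exists_limit`). This
already gives relative compactness of the occupancies.

At a time around which the thresholds of `U`-almost all systems are constant and equal to `m` (a
quiet time, `IsQuiet`), `x` solves the fluid equations with threshold `m` (`IsQuiet.dynamics`). If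
level `m` is not full, this is the law of large numbers for the selection variables. If level `m`
is full and level `m + 1` is not, the levels up to `m` have a local maximum, so that their
derivatives vanish; the arrivals to them must balance the departures, and the rest of the arrivals
goes to level `m + 1`. That level `m + 1` is not full at almost every time is `subsingleton_full`:
within a period it is full at one time at most.

The updates are constructed one after the other (`UpdateState.IsGood.step`): after an update at
which the limiting state lies in the interior region, level `m` above `α` and level `m + 1` below
`1`, some time passes without update, and the next update is the limit of the first arrivals that
change the threshold. The point is that the state after that update is again in the interior
region. After an increase this holds because the levels above `m + 1` decrease during a period
(`antitoneOn_above`); after a decrease it is a uniqueness argument of Grönwall type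
(`alpha_lt_of_update_down`). The update times do not accumulate (`exists_lt_time`): each increase
needs a full level, which bounds the thresholds, and a level cannot drop from `1` to `α` within a
short time, so that increases cannot be followed by decreases near an accumulation point.
Altogether `U` yields an admissible fluid system that is defined at all times and whose update
times are the limits of those of the systems (`exists_fluidSystem`).

If `T` is not an update time, a piecewise linear time change that moves the update times of the
`n`-th system to their limits shows convergence of the thresholds in the Skorokhod topology
(`ThresholdsConverge.tendsto_rhoSkorokhod`). Conversely, every Skorokhod limit of the thresholds
agrees with the fluid system off the update times (`ThresholdsConverge.eq_of_tendsto`), hence on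
`[0, T)` by right-continuity, and at `T` if `T` is not an update time.
-/

noncomputable section

namespace ThresholdBalancing

/-! ### Almost sure properties of the clocks and of the selection variables -/

/-- The counting path `N` grows linearly at rate `r`, up to an error that is `o(x)` as `x → ∞`. The
form with a constant `C` gives at once the uniform law of large numbers for `t ↦ N (n t) / n`. -/
def HasRate (N : ℝ≥0 → ℕ) (r : ℝ) : Prop :=
  ∀ ε : ℝ, 0 < ε → ∃ C : ℝ, ∀ x : ℝ≥0, |(N x : ℝ) - r * x| ≤ ε * x + C

lemma hasSum_mean_poisson (r : ℝ≥0) :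
    HasSum (fun n : ℕ => (Real.exp (-r) * r ^ n / n.factorial) * (n : ℝ)) r := by
  have h := (hasSum_one_poissonMeasure r).mul_left (r : ℝ)
  rw [mul_one] at h
  rw [← hasSum_nat_add_iff' 1]
  simp only [Finset.range_one, Finset.sum_singleton, Nat.cast_zero, mul_zero, sub_zero]
  refine (congrArg (fun f => HasSum f (r : ℝ)) (funext fun n => ?_)).mpr h
  rw [Nat.factorial_succ]
  have : (n.factorial : ℝ) ≠ 0 := by positivity
  push_cast
  field_simp
  ring

lemma integrable_cast_poisson (r : ℝ≥0) :
    Integrable (fun n : ℕ => (n : ℝ)) (poissonMeasure r) := by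
  rw [integrable_poissonMeasure_iff]
  simpa using (hasSum_mean_poisson r).summable

lemma integral_cast_poisson (r : ℝ≥0) : ∫ n : ℕ, (n : ℝ) ∂(poissonMeasure r) = r := by
  rw [integral_poissonMeasure]
  simpa using (hasSum_mean_poisson r).tsum_eq

lemma poisson_two_le (r : ℝ≥0) :
    poissonMeasure r {k | 2 ≤ k} ≤ ENNReal.ofReal ((r : ℝ) ^ 2) := by
  have hE : ({k : ℕ | 2 ≤ k}) = ({0, 1} : Set ℕ)ᶜ := by
    ext k; simp; omega
  have hm : poissonMeasure r ({0, 1} : Set ℕ)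
      = ENNReal.ofReal (Real.exp (-r) * (1 + r)) := by
    rw [show ({0, 1} : Set ℕ) = {0} ∪ {1} from rfl,
      measure_union (by simp) (measurableSet_singleton _), poissonMeasure_singleton,
      poissonMeasure_singleton, ← ENNReal.ofReal_add (by positivity) (by positivity)]
    congr 1
    simp
    ring
  rw [hE, prob_compl_eq_one_sub (by measurability), hm, ← ENNReal.ofReal_one,
    ← ENNReal.ofReal_sub _ (by positivity)]
  apply ENNReal.ofReal_le_ofReal
  have h1 := Real.add_one_le_exp (-(r : ℝ))
  have h2 : (0 : ℝ) ≤ r := r.2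
  nlinarith

lemma hasRate_of_tendsto {N : ℝ≥0 → ℕ} {r : ℝ} (hr : 0 ≤ r) (hN : Monotone N)
    (h : Tendsto (fun k : ℕ => (N k : ℝ) / k) atTop (𝓝 r)) : HasRate N r := by
  intro ε hε
  obtain ⟨K, hK⟩ := Metric.tendsto_atTop.1 h ε hε
  set C₀ := ∑ k ∈ Finset.range (K + 1), |(N k : ℝ) - r * k|
  have hC₀ : 0 ≤ C₀ := Finset.sum_nonneg fun _ _ => abs_nonneg _
  have hk : ∀ k : ℕ, |(N k : ℝ) - r * k| ≤ ε * k + C₀ := by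
    intro k
    rcases le_or_gt k K with hkK | hkK
    · have := Finset.single_le_sum (f := fun k : ℕ => |(N k : ℝ) - r * k|)
        (fun _ _ => abs_nonneg _) (Finset.mem_range.2 (Nat.lt_succ_of_le hkK))
      have h0 : 0 ≤ ε * k := by positivity
      exact this.trans (by linarith)
    · have h1 := hK k hkK.le
      have h0 : (0 : ℝ) < k := by exact_mod_cast (Nat.zero_le K).trans_lt hkK
      rw [Real.dist_eq] at h1
      have : (N k : ℝ) - r * k = ((N k : ℝ) / k - r) * k := by field_simp
      rw [this, abs_mul, abs_of_pos h0]
      nlinarith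
  refine ⟨C₀ + r + ε, fun x => ?_⟩
  set k := ⌊x⌋₊
  have hk1 : (k : ℝ≥0) ≤ x := Nat.floor_le (zero_le)
  have hk2 : x ≤ ((k + 1 : ℕ) : ℝ≥0) := by
    push_cast; exact (Nat.lt_floor_add_one x).le
  have hN1 : (N k : ℝ) ≤ N x := by exact_mod_cast hN hk1
  have hN2 : (N x : ℝ) ≤ N ((k + 1 : ℕ) : ℝ≥0) := by exact_mod_cast hN hk2
  have hk1' : (k : ℝ) ≤ x := by exact_mod_cast hk1
  have hk2' : (x : ℝ) ≤ k + 1 := by exact_mod_cast hk2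
  have h1 := abs_le.1 (hk k)
  have h2 := abs_le.1 (hk (k + 1))
  push_cast at h2 hN2
  rw [abs_le]
  constructor <;> nlinarith

/-- The law of large numbers for a Poisson process, from its increments over unit intervals. -/
theorem IsPoissonProcess.ae_hasRate {Ω : Type*} [MeasurableSpace Ω] {P : Measure Ω}
    {N : ℝ≥0 → Ω → ℕ} {r : ℝ≥0} (h : IsPoissonProcess N r P) :
    ∀ᵐ ω ∂P, HasRate (fun t => N t ω) r := by
  set X : ℕ → Ω → ℝ := fun k ω => ((N ((k + 1 : ℕ) : ℝ≥0) ω - N (k : ℝ≥0) ω : ℕ) : ℝ)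
  have hmeas : ∀ k : ℕ, Measurable fun ω => N ((k + 1 : ℕ) : ℝ≥0) ω - N (k : ℝ≥0) ω :=
    fun k => (h.measurable _).sub (h.measurable _)
  have hlaw : ∀ k : ℕ, P.map (fun ω => N ((k + 1 : ℕ) : ℝ≥0) ω - N (k : ℝ≥0) ω)
      = poissonMeasure r := by
    intro k
    rw [h.increments _ _ (by simp)]
    simp
  have hmeasX : ∀ k, Measurable (X k) := fun k => measurable_from_top.comp (hmeas k)
  have hlawX : ∀ k, P.map (X k) = (poissonMeasure r).map (fun n : ℕ => (n : ℝ)) := by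
    intro k
    rw [← hlaw k, Measure.map_map measurable_from_top (hmeas k)]
    rfl
  have hint : Integrable (X 0) P := by
    have := integrable_cast_poisson r
    rw [← hlaw 0] at this
    exact this.comp_measurable (hmeas 0)
  have hmean : ∫ ω, X 0 ω ∂P = r := by
    rw [← integral_cast_poisson r, ← hlaw 0,
      integral_map (hmeas 0).aemeasurable (measurable_from_top).aestronglyMeasurable]
  have hind : iIndepFun X P := by
    have := h.indep.nat (t := fun k : ℕ => (k : ℝ≥0)) (fun a b hab => Nat.cast_le.2 hab)
    exact this.comp (fun _ (n : ℕ) => (n : ℝ)) (fun _ => measurable_from_top)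
  have hslln := strong_law_ae_real X hint (fun i j hij => hind.indepFun hij)
    (fun i => ⟨(hmeasX i).aemeasurable, (hmeasX 0).aemeasurable, by rw [hlawX, hlawX]⟩)
  rw [hmean] at hslln
  filter_upwards [hslln, h.zero, h.mono] with ω h1 h2 h3
  refine hasRate_of_tendsto r.2 h3 (h1.congr fun n => ?_)
  congr 1
  rw [← Nat.cast_sum]
  norm_cast
  rw [Finset.sum_range_tsub (f := fun k : ℕ => N (k : ℝ≥0) ω)]
  · simp [h2]
  · exact fun a b hab => h3 (by exact_mod_cast hab)

/-- A counting path that skips the value `j` has a cell of any mesh with at least two jumps. -/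
lemma exists_two_le_increment {N : ℝ≥0 → ℕ} (h0 : N 0 = 0)
    {M m : ℕ} (hm : 0 < m) {j : ℕ} (hj : ∀ t, N t ≠ j) (hM : j ≤ N M) :
    ∃ k < M * m, 2 ≤ N (((k + 1 : ℕ) : ℝ≥0) / m) - N ((k : ℝ≥0) / m) := by
  classical
  have hex : ∃ k : ℕ, j ≤ N ((k : ℝ≥0) / m) := by
    refine ⟨M * m, ?_⟩
    have : ((M * m : ℕ) : ℝ≥0) / m = M := by
      push_cast; field_simp
    rwa [this]
  have hle : Nat.find hex ≤ M * m := Nat.find_min' hex (by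
    have : ((M * m : ℕ) : ℝ≥0) / m = M := by
      push_cast; field_simp
    rwa [this])
  have hpos : Nat.find hex ≠ 0 := by
    intro h
    have := Nat.find_spec hex
    rw [h] at this
    simp only [Nat.cast_zero, zero_div, h0] at this
    exact hj 0 (by omega)
  obtain ⟨k, hk⟩ := Nat.exists_eq_succ_of_ne_zero hpos
  refine ⟨k, by omega, ?_⟩
  have h1 := Nat.find_spec hex
  have h2 := Nat.find_min hex (m := k) (by omega)
  rw [hk] at h1
  have h3 := hj (((k + 1 : ℕ) : ℝ≥0) / m)
  have h1' : j ≤ N (((k + 1 : ℕ) : ℝ≥0) / m) := h1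
  omega

/-- The paths of a Poisson process have unit jumps: no value is skipped. Indeed, at mesh `1 / m` the
probability that one of the `M m` cells of `[0, M]` has two jumps is at most `M r² / m`. -/
theorem IsPoissonProcess.ae_surjective {Ω : Type*} [MeasurableSpace Ω] {P : Measure Ω}
    {N : ℝ≥0 → Ω → ℕ} {r : ℝ≥0} (hr : 0 < r) (h : IsPoissonProcess N r P) :
    ∀ᵐ ω ∂P, Function.Surjective (fun t => N t ω) := by
  have hskip : ∀ M : ℕ, ∀ᵐ ω ∂P, Monotone (fun t => N t ω) → N 0 ω = 0 →
      ∀ j ≤ N M ω, ∃ t, N t ω = j := by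
    intro M
    rw [ae_iff]
    set E := {ω | ¬(Monotone (fun t => N t ω) → N 0 ω = 0 → ∀ j ≤ N M ω, ∃ t, N t ω = j)}
    have hbound : ∀ m : ℕ, 0 < m → P E ≤ ENNReal.ofReal (M * (r : ℝ) ^ 2 / m) := by
      intro m hm
      have hsub : E ⊆ ⋃ k ∈ Finset.range (M * m),
          {ω | 2 ≤ N (((k + 1 : ℕ) : ℝ≥0) / m) ω - N ((k : ℝ≥0) / m) ω} := by
        intro ω hω
        simp only [E, mem_ofPred_eq, not_forall, not_exists] at hω
        obtain ⟨h1, h2, j, h3, h4⟩ := hω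
        obtain ⟨k, hk, hk2⟩ := exists_two_le_increment h2 hm h4 h3
        simp only [mem_iUnion]
        exact ⟨k, Finset.mem_range.2 hk, hk2⟩
      have hcell : ∀ k : ℕ, P {ω | 2 ≤ N (((k + 1 : ℕ) : ℝ≥0) / m) ω - N ((k : ℝ≥0) / m) ω}
          ≤ ENNReal.ofReal ((r / m : ℝ) ^ 2) := by
        intro k
        have hle : (k : ℝ≥0) / m ≤ ((k + 1 : ℕ) : ℝ≥0) / m := by
          gcongr; simp
        have hlaw := h.increments _ _ hle
        have hdiff : ((k + 1 : ℕ) : ℝ≥0) / m - (k : ℝ≥0) / m = 1 / m := by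
          rw [← NNReal.sub_div]; simp
        rw [hdiff] at hlaw
        have hms : Measurable fun ω => N (((k + 1 : ℕ) : ℝ≥0) / m) ω - N ((k : ℝ≥0) / m) ω :=
          (h.measurable _).sub (h.measurable _)
        have := poisson_two_le (r * (1 / m))
        rw [← hlaw, Measure.map_apply hms (by measurability)] at this
        refine this.trans (le_of_eq ?_)
        congr 2
        push_cast
        ring
      calc P E ≤ P (⋃ k ∈ Finset.range (M * m),
            {ω | 2 ≤ N (((k + 1 : ℕ) : ℝ≥0) / m) ω - N ((k : ℝ≥0) / m) ω}) := measure_mono hsub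
        _ ≤ ∑ k ∈ Finset.range (M * m), _ := measure_biUnion_finset_le _ _
        _ ≤ ∑ k ∈ Finset.range (M * m), ENNReal.ofReal ((r / m : ℝ) ^ 2) :=
            Finset.sum_le_sum fun k _ => hcell k
        _ = ENNReal.ofReal (M * (r : ℝ) ^ 2 / m) := by
            rw [Finset.sum_const, Finset.card_range, nsmul_eq_mul,
              ← ENNReal.ofReal_natCast, ← ENNReal.ofReal_mul (by positivity)]
            congr 1
            push_cast
            field_simp
    have hlim : Tendsto (fun m : ℕ => ENNReal.ofReal (M * (r : ℝ) ^ 2 / m)) atTop (𝓝 0) := by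
      rw [← ENNReal.ofReal_zero]
      exact ENNReal.tendsto_ofReal (tendsto_const_div_atTop_nhds_zero_nat _)
    exact le_antisymm (ge_of_tendsto hlim
      ((eventually_gt_atTop 0).mono hbound)) (zero_le)
  filter_upwards [ae_all_iff.2 hskip, h.ae_hasRate, h.mono, h.zero] with ω h1 h2 h3 h4 j
  obtain ⟨C, hC⟩ := h2 (r / 2) (by positivity)
  obtain ⟨M, hM⟩ := exists_nat_gt ((j + C) / (r / 2))
  refine h1 M h3 h4 j ?_
  have hM' := (div_lt_iff₀ (by positivity)).1 hM
  have := (abs_le.1 (hC M)).1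
  have hlt : (j : ℝ) < N M ω := by
    push_cast at this
    nlinarith
  exact_mod_cast hlt.le

/-- The number of the selection variables `u 1, …, u m` that are below `c`. -/
def empirical (u : ℕ → ℝ) (c : ℝ) (m : ℕ) : ℝ :=
  ∑ j ∈ Finset.Icc 1 m, (Iio c).indicator (fun _ => (1 : ℝ)) (u j)

lemma empirical_mono {u : ℕ → ℝ} {c d : ℝ} (h : c ≤ d) (m : ℕ) :
    empirical u c m ≤ empirical u d m :=
  Finset.sum_le_sum fun _ _ =>
    indicator_le_indicator_of_subset (Iio_subset_Iio h) (fun _ => zero_le_one) _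

/-- The law of large numbers for the selection variables, simultaneously for all levels `c`: it holds
for rational `c`, and the empirical distribution function is monotone. -/
theorem ae_tendsto_empirical {Ω : Type*} [MeasurableSpace Ω] {P : Measure Ω}
    [IsProbabilityMeasure P]
    (U : ℕ → Ω → ℝ) (hU_meas : ∀ j, Measurable (U j))
    (hU_law : ∀ j, P.map (U j) = (volume : Measure ℝ).restrict (Ico 0 1))
    (hU_indep : iIndepFun U P) :
    ∀ᵐ ω ∂P, ∀ c ∈ Icc (0 : ℝ) 1,
      Tendsto (fun m : ℕ => empirical (fun j => U j ω) c m / m) atTop (𝓝 c) := by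
  have hrat : ∀ c : ℚ, ∀ᵐ ω ∂P, (c : ℝ) ∈ Icc (0 : ℝ) 1 →
      Tendsto (fun m : ℕ => empirical (fun j => U j ω) c m / m) atTop (𝓝 (c : ℝ)) := by
    intro c
    by_cases hc : (c : ℝ) ∈ Icc (0 : ℝ) 1
    swap
    · exact Eventually.of_forall fun ω h => absurd h hc
    have hi : Measurable ((Iio (c : ℝ)).indicator (fun _ => (1 : ℝ))) :=
      measurable_const.indicator measurableSet_Iio
    set X : ℕ → Ω → ℝ := fun j ω => (Iio (c : ℝ)).indicator (fun _ => (1 : ℝ)) (U (j + 1) ω)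
    have hX : ∀ j, Measurable (X j) := fun j => hi.comp (hU_meas _)
    have hlawX : ∀ j, P.map (X j) = ((volume : Measure ℝ).restrict (Ico 0 1)).map
        ((Iio (c : ℝ)).indicator (fun _ => (1 : ℝ))) := by
      intro j
      rw [← hU_law (j + 1), Measure.map_map hi (hU_meas _)]
      rfl
    have hint : Integrable (X 0) P := by
      refine Integrable.of_bound (hX 0).aestronglyMeasurable 1 (Eventually.of_forall fun ω => ?_)
      simp only [X, indicator]
      split_ifs <;> simp
    have hmean : ∫ ω, X 0 ω ∂P = c := by
      have : ∫ ω, X 0 ω ∂P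
          = ∫ x, (Iio (c : ℝ)).indicator (fun _ => (1 : ℝ)) x ∂(P.map (U 1)) := by
        rw [integral_map (hU_meas 1).aemeasurable hi.aestronglyMeasurable]
      rw [this, hU_law, integral_indicator_const _ measurableSet_Iio]
      rw [measureReal_restrict_apply measurableSet_Iio]
      have : Iio (c : ℝ) ∩ Ico 0 1 = Ico 0 (c : ℝ) := by
        ext x
        simp only [mem_inter_iff, mem_Iio, mem_Ico]
        constructor
        · rintro ⟨a, b, -⟩; exact ⟨b, a⟩
        · rintro ⟨a, b⟩; exact ⟨b, a, b.trans_le hc.2⟩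
      rw [this]
      simp [hc.1]
    have hind : iIndepFun X P :=
      (hU_indep.precomp (g := fun j : ℕ => j + 1) (add_left_injective 1)).comp
        (fun _ => (Iio (c : ℝ)).indicator (fun _ => (1 : ℝ))) (fun _ => hi)
    have hs := strong_law_ae_real X hint (fun i j hij => hind.indepFun hij)
      (fun i => ⟨(hX i).aemeasurable, (hX 0).aemeasurable, by rw [hlawX, hlawX]⟩)
    rw [hmean] at hs
    filter_upwards [hs] with ω hω _
    refine hω.congr fun m => ?_
    congr 1
    rw [empirical, ← Finset.Ico_add_one_right_eq_Icc, Finset.sum_Ico_eq_sum_range]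
    simp [X, add_comm]
  filter_upwards [ae_all_iff.2 hrat] with ω hω c hc
  rw [Metric.tendsto_atTop]
  intro ε hε
  -- bracket `c` between points of `[0, 1]` that are rational, or equal to `c`
  obtain ⟨a, ha0, ha1, ha2, haT⟩ : ∃ a : ℝ, a ∈ Icc (0 : ℝ) 1 ∧ a ≤ c ∧ c - ε / 2 < a ∧
      Tendsto (fun m : ℕ => empirical (fun j => U j ω) a m / m) atTop (𝓝 a) := by
    rcases eq_or_lt_of_le hc.1 with h | h
    · refine ⟨0, by simp, hc.1, by linarith, ?_⟩
      simpa using hω 0 (by simp)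
    · obtain ⟨a, h1, h2⟩ := exists_rat_btwn (max_lt h (by linarith : c - ε / 2 < c))
      have h0 : (a : ℝ) ∈ Icc (0 : ℝ) 1 :=
        ⟨((le_max_left _ _).trans_lt h1).le, h2.le.trans hc.2⟩
      exact ⟨a, h0, h2.le, (le_max_right _ _).trans_lt h1, hω a h0⟩
  obtain ⟨b, hb0, hb1, hb2, hbT⟩ : ∃ b : ℝ, b ∈ Icc (0 : ℝ) 1 ∧ c ≤ b ∧ b < c + ε / 2 ∧
      Tendsto (fun m : ℕ => empirical (fun j => U j ω) b m / m) atTop (𝓝 b) := by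
    rcases eq_or_lt_of_le hc.2 with h | h
    · refine ⟨1, by simp, hc.2, by linarith, ?_⟩
      simpa using hω 1 (by simp)
    · obtain ⟨a, h1, h2⟩ := exists_rat_btwn (lt_min h (by linarith : c < c + ε / 2))
      have h0 : (a : ℝ) ∈ Icc (0 : ℝ) 1 :=
        ⟨hc.1.trans h1.le, (h2.trans_le (min_le_left _ _)).le⟩
      exact ⟨a, h0, h1.le, h2.trans_le (min_le_right _ _), hω a h0⟩
  obtain ⟨K₁, h₁⟩ := Metric.tendsto_atTop.1 haT (ε / 2) (by linarith)
  obtain ⟨K₂, h₂⟩ := Metric.tendsto_atTop.1 hbT (ε / 2) (by linarith)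
  refine ⟨max K₁ K₂, fun m hm => ?_⟩
  have e1 := h₁ m (le_trans (le_max_left _ _) hm)
  have e2 := h₂ m (le_trans (le_max_right _ _) hm)
  rw [Real.dist_eq, abs_lt] at e1 e2 ⊢
  have m1 : empirical (fun j => U j ω) a m / m ≤ empirical (fun j => U j ω) c m / m :=
    div_le_div_of_nonneg_right (empirical_mono ha1 m) (Nat.cast_nonneg _)
  have m2 : empirical (fun j => U j ω) c m / m ≤ empirical (fun j => U j ω) b m / m :=
    div_le_div_of_nonneg_right (empirical_mono hb1 m) (Nat.cast_nonneg _)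
  constructor <;> linarith

lemma ae_uniform_mem {Ω : Type*} [MeasurableSpace Ω] {P : Measure Ω} {U : Ω → ℝ}
    (hU : Measurable U) (hlaw : P.map U = (volume : Measure ℝ).restrict (Ico 0 1)) :
    ∀ᵐ ω ∂P, U ω ∈ Ico (0 : ℝ) 1 := by
  have : ∀ᵐ x ∂(P.map U), x ∈ Ico (0 : ℝ) 1 := by
    rw [hlaw]; exact ae_restrict_mem measurableSet_Ico
  exact ae_of_ae_map hU.aemeasurable this

end ThresholdBalancing

namespace ThresholdBalancing

/-! ### Arrival epochs -/

/-- An arrival clock that starts from `0`, is right-continuous and has unit jumps; the last property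
is stated as surjectivity, which also says that there are infinitely many arrivals. -/
structure IsArrivalClock (arr : ℝ≥0 → ℕ) : Prop where
  mono : Monotone arr
  zero : arr 0 = 0
  rightCont : ∀ t, ContinuousWithinAt arr (Ici t) t
  surj : Function.Surjective arr

section Epochs

variable {arr : ℝ≥0 → ℕ} {n : ℕ}

lemma arrivalCount_mono (h : Monotone arr) (n : ℕ) : Monotone (arrivalCount arr n) :=
  fun s t hst => h (Real.toNNReal_le_toNNReal (by gcongr))

lemma IsArrivalClock.arrivalCount_arrivalTime (h : IsArrivalClock arr) (hn : 1 ≤ n) (j : ℕ) :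
    0 ≤ arrivalTime arr n j ∧ arrivalCount arr n (arrivalTime arr n j) = j := by
  have hn' : (0 : ℝ) < n := by exact_mod_cast hn
  set S := {t : ℝ | 0 ≤ t ∧ j ≤ arrivalCount arr n t}
  obtain ⟨x, hx⟩ := h.surj j
  have hcx : arrivalCount arr n ((x : ℝ) / n) = j := by
    rw [arrivalCount, mul_div_cancel₀ _ hn'.ne', Real.toNNReal_coe, hx]
  have hxS : (x : ℝ) / n ∈ S := ⟨by positivity, hcx.ge⟩
  have hbdd : BddBelow S := ⟨0, fun t ht => ht.1⟩
  have hσ0 : 0 ≤ sInf S := le_csInf ⟨_, hxS⟩ fun t ht => ht.1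
  refine ⟨hσ0, le_antisymm ?_ ?_⟩
  · exact (arrivalCount_mono h.mono n (csInf_le hbdd hxS)).trans hcx.le
  · -- by right-continuity the infimum is attained
    by_contra! hlt
    have hev : ∀ᶠ y in 𝓝[≥] (Real.toNNReal (n * sInf S)), arr y = arr (Real.toNNReal (n * sInf S)) :=
      h.rightCont _ (mem_nhds_discrete.2 (mem_singleton _))
    have hcont : Tendsto (fun t : ℝ => Real.toNNReal (n * t)) (𝓝[≥] (sInf S))
        (𝓝[≥] (Real.toNNReal (n * sInf S))) := by
      apply tendsto_nhdsWithin_of_tendsto_nhds_of_eventually_within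
      · exact ((continuous_real_toNNReal.comp (continuous_const.mul continuous_id)).tendsto
          _).mono_left nhdsWithin_le_nhds
      · filter_upwards [self_mem_nhdsWithin] with t ht
        exact Real.toNNReal_le_toNNReal (by gcongr; exact ht)
    obtain ⟨b, hb, hball⟩ := mem_nhdsGE_iff_exists_Ico_subset.1 (hcont.eventually hev)
    obtain ⟨t, htS, htb⟩ := exists_lt_of_csInf_lt ⟨_, hxS⟩ hb
    have h1 : arrivalCount arr n t = arrivalCount arr n (sInf S) := hball ⟨csInf_le hbdd htS, htb⟩
    have h2 := htS.2
    rw [h1] at h2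
    exact absurd hlt (not_lt.2 h2)

lemma IsArrivalClock.le_arrivalCount_iff (h : IsArrivalClock arr) (hn : 1 ≤ n) {j : ℕ} {t : ℝ}
    (ht : 0 ≤ t) : j ≤ arrivalCount arr n t ↔ arrivalTime arr n j ≤ t := by
  constructor
  · intro hj
    exact csInf_le ⟨0, fun t ht => ht.1⟩ ⟨ht, hj⟩
  · intro hj
    have := arrivalCount_mono h.mono n hj
    rwa [(h.arrivalCount_arrivalTime hn j).2] at this

lemma IsArrivalClock.arrivalTime_nonneg (h : IsArrivalClock arr) (hn : 1 ≤ n) (j : ℕ) :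
    0 ≤ arrivalTime arr n j := (h.arrivalCount_arrivalTime hn j).1

lemma IsArrivalClock.arrivalTime_strictMono (h : IsArrivalClock arr) (hn : 1 ≤ n) :
    StrictMono (arrivalTime arr n) := by
  intro i j hij
  by_contra! hle
  have := arrivalCount_mono h.mono n hle
  rw [(h.arrivalCount_arrivalTime hn j).2, (h.arrivalCount_arrivalTime hn i).2] at this
  omega

lemma IsArrivalClock.arrivalTime_zero (h : IsArrivalClock arr) (hn : 1 ≤ n) :
    arrivalTime arr n 0 = 0 :=
  le_antisymm ((h.le_arrivalCount_iff hn le_rfl).1 (Nat.zero_le _)) (h.arrivalTime_nonneg hn 0)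

lemma IsArrivalClock.arrivalTime_pos (h : IsArrivalClock arr) (hn : 1 ≤ n) {j : ℕ} (hj : 1 ≤ j) :
    0 < arrivalTime arr n j := by
  rw [← h.arrivalTime_zero hn]
  exact h.arrivalTime_strictMono hn hj

/-- The number of arrivals up to `t` is `j` exactly when `t` lies in `[σ_{nj}, σ_{n,j+1})`. -/
lemma IsArrivalClock.arrivalCount_eq (h : IsArrivalClock arr) (hn : 1 ≤ n) {j : ℕ} {t : ℝ}
    (h1 : arrivalTime arr n j ≤ t) (h2 : t < arrivalTime arr n (j + 1)) :
    arrivalCount arr n t = j := by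
  have ht : 0 ≤ t := (h.arrivalTime_nonneg hn j).trans h1
  have h3 := (h.le_arrivalCount_iff hn ht).2 h1
  have h4 : ¬ (j + 1 ≤ arrivalCount arr n t) := fun h5 =>
    absurd ((h.le_arrivalCount_iff hn ht).1 h5) (not_le.2 h2)
  omega

end Epochs

/-! ### Path properties of the systems with finitely many server pools -/

lemma IsCadlagOn.tendsto_leftLim {E : Type*} [TopologicalSpace E] {f : ℝ → E}
    (hf : IsCadlagOn f (Ici 0)) {t : ℝ} (ht : 0 < t) :
    Tendsto f (𝓝[<] t) (𝓝 (Function.leftLim f t)) := by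
  obtain ⟨l, hl⟩ := (hf t ht.le).2
  refine tendsto_leftLim_of_tendsto ⟨l, ?_⟩
  have : 𝓝[Ici 0 ∩ Iio t] t = 𝓝[<] t := by
    rw [inter_comm]
    exact nhdsWithin_inter_of_mem' (mem_nhdsWithin_of_mem_nhds (Ici_mem_nhds ht))
  rwa [this] at hl

/-- A right-continuous function is the limit of the step functions that read its values at the next
point of a grid to the right. -/
lemma measurable_of_rightCont {f : ℝ → ℝ} (hf : ∀ t, ContinuousWithinAt f (Ici t) t) :
    Measurable f := by
  have hm : ∀ k : ℕ, Measurable fun t : ℝ => f (((⌊(k + 1 : ℝ) * t⌋ : ℝ) + 1) / (k + 1)) := by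
    intro k
    have h1 : Measurable fun z : ℤ => f (((z : ℝ) + 1) / (k + 1)) := measurable_from_top
    exact h1.comp (Int.measurable_floor.comp (measurable_const.mul measurable_id))
  refine measurable_of_tendsto_metrizable hm (tendsto_pi_nhds.2 fun t => ?_)
  refine (hf t).tendsto.comp ?_
  have hk : ∀ k : ℕ, (0 : ℝ) < k + 1 := fun k => by positivity
  apply tendsto_nhdsWithin_of_tendsto_nhds_of_eventually_within
  · have h0 : Tendsto (fun k : ℕ => t + 1 / ((k : ℝ) + 1)) atTop (𝓝 t) := by
      simpa using tendsto_const_nhds.add (tendsto_one_div_add_atTop_nhds_zero_nat (𝕜 := ℝ))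
    refine tendsto_of_tendsto_of_tendsto_of_le_of_le tendsto_const_nhds h0 (fun k => ?_)
      (fun k => ?_)
    · show t ≤ _
      rw [le_div_iff₀ (hk k)]
      have := Int.lt_floor_add_one ((k + 1 : ℝ) * t)
      linarith
    · show _ ≤ t + 1 / ((k : ℝ) + 1)
      rw [div_le_iff₀ (hk k), add_mul t, one_div, inv_mul_cancel₀ (hk k).ne']
      have := Int.floor_le ((k + 1 : ℝ) * t)
      linarith
  · refine Eventually.of_forall fun k => ?_
    show t ≤ _
    rw [le_div_iff₀ (hk k)]
    have := Int.lt_floor_add_one ((k + 1 : ℝ) * t)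
    linarith

lemma mem_occupancySpace_of_tendsto {ι : Type*} {f : Filter ι} [f.NeBot] {p : ι → ℕ → ℝ}
    {l : ℕ → ℝ} (hp : ∀ᶠ k in f, p k ∈ occupancySpace)
    (hl : ∀ i, Tendsto (fun k => p k i) f (𝓝 (l i))) : l ∈ occupancySpace := by
  refine ⟨?_, fun i => ?_, fun i => ?_⟩
  · exact tendsto_nhds_unique (hl 0) (tendsto_const_nhds.congr' (hp.mono fun k hk => hk.1.symm))
  · exact isClosed_Icc.mem_of_tendsto (hl i) (hp.mono fun k hk => hk.2.1 i)
  · exact le_of_tendsto_of_tendsto (hl (i + 1)) (hl i) (hp.mono fun k hk => hk.2.2 i)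

lemma occupancySpace_antitone {p : ℕ → ℝ} (hp : p ∈ occupancySpace) : Antitone p :=
  antitone_nat_of_succ_le hp.2.2

lemma routing_nonneg (v : ℝ) (p : ℕ → ℝ) (m i : ℕ) : 0 ≤ routing v p m i := by
  unfold routing
  split_ifs <;> norm_num

/-- The number of selected classes among `1, …, k` is read off the position of the selection
variable relative to a single threshold, as the selection intervals are adjacent. -/
lemma sum_interval {v : ℝ} (hv : 0 ≤ v) {g : ℕ → ℝ} (hg : Monotone g) (hg0 : g 0 = 0) (k : ℕ) :
    ∑ i ∈ Finset.Icc 1 k, (if v ∈ Ico (g (i - 1)) (g i) then (1 : ℝ) else 0)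
      = if v < g k then 1 else 0 := by
  induction k with
  | zero => simp [hg0, hv]
  | succ k ih =>
    rw [Finset.sum_Icc_succ_top (by omega), ih]
    have := hg (Nat.le_succ k)
    simp only [Nat.add_sub_cancel, mem_Ico, Nat.succ_eq_add_one] at this ⊢
    by_cases h1 : v < g k
    · simp [h1, h1.trans_le this]
    · simp [h1, not_lt.1 h1]

lemma routing_of_full {v : ℝ} {p : ℕ → ℝ} {m i : ℕ} (h1 : p (m + 1) < 1) (hi : m + 1 < i) :
    routing v p m i = 0 := by
  unfold routing
  rw [if_neg (by omega), if_neg (by omega), if_neg]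
  exact fun h => absurd h.1 h1.ne

/-- As long as some server pool has at most `m` tasks, each task is sent to such a pool. -/
lemma sum_routing_eq_one {v : ℝ} (hv : v ∈ Ico (0 : ℝ) 1) {p : ℕ → ℝ} (hp : p ∈ occupancySpace)
    {m : ℕ} (h1 : p (m + 1) < 1) : ∑ i ∈ Finset.Icc 1 (m + 1), routing v p m i = 1 := by
  rw [Finset.sum_Icc_succ_top (by omega)]
  by_cases hm : p m < 1
  · have h0 : routing v p m (m + 1) = 0 := by
      unfold routing
      rw [if_neg (by omega), if_pos rfl, if_neg]
      exact fun h => absurd h.1 hm.ne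
    have hpos : 0 < 1 - p m := by linarith
    have hs := sum_interval hv.1 (g := fun i => (1 - p i) / (1 - p m))
      (fun a b hab => by
        have := occupancySpace_antitone hp hab
        show (1 - p a) / (1 - p m) ≤ (1 - p b) / (1 - p m)
        gcongr) (by simp [hp.1]) m
    rw [h0, add_zero]
    simp only [div_self hpos.ne', hv.2, if_true] at hs
    rw [← hs]
    refine Finset.sum_congr rfl fun i hi => ?_
    have := (Finset.mem_Icc.1 hi).2
    unfold routing
    rw [if_pos this]
    simp [hm]
  · have hm1 : p m = 1 := le_antisymm (hp.2.1 m).2 (not_lt.1 hm)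
    have h0 : ∑ i ∈ Finset.Icc 1 m, routing v p m i = 0 := by
      refine Finset.sum_eq_zero fun i hi => ?_
      have := (Finset.mem_Icc.1 hi).2
      unfold routing
      rw [if_pos this, if_neg]
      exact fun h => hm h.1
    rw [h0, zero_add]
    unfold routing
    rw [if_neg (by omega), if_pos rfl, if_pos ⟨hm1, h1⟩]

/-- Each task is sent to at most one server pool. -/
lemma sum_routing_le_one {v : ℝ} (hv : v ∈ Ico (0 : ℝ) 1) {p : ℕ → ℝ} (hp : p ∈ occupancySpace)
    (m k : ℕ) : ∑ i ∈ Finset.Icc 1 k, routing v p m i ≤ 1 := by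
  by_cases h1 : p (m + 1) < 1
  · calc ∑ i ∈ Finset.Icc 1 k, routing v p m i
        ≤ ∑ i ∈ Finset.Icc 1 (max k (m + 1)), routing v p m i :=
          Finset.sum_le_sum_of_subset_of_nonneg
            (Finset.Icc_subset_Icc le_rfl (le_max_left _ _)) fun i _ _ => routing_nonneg _ _ _ _
      _ = ∑ i ∈ Finset.Icc 1 (m + 1), routing v p m i := by
          refine (Finset.sum_subset (Finset.Icc_subset_Icc le_rfl (le_max_right _ _))
            fun i hi hi' => routing_of_full h1 ?_).symm
          simp only [Finset.mem_Icc] at hi hi'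
          omega
      _ ≤ 1 := (sum_routing_eq_one hv hp h1).le
  · have h1' : p (m + 1) = 1 := le_antisymm (hp.2.1 _).2 (not_lt.1 h1)
    have hm1 : p m = 1 := le_antisymm (hp.2.1 _).2 (h1'.symm.le.trans (hp.2.2 m))
    have hs := sum_interval hv.1 (g := fun i => 1 - p i)
      (fun a b hab => by
        have := occupancySpace_antitone hp hab
        show 1 - p a ≤ 1 - p b
        gcongr) (by simp [hp.1]) k
    refine le_trans (Finset.sum_le_sum fun i _ => ?_) (hs.le.trans (by split_ifs <;> norm_num))
    unfold routing
    simp only [hm1, h1', lt_irrefl, false_and, if_false, and_false, true_and]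
    split_ifs <;> norm_num

section System

variable {α : ℝ} {n : ℕ} {clock : ℕ → ℝ≥0 → ℕ} {u : ℕ → ℝ} {q₀ : ℕ → ℝ} {ℓ₀ : ℕ}
  {q : ℝ → ℕ → ℝ} {ℓ : ℝ → ℕ}

lemma IsDiscreteSystem.tendsto_leftLim (h : IsDiscreteSystem α n clock u q₀ ℓ₀ q ℓ) {t : ℝ}
    (ht : 0 < t) (i : ℕ) :
    Tendsto (fun s => q s i) (𝓝[<] t) (𝓝 (Function.leftLim q t i)) :=
  (tendsto_pi_nhds.1 (h.cadlag_occupancy.tendsto_leftLim ht)) i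

lemma eventually_nonneg_left {t : ℝ} (ht : 0 < t) : ∀ᶠ s in 𝓝[<] t, 0 ≤ s :=
  mem_nhdsWithin_of_mem_nhds (Ici_mem_nhds ht)

lemma IsDiscreteSystem.leftLim_mem (h : IsDiscreteSystem α n clock u q₀ ℓ₀ q ℓ) {t : ℝ}
    (ht : 0 < t) : Function.leftLim q t ∈ occupancySpace :=
  mem_occupancySpace_of_tendsto ((eventually_nonneg_left ht).mono fun s hs => h.mem s hs)
    (h.tendsto_leftLim ht)

/-- The threshold is constant between two arrivals. -/
lemma IsDiscreteSystem.threshold_eq (h : IsDiscreteSystem α n clock u q₀ ℓ₀ q ℓ)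
    (hc : IsArrivalClock (clock 0)) (hn : 1 ≤ n) {j : ℕ} {t : ℝ}
    (h1 : arrivalTime (clock 0) n j ≤ t) (h2 : t < arrivalTime (clock 0) n (j + 1)) :
    ℓ t = ℓ (arrivalTime (clock 0) n j) := by
  have h0 := hc.arrivalTime_nonneg hn j
  have e1 := h.threshold t (h0.trans h1)
  have e2 := h.threshold _ h0
  rw [hc.arrivalCount_eq hn h1 h2] at e1
  rw [(hc.arrivalCount_arrivalTime hn j).2] at e2
  exact_mod_cast e1.trans e2.symm

lemma IsDiscreteSystem.leftLim_threshold (h : IsDiscreteSystem α n clock u q₀ ℓ₀ q ℓ)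
    (hc : IsArrivalClock (clock 0)) (hn : 1 ≤ n) (j : ℕ) :
    Function.leftLim ℓ (arrivalTime (clock 0) n (j + 1)) = ℓ (arrivalTime (clock 0) n j) := by
  refine leftLim_eq_of_tendsto (tendsto_const_nhds.congr' ?_)
  have := hc.arrivalTime_strictMono hn (Nat.lt_succ_self j)
  filter_upwards [Ioo_mem_nhdsLT this] with t ht
  exact (h.threshold_eq hc hn ht.1.le ht.2).symm

lemma IsDiscreteSystem.threshold_succ (h : IsDiscreteSystem α n clock u q₀ ℓ₀ q ℓ)
    (hc : IsArrivalClock (clock 0)) (hn : 1 ≤ n) (j : ℕ) :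
    (ℓ (arrivalTime (clock 0) n (j + 1)) : ℤ) = ℓ (arrivalTime (clock 0) n j) +
      thresholdChange α n (Function.leftLim q (arrivalTime (clock 0) n (j + 1)))
        (ℓ (arrivalTime (clock 0) n j)) := by
  have e1 := h.threshold _ (hc.arrivalTime_nonneg hn (j + 1))
  have e2 := h.threshold _ (hc.arrivalTime_nonneg hn j)
  rw [(hc.arrivalCount_arrivalTime hn _).2] at e1 e2
  rw [Finset.sum_Icc_succ_top (by omega), ← add_assoc, ← e2, h.leftLim_threshold hc hn] at e1
  exact e1

lemma IsDiscreteSystem.arrivals_sub (h : Monotone (clock 0)) {s t : ℝ} (hst : s ≤ t) {i : ℕ}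
    (hi : i ≠ 0) :
    arrivals n (clock 0) u q ℓ t i - arrivals n (clock 0) u q ℓ s i
      = (∑ j ∈ Finset.Ioc (arrivalCount (clock 0) n s) (arrivalCount (clock 0) n t),
          routing (u j) (Function.leftLim q (arrivalTime (clock 0) n j))
            (Function.leftLim ℓ (arrivalTime (clock 0) n j)) i) / n := by
  have hle := arrivalCount_mono h n hst
  simp only [arrivals, if_neg hi]
  have hsub : Finset.Icc 1 (arrivalCount (clock 0) n s)
      ⊆ Finset.Icc 1 (arrivalCount (clock 0) n t) := Finset.Icc_subset_Icc le_rfl hle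
  rw [← Finset.sum_sdiff hsub]
  have : Finset.Icc 1 (arrivalCount (clock 0) n t) \ Finset.Icc 1 (arrivalCount (clock 0) n s)
      = Finset.Ioc (arrivalCount (clock 0) n s) (arrivalCount (clock 0) n t) := by
    ext j; simp only [Finset.mem_sdiff, Finset.mem_Icc, Finset.mem_Ioc]; omega
  rw [this]
  ring

/-- The time is truncated at `0` because nothing is known about `q` at negative times. -/
lemma IsDiscreteSystem.measurable_coord (h : IsDiscreteSystem α n clock u q₀ ℓ₀ q ℓ) (i : ℕ) :
    Measurable fun t => q (max t 0) i := by
  refine measurable_of_rightCont fun t => ?_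
  have h1 := (h.cadlag_occupancy (max t 0) (show (0 : ℝ) ≤ _ from le_max_right _ _)).1
  have h2 : ContinuousWithinAt (fun s => q s i) (Ici 0 ∩ Ici (max t 0)) (max t 0) :=
    (continuous_apply i).continuousAt.comp_continuousWithinAt h1
  refine ContinuousWithinAt.comp (g := fun s => q s i) (f := fun s => max s 0) h2
    (continuous_id.max continuous_const).continuousWithinAt fun s hs => ?_
  exact ⟨show (0 : ℝ) ≤ max s 0 from le_max_right _ _, show max t 0 ≤ max s 0 from max_le_max hs le_rfl⟩

lemma IsDiscreteSystem.intervalIntegrable (h : IsDiscreteSystem α n clock u q₀ ℓ₀ q ℓ) (i : ℕ)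
    {s t : ℝ} (hs : 0 ≤ s) (ht : 0 ≤ t) :
    IntervalIntegrable (fun r => q r i) volume s t := by
  have h1 : IntervalIntegrable (fun r => q (max r 0) i) volume s t := by
    refine IntervalIntegrable.mono_fun (g := fun r => q (max r 0) i)
      (intervalIntegrable_const (c := (1 : ℝ))) (h.measurable_coord i).aestronglyMeasurable
      (Eventually.of_forall fun r => ?_)
    have := (h.mem (max r 0) (le_max_right _ _)).2.1 i
    simp only [Real.norm_eq_abs, abs_of_nonneg this.1, abs_one]
    exact this.2
  refine h1.congr fun r hr => ?_
  have : 0 ≤ r := (le_min hs ht).trans hr.1.le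
  simp [this]

/-- The cumulative departure intensity from the server pools with exactly `i` tasks. -/
def intensity (q : ℝ → ℕ → ℝ) (i : ℕ) (t : ℝ) : ℝ :=
  ∫ s in (0 : ℝ)..t, (i : ℝ) * (q s i - q s (i + 1))

lemma intensity_bounds {q : ℝ → ℕ → ℝ} (hmem : ∀ t, 0 ≤ t → q t ∈ occupancySpace)
    (hint : ∀ i s t, 0 ≤ s → 0 ≤ t → IntervalIntegrable (fun r => q r i) volume s t)
    (i : ℕ) {s t : ℝ} (hs : 0 ≤ s) (hst : s ≤ t) :
    0 ≤ intensity q i t - intensity q i s ∧ intensity q i t - intensity q i s ≤ i * (t - s) := by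
  have hI : ∀ a b, 0 ≤ a → 0 ≤ b →
      IntervalIntegrable (fun r => (i : ℝ) * (q r i - q r (i + 1))) volume a b :=
    fun a b ha hb => ((hint i a b ha hb).sub (hint (i + 1) a b ha hb)).const_mul _
  have heq : intensity q i t - intensity q i s
      = ∫ r in s..t, (i : ℝ) * (q r i - q r (i + 1)) :=
    intervalIntegral.integral_interval_sub_left (hI _ _ le_rfl (hs.trans hst)) (hI _ _ le_rfl hs)
  rw [heq]
  constructor
  · refine intervalIntegral.integral_nonneg hst fun r hr => ?_
    have := (hmem r (hs.trans hr.1)).2.2 i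
    exact mul_nonneg (Nat.cast_nonneg _) (by linarith)
  · calc ∫ r in s..t, (i : ℝ) * (q r i - q r (i + 1)) ≤ ∫ r in s..t, (i : ℝ) := by
          refine intervalIntegral.integral_mono_on hst (hI _ _ hs (hs.trans hst)) (by simp)
            fun r hr => ?_
          have h1 := ((hmem r (hs.trans hr.1)).2.1 i).2
          have h2 := ((hmem r (hs.trans hr.1)).2.1 (i + 1)).1
          have : q r i - q r (i + 1) ≤ 1 := by linarith
          nlinarith [Nat.cast_nonneg (α := ℝ) i]
      _ = i * (t - s) := by simp [mul_comm]

end System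

/-- The uniform law of large numbers on compact time intervals. -/
lemma HasRate.uniform {N : ℝ≥0 → ℕ} {r : ℝ} (h : HasRate N r) (M : ℝ) {ε : ℝ} (hε : 0 < ε) :
    ∀ᶠ n : ℕ in atTop, ∀ t ∈ Icc 0 M, |(N (Real.toNNReal (n * t)) : ℝ) / n - r * t| ≤ ε := by
  rcases lt_or_ge M 0 with hM | hM
  · exact Eventually.of_forall fun n t ht => absurd (ht.1.trans ht.2) (not_le.2 hM)
  obtain ⟨C, hC⟩ := h (ε / (2 * (M + 1))) (by positivity)
  obtain ⟨K, hK⟩ := exists_nat_gt (2 * C / ε)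
  filter_upwards [eventually_ge_atTop (max K 1)] with n hn t ht
  have hn1 : (0 : ℝ) < n := by exact_mod_cast (le_max_right K 1).trans hn
  have hn2 : (K : ℝ) ≤ n := by exact_mod_cast (le_max_left K 1).trans hn
  have hx := hC (Real.toNNReal (n * t))
  rw [Real.coe_toNNReal _ (mul_nonneg hn1.le ht.1)] at hx
  have e1 : (N (Real.toNNReal (n * t)) : ℝ) / n - r * t
      = ((N (Real.toNNReal (n * t)) : ℝ) - r * (n * t)) / n := by field_simp
  rw [e1, abs_div, abs_of_pos hn1, div_le_iff₀ hn1]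
  have h2 : C ≤ ε / 2 * n := by
    have : 2 * C / ε < n := hK.trans_le hn2
    rw [div_lt_iff₀ hε] at this
    linarith
  have h3 : ε / (2 * (M + 1)) * (n * t) ≤ ε / 2 * n := by
    have : ε / (2 * (M + 1)) * (n * t) = ε / 2 * n * (t / (M + 1)) := by field_simp
    rw [this]
    have h4 : t / (M + 1) ≤ 1 := by rw [div_le_one (by linarith)]; linarith [ht.2]
    have h5 : 0 ≤ ε / 2 * n := by positivity
    nlinarith
  linarith

end ThresholdBalancing

namespace ThresholdBalancing

/-! ### Limits of the occupancy processes along an ultrafilter -/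

/-- A realization of the systems for all numbers `n` of server pools at which the almost sure
properties of the clocks, of the selection variables and of the initial conditions hold. All
arguments below are about a fixed realization of this kind. -/
structure GoodRun (lam α : ℝ) (clock : ℕ → ℝ≥0 → ℕ) (u : ℕ → ℝ) (q₀ : ℕ → ℝ) (ℓ₀ : ℕ)
    (q : ℕ → ℝ → ℕ → ℝ) (ℓ : ℕ → ℝ → ℕ) : Prop where
  lam_pos : 0 < lam
  alpha_lt : α < 1
  arr : IsArrivalClock (clock 0)
  arr_rate : HasRate (clock 0) lam
  dep_rate : ∀ i, 1 ≤ i → HasRate (clock i) 1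
  sel_mem : ∀ j, u j ∈ Ico (0 : ℝ) 1
  sel_lln : ∀ c ∈ Icc (0 : ℝ) 1, Tendsto (fun m : ℕ => empirical u c m / m) atTop (𝓝 c)
  sys : ∀ n, 1 ≤ n → IsDiscreteSystem α n clock u (q n 0) (ℓ n 0) (q n) (ℓ n)
  q_init : Tendsto (fun n => q n 0) atTop (𝓝 q₀)
  ℓ_init : ∀ᶠ n in atTop, ℓ n 0 = ℓ₀
  alpha_lt_init : α < q₀ ℓ₀
  init_lt_one : q₀ (ℓ₀ + 1) < 1

variable {lam α : ℝ} {clock : ℕ → ℝ≥0 → ℕ} {u : ℕ → ℝ} {q₀ : ℕ → ℝ} {ℓ₀ : ℕ}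
  {q : ℕ → ℝ → ℕ → ℝ} {ℓ : ℕ → ℝ → ℕ}

lemma routing_le_one (v : ℝ) (p : ℕ → ℝ) (m i : ℕ) : routing v p m i ≤ 1 := by
  unfold routing
  split_ifs <;> norm_num

lemma GoodRun.departures_close (h : GoodRun lam α clock u q₀ ℓ₀ q ℓ) (i : ℕ) (M : ℝ) {ε : ℝ}
    (hε : 0 < ε) : ∀ᶠ n in atTop, ∀ t ∈ Icc 0 M,
      |departures n clock (q n) t i - intensity (q n) i t| ≤ ε := by
  rcases Nat.eq_zero_or_pos i with rfl | hi
  · refine Eventually.of_forall fun n t ht => ?_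
    simp [departures, intensity, hε.le]
  filter_upwards [(h.dep_rate i hi).uniform (i * M) hε, eventually_ge_atTop 1] with n hn hn1 t ht
  have hs := h.sys n hn1
  have hb := intensity_bounds hs.mem (fun i s t => hs.intervalIntegrable i) i le_rfl ht.1
  have h0 : intensity (q n) i 0 = 0 := by simp [intensity]
  rw [h0, sub_zero, sub_zero] at hb
  have := hn (intensity (q n) i t) ⟨hb.1, hb.2.trans (by gcongr; exact ht.2)⟩
  rw [one_mul] at this
  rw [departures, if_neg (by omega), one_div, inv_mul_eq_div]
  exact this

/-- The occupancy processes are asymptotically Lipschitz. -/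
lemma GoodRun.increment_le (h : GoodRun lam α clock u q₀ ℓ₀ q ℓ) (i : ℕ) (M : ℝ) {ε : ℝ}
    (hε : 0 < ε) : ∀ᶠ n in atTop, ∀ s ∈ Icc 0 M, ∀ t ∈ Icc 0 M, s ≤ t →
      |q n t i - q n s i| ≤ (lam + i) * (t - s) + ε := by
  filter_upwards [h.departures_close i M (ε := ε / 4) (by positivity),
    h.arr_rate.uniform M (ε := ε / 4) (by positivity), eventually_ge_atTop 1] with n h1 h2 hn s hs t ht
    hst
  have hsys := h.sys n hn
  have hb := intensity_bounds hsys.mem (fun i s t => hsys.intervalIntegrable i) i hs.1 hst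
  have e1 := hsys.occupancy t ht.1 i
  have e2 := hsys.occupancy s hs.1 i
  have d1 := abs_le.1 (h1 t ht)
  have d2 := abs_le.1 (h1 s hs)
  have a1 := abs_le.1 (h2 t ht)
  have a2 := abs_le.1 (h2 s hs)
  have ha : 0 ≤ arrivals n (clock 0) u (q n) (ℓ n) t i - arrivals n (clock 0) u (q n) (ℓ n) s i ∧
      arrivals n (clock 0) u (q n) (ℓ n) t i - arrivals n (clock 0) u (q n) (ℓ n) s i
        ≤ lam * (t - s) + ε / 2 := by
    rcases eq_or_ne i 0 with rfl | hi
    · have : 0 ≤ lam * (t - s) := mul_nonneg h.lam_pos.le (by linarith)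
      simp only [arrivals, if_true, sub_self, le_refl, true_and]
      linarith
    rw [IsDiscreteSystem.arrivals_sub h.arr.mono hst hi]
    refine ⟨div_nonneg (Finset.sum_nonneg fun j _ => routing_nonneg _ _ _ _) (Nat.cast_nonneg _),
      ?_⟩
    have hle := arrivalCount_mono h.arr.mono n hst
    have : (∑ j ∈ Finset.Ioc (arrivalCount (clock 0) n s) (arrivalCount (clock 0) n t),
          routing (u j) (Function.leftLim (q n) (arrivalTime (clock 0) n j))
            (Function.leftLim (ℓ n) (arrivalTime (clock 0) n j)) i)
        ≤ (arrivalCount (clock 0) n t : ℝ) - arrivalCount (clock 0) n s := by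
      refine (Finset.sum_le_card_nsmul _ _ 1 fun j _ => routing_le_one _ _ _ _).trans ?_
      rw [Nat.card_Ioc, nsmul_eq_mul, mul_one, Nat.cast_sub hle]
    refine (div_le_div_of_nonneg_right this (Nat.cast_nonneg n)).trans ?_
    rw [sub_div]
    unfold arrivalCount
    linarith
  rw [abs_le]
  constructor <;> nlinarith [Nat.cast_nonneg (α := ℝ) i, h.lam_pos]

/-- `x` is the limit of the occupancy processes along the ultrafilter `U`, uniformly on compact time
intervals for each coordinate. At negative times `x` is merely a Lipschitz extension. -/
structure IsOccupancyLimit (lam : ℝ) (U : Ultrafilter ℕ) (q₀ : ℕ → ℝ) (q : ℕ → ℝ → ℕ → ℝ)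
    (x : ℝ → ℕ → ℝ) : Prop where
  le_atTop : (U : Filter ℕ) ≤ atTop
  lipschitz : ∀ i s t, |x t i - x s i| ≤ (lam + i) * |t - s|
  close : ∀ i M ε, 0 < ε → ∀ᶠ n in U, ∀ t ∈ Icc 0 M, |q n t i - x t i| ≤ ε
  init : x 0 = q₀

/-- Pointwise limits exist by compactness of `[0, 1]`; the convergence is uniform on compact time
intervals because the processes are asymptotically Lipschitz. -/
theorem GoodRun.exists_limit (h : GoodRun lam α clock u q₀ ℓ₀ q ℓ) {U : Ultrafilter ℕ}
    (hU : (U : Filter ℕ) ≤ atTop) : ∃ x, IsOccupancyLimit lam U q₀ q x := by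
  have hpos : ∀ i : ℕ, 0 < lam + i := fun i => add_pos_of_pos_of_nonneg h.lam_pos (Nat.cast_nonneg i)
  have hlim : ∀ t i, ∃ l, Tendsto (fun n => q n (max t 0) i) U (𝓝 l) := by
    intro t i
    have hmem : ↑(U.map (fun n => q n (max t 0) i)) ≤ 𝓟 (Icc (0 : ℝ) 1) := by
      rw [le_principal_iff]
      refine (Eventually.filter_mono hU (eventually_ge_atTop 1)).mono fun n hn =>
        ((h.sys n hn).mem _ (le_max_right _ _)).2.1 i
    obtain ⟨l, -, hl⟩ := isCompact_Icc.ultrafilter_le_nhds _ hmem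
    exact ⟨l, hl⟩
  choose x hx using hlim
  have hlip0 : ∀ i s t, s ≤ t → |x t i - x s i| ≤ (lam + i) * |t - s| := by
    intro i s t hst
    refine le_of_forall_pos_le_add fun ε hε => ?_
    have hT : Tendsto (fun n => |q n (max t 0) i - q n (max s 0) i|) U (𝓝 |x t i - x s i|) :=
      ((hx t i).sub (hx s i)).abs
    refine le_of_tendsto hT ((Eventually.filter_mono hU (h.increment_le i (max t 0) hε)).mono fun n hn => ?_)
    have hmm : max s 0 ≤ max t 0 := max_le_max hst le_rfl
    refine (hn (max s 0) ⟨le_max_right _ _, hmm⟩ (max t 0) ⟨le_max_right _ _, le_rfl⟩ hmm).trans ?_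
    have h1 : max t 0 - max s 0 ≤ |t - s| :=
      (le_abs_self _).trans (abs_max_sub_max_le_abs t s 0)
    have := (hpos i).le
    gcongr
  have hlip : ∀ i s t, |x t i - x s i| ≤ (lam + i) * |t - s| := by
    intro i s t
    rcases le_total s t with hst | hst
    · exact hlip0 i s t hst
    · rw [abs_sub_comm, abs_sub_comm t]
      exact hlip0 i t s hst
  refine ⟨x, hU, hlip, ?_, ?_⟩
  · intro i M ε hε
    rcases lt_or_ge M 0 with hM | hM
    · exact Eventually.of_forall fun n t ht => absurd (ht.1.trans ht.2) (not_le.2 hM)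
    -- compare on a grid whose mesh matches the Lipschitz constant
    set δ := ε / (4 * (lam + i)) with hδ
    have hδ0 : 0 < δ := div_pos hε (mul_pos (by norm_num) (hpos i))
    have hgrid : ∀ᶠ n in (U : Filter ℕ), ∀ k ∈ Finset.range (⌊M / δ⌋₊ + 1),
        |q n (k * δ) i - x (k * δ) i| ≤ ε / 4 := by
      rw [Filter.eventually_all_finset]
      intro k _
      have h0 : (0 : ℝ) ≤ k * δ := by positivity
      have := hx (k * δ) i
      rw [max_eq_left h0] at this
      exact ((Metric.tendsto_nhds.1 this) (ε / 4) (by positivity)).mono fun n hn => hn.le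
    filter_upwards [hgrid, Eventually.filter_mono hU (h.increment_le i M (ε := ε / 4) (by positivity))]
      with n h1 h2 t ht
    have hk := h1 ⌊t / δ⌋₊ (Finset.mem_range.2
      (Nat.lt_succ_of_le (Nat.floor_le_floor (div_le_div_of_nonneg_right ht.2 hδ0.le))))
    have hs1 : (⌊t / δ⌋₊ : ℝ) * δ ≤ t := by
      rw [← le_div_iff₀ hδ0]; exact Nat.floor_le (div_nonneg ht.1 hδ0.le)
    have hs2 : t ≤ (⌊t / δ⌋₊ : ℝ) * δ + δ := by
      have := (Nat.lt_floor_add_one (t / δ)).le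
      rw [div_le_iff₀ hδ0] at this
      linarith
    set s := (⌊t / δ⌋₊ : ℝ) * δ
    have hs0 : 0 ≤ s := by positivity
    have e1 := h2 s ⟨hs0, hs1.trans ht.2⟩ t ht hs1
    have e2 := hlip i s t
    rw [abs_of_nonneg (by linarith : 0 ≤ t - s)] at e2
    have e3 : (lam + i) * (t - s) ≤ ε / 4 := by
      calc (lam + i) * (t - s) ≤ (lam + i) * δ :=
            mul_le_mul_of_nonneg_left (by linarith) (hpos i).le
        _ = ε / 4 := by rw [hδ]; have := (hpos i).ne'; field_simp
    rw [abs_le] at e1 e2 hk ⊢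
    constructor <;> linarith [e1.1, e1.2, e2.1, e2.2, hk.1, hk.2]
  · ext i
    have h1 := hx 0 i
    rw [max_self] at h1
    exact tendsto_nhds_unique h1 ((tendsto_pi_nhds.1 (h.q_init.mono_left hU)) i)

/-- The cumulative fluid arrivals to the server pools with exactly `i - 1` tasks, read off from the
occupancy limit `x` by adding the departures. -/
def fluidArrivals (x : ℝ → ℕ → ℝ) (i : ℕ) (t : ℝ) : ℝ := x t i - x 0 i + intensity x i t

section Limit

variable {U : Ultrafilter ℕ} {x : ℝ → ℕ → ℝ}

lemma IsOccupancyLimit.eventually_one_le (hx : IsOccupancyLimit lam U q₀ q x) :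
    ∀ᶠ n in U, 1 ≤ n := Eventually.filter_mono hx.le_atTop (eventually_ge_atTop 1)

lemma IsOccupancyLimit.tendsto (hx : IsOccupancyLimit lam U q₀ q x) {t : ℝ} (ht : 0 ≤ t) (i : ℕ) :
    Tendsto (fun n => q n t i) U (𝓝 (x t i)) := by
  rw [Metric.tendsto_nhds]
  intro ε hε
  filter_upwards [hx.close i t (ε / 2) (by positivity)] with n hn
  rw [Real.dist_eq]
  linarith [hn t ⟨ht, le_rfl⟩]

lemma IsOccupancyLimit.lipschitzWith (hx : IsOccupancyLimit lam U q₀ q x) (i : ℕ) :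
    LipschitzWith (lam + i).toNNReal fun t => x t i := by
  refine LipschitzWith.of_dist_le_mul fun s t => ?_
  rw [Real.dist_eq, Real.dist_eq]
  refine (hx.lipschitz i t s).trans ?_
  gcongr
  exact Real.le_coe_toNNReal _

lemma IsOccupancyLimit.continuous (hx : IsOccupancyLimit lam U q₀ q x) (i : ℕ) :
    Continuous fun t => x t i := (hx.lipschitzWith i).continuous

lemma IsOccupancyLimit.mem (hx : IsOccupancyLimit lam U q₀ q x)
    (h : GoodRun lam α clock u q₀ ℓ₀ q ℓ) {t : ℝ} (ht : 0 ≤ t) : x t ∈ occupancySpace :=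
  mem_occupancySpace_of_tendsto (hx.eventually_one_le.mono fun n hn => (h.sys n hn).mem t ht)
    (hx.tendsto ht)

lemma IsOccupancyLimit.leftLim_close (hx : IsOccupancyLimit lam U q₀ q x)
    (h : GoodRun lam α clock u q₀ ℓ₀ q ℓ) (i : ℕ) (M : ℝ) {ε : ℝ} (hε : 0 < ε) :
    ∀ᶠ n in U, ∀ t ∈ Ioc 0 M, |Function.leftLim (q n) t i - x t i| ≤ ε := by
  filter_upwards [hx.close i M ε hε, hx.eventually_one_le] with n hn h1 t ht
  have hT : Tendsto (fun s => |q n s i - x s i|) (𝓝[<] t)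
      (𝓝 |Function.leftLim (q n) t i - x t i|) :=
    (((h.sys n h1).tendsto_leftLim ht.1 i).sub
      (((hx.continuous i).tendsto t).mono_left nhdsWithin_le_nhds)).abs
  refine le_of_tendsto hT ?_
  filter_upwards [eventually_nonneg_left ht.1, self_mem_nhdsWithin] with s hs hst
  exact hn s ⟨hs, (le_of_lt hst).trans ht.2⟩

lemma IsOccupancyLimit.tendsto_intensity (hx : IsOccupancyLimit lam U q₀ q x)
    (h : GoodRun lam α clock u q₀ ℓ₀ q ℓ) (i : ℕ) {t : ℝ} (ht : 0 ≤ t) :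
    Tendsto (fun n => intensity (q n) i t) U (𝓝 (intensity x i t)) := by
  rw [Metric.tendsto_nhds]
  intro ε hε
  set η := ε / (2 * (i + 1) * (t + 1)) / 2 with hη
  have hη0 : 0 < η := by positivity
  filter_upwards [hx.close i t η hη0, hx.close (i + 1) t η hη0, hx.eventually_one_le]
    with n h1 h2 hn
  have hs := h.sys n hn
  have hI1 : IntervalIntegrable (fun s => (i : ℝ) * (q n s i - q n s (i + 1))) volume 0 t :=
    ((hs.intervalIntegrable i le_rfl ht).sub (hs.intervalIntegrable (i + 1) le_rfl ht)).const_mul _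
  have hI2 : IntervalIntegrable (fun s => (i : ℝ) * (x s i - x s (i + 1))) volume 0 t :=
    (continuous_const.mul ((hx.continuous i).sub (hx.continuous (i + 1)))).intervalIntegrable _ _
  rw [Real.dist_eq, intensity, intensity, ← intervalIntegral.integral_sub hI1 hI2,
    ← Real.norm_eq_abs]
  refine lt_of_le_of_lt (intervalIntegral.norm_integral_le_of_norm_le_const
    (C := (i + 1) * (2 * η)) fun s hs => ?_) ?_
  · rw [uIoc_of_le ht] at hs
    have e1 := abs_le.1 (h1 s ⟨hs.1.le, hs.2⟩)
    have e2 := abs_le.1 (h2 s ⟨hs.1.le, hs.2⟩)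
    rw [Real.norm_eq_abs, ← mul_sub, abs_mul, abs_of_nonneg (Nat.cast_nonneg i)]
    have e3 : |q n s i - q n s (i + 1) - (x s i - x s (i + 1))| ≤ 2 * η := by
      rw [abs_le]; constructor <;> linarith [e1.1, e1.2, e2.1, e2.2]
    gcongr
    linarith
  · rw [sub_zero, abs_of_nonneg ht, hη]
    have : ((i : ℝ) + 1) * (2 * (ε / (2 * (i + 1) * (t + 1)) / 2)) * t = ε / 2 * (t / (t + 1)) := by
      field_simp
    rw [this]
    have h4 : t / (t + 1) ≤ 1 := by rw [div_le_one (by linarith)]; linarith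
    nlinarith

lemma IsOccupancyLimit.tendsto_arrivals (hx : IsOccupancyLimit lam U q₀ q x)
    (h : GoodRun lam α clock u q₀ ℓ₀ q ℓ) (i : ℕ) {t : ℝ} (ht : 0 ≤ t) :
    Tendsto (fun n => arrivals n (clock 0) u (q n) (ℓ n) t i) U (𝓝 (fluidArrivals x i t)) := by
  have h1 : Tendsto (fun n => departures n clock (q n) t i - intensity (q n) i t) U (𝓝 0) := by
    rw [Metric.tendsto_nhds]
    intro ε hε
    filter_upwards [Eventually.filter_mono hx.le_atTop (h.departures_close i t (ε := ε / 2) (by positivity))]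
      with n hn
    rw [Real.dist_eq, sub_zero]
    linarith [hn t ⟨ht, le_rfl⟩]
  have h2 := ((hx.tendsto ht i).sub (hx.tendsto le_rfl i)).add
    (h1.add (hx.tendsto_intensity h i ht))
  rw [zero_add] at h2
  refine h2.congr' (hx.eventually_one_le.mono fun n hn => ?_)
  have := (h.sys n hn).occupancy t ht i
  rw [this]
  ring

lemma IsOccupancyLimit.tendsto_arrivalCount (hx : IsOccupancyLimit lam U q₀ q x)
    (h : GoodRun lam α clock u q₀ ℓ₀ q ℓ) {t : ℝ} (ht : 0 ≤ t) :
    Tendsto (fun n => (arrivalCount (clock 0) n t : ℝ) / n) U (𝓝 (lam * t)) := by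
  rw [Metric.tendsto_nhds]
  intro ε hε
  filter_upwards [Eventually.filter_mono hx.le_atTop (h.arr_rate.uniform t (ε := ε / 2) (by positivity))]
    with n hn
  rw [Real.dist_eq]
  unfold arrivalCount
  linarith [hn t ⟨ht, le_rfl⟩]

/-- Fluid arrives at rate `lam`, each bit of it to one level at most. -/
lemma IsOccupancyLimit.sum_fluidArrivals_le (hx : IsOccupancyLimit lam U q₀ q x)
    (h : GoodRun lam α clock u q₀ ℓ₀ q ℓ) (k : ℕ) {s t : ℝ} (hs : 0 ≤ s) (hst : s ≤ t) :
    ∑ i ∈ Finset.Icc 1 k, (fluidArrivals x i t - fluidArrivals x i s) ≤ lam * (t - s) := by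
  have ht := hs.trans hst
  have h1 : Tendsto (fun n => ∑ i ∈ Finset.Icc 1 k,
      (arrivals n (clock 0) u (q n) (ℓ n) t i - arrivals n (clock 0) u (q n) (ℓ n) s i)) U
      (𝓝 (∑ i ∈ Finset.Icc 1 k, (fluidArrivals x i t - fluidArrivals x i s))) :=
    tendsto_finsetSum _ fun i _ => (hx.tendsto_arrivals h i ht).sub (hx.tendsto_arrivals h i hs)
  have h2 := (hx.tendsto_arrivalCount h ht).sub (hx.tendsto_arrivalCount h hs)
  rw [mul_sub]
  refine le_of_tendsto_of_tendsto h1 h2 (hx.eventually_one_le.mono fun n hn => ?_)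
  have hle := arrivalCount_mono h.arr.mono n hst
  beta_reduce
  rw [Finset.sum_congr rfl fun i hi => IsDiscreteSystem.arrivals_sub (u := u) (q := q n) (ℓ := ℓ n)
    h.arr.mono hst (i := i) (by have := (Finset.mem_Icc.1 hi).1; omega)]
  rw [← Finset.sum_div, ← sub_div, Finset.sum_comm]
  refine div_le_div_of_nonneg_right ?_ (Nat.cast_nonneg n)
  refine (Finset.sum_le_card_nsmul _ _ 1 fun j hj => ?_).trans ?_
  · refine sum_routing_le_one (h.sel_mem j) ((h.sys n hn).leftLim_mem
      (h.arr.arrivalTime_pos hn ?_)) _ _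
    have := (Finset.mem_Ioc.1 hj).1
    omega
  · rw [Nat.card_Ioc, nsmul_eq_mul, mul_one, Nat.cast_sub hle]

lemma IsOccupancyLimit.fluidArrivals_mono (hx : IsOccupancyLimit lam U q₀ q x)
    (h : GoodRun lam α clock u q₀ ℓ₀ q ℓ) {i : ℕ} (hi : 1 ≤ i) {s t : ℝ} (hs : 0 ≤ s)
    (hst : s ≤ t) : fluidArrivals x i s ≤ fluidArrivals x i t := by
  refine le_of_tendsto_of_tendsto (hx.tendsto_arrivals h i hs)
    (hx.tendsto_arrivals h i (hs.trans hst)) (Eventually.of_forall fun n => ?_)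
  rw [← sub_nonneg, IsDiscreteSystem.arrivals_sub h.arr.mono hst (by omega)]
  exact div_nonneg (Finset.sum_nonneg fun j _ => routing_nonneg _ _ _ _) (Nat.cast_nonneg _)

end Limit

end ThresholdBalancing

namespace ThresholdBalancing

variable {lam α : ℝ} {clock : ℕ → ℝ≥0 → ℕ} {u : ℕ → ℝ} {q₀ : ℕ → ℝ} {ℓ₀ : ℕ}
  {q : ℕ → ℝ → ℕ → ℝ} {ℓ : ℕ → ℝ → ℕ} {U : Ultrafilter ℕ} {x : ℝ → ℕ → ℝ}

/-! ### Local dynamics of the limit while the threshold does not change -/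

/-- Near time `t` the threshold of the `n`-th system is `m` and no arrival changes it, for
`U`-almost all `n`. -/
def IsQuiet (U : Ultrafilter ℕ) (α : ℝ) (clock : ℕ → ℝ≥0 → ℕ) (q : ℕ → ℝ → ℕ → ℝ)
    (ℓ : ℕ → ℝ → ℕ) (t : ℝ) (m : ℕ) : Prop :=
  ∃ δ : ℝ, 0 < δ ∧ ∀ᶠ n in U, ∀ j, 1 ≤ j → |arrivalTime (clock 0) n j - t| < δ →
    Function.leftLim (ℓ n) (arrivalTime (clock 0) n j) = m ∧
    thresholdChange α n (Function.leftLim (q n) (arrivalTime (clock 0) n j)) m = 0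

lemma hasDerivAt_of_increments {f : ℝ → ℝ} {c t : ℝ}
    (h : ∀ ε : ℝ, 0 < ε → ∃ δ : ℝ, 0 < δ ∧ ∀ s s' : ℝ, t - δ < s → s ≤ s' → s' < t + δ →
      |f s' - f s - c * (s' - s)| ≤ ε * (s' - s)) : HasDerivAt f c t := by
  rw [hasDerivAt_iff_isLittleO, Asymptotics.isLittleO_iff]
  intro ε hε
  obtain ⟨δ, hδ, hf⟩ := h ε hε
  filter_upwards [Ioo_mem_nhds (by linarith : t - δ < t) (by linarith : t < t + δ)] with s hs
  simp only [Real.norm_eq_abs, smul_eq_mul]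
  rcases le_total t s with hts | hts
  · have := hf t s (by linarith) hts hs.2
    rw [abs_of_nonneg (by linarith : 0 ≤ s - t), mul_comm (s - t)]
    exact this
  · have := hf s t hs.1 hts (by linarith)
    rw [abs_sub_comm s t, abs_of_nonneg (by linarith : 0 ≤ t - s), ← abs_neg]
    convert this using 2
    ring

lemma mem_Ioc_arrivalTime (h : IsArrivalClock (clock 0)) {n : ℕ} (hn : 1 ≤ n) {s s' : ℝ}
    (hs : 0 ≤ s) (hss : s ≤ s') {j : ℕ}
    (hj : j ∈ Finset.Ioc (arrivalCount (clock 0) n s) (arrivalCount (clock 0) n s')) :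
    1 ≤ j ∧ s < arrivalTime (clock 0) n j ∧ arrivalTime (clock 0) n j ≤ s' := by
  have h1 := Finset.mem_Ioc.1 hj
  refine ⟨by omega, ?_, (h.le_arrivalCount_iff hn (hs.trans hss)).1 h1.2⟩
  by_contra! hle
  have := (h.le_arrivalCount_iff hn hs).2 hle
  omega

/-- The occupancy states seen by the arrivals close to time `t` are close to `x t`. -/
lemma IsOccupancyLimit.leftLim_near (hx : IsOccupancyLimit lam U q₀ q x)
    (h : GoodRun lam α clock u q₀ ℓ₀ q ℓ) (t : ℝ) (i : ℕ) {η : ℝ} (hη : 0 < η) :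
    ∃ δ : ℝ, 0 < δ ∧ ∀ᶠ n in U, ∀ s, 0 < s → |s - t| < δ →
      |Function.leftLim (q n) s i - x t i| < η := by
  obtain ⟨δ, hδ, hc⟩ := Metric.continuous_iff.1 (hx.continuous i) t (η / 2) (by positivity)
  refine ⟨δ, hδ, ?_⟩
  filter_upwards [hx.leftLim_close h i (t + δ) (ε := η / 2) (by positivity)] with n hn s hs hst
  have e1 := hn s ⟨hs, by have := (abs_lt.1 hst).2; linarith⟩
  have e2 := hc s hst
  rw [Real.dist_eq] at e2
  calc |Function.leftLim (q n) s i - x t i|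
      ≤ |Function.leftLim (q n) s i - x s i| + |x s i - x t i| := abs_sub_le _ _ _
    _ < η := by linarith

lemma eventually_alpha_lt (h : GoodRun lam α clock u q₀ ℓ₀ q ℓ) :
    ∀ᶠ n : ℕ in atTop, α < 1 - 1 / (n : ℝ) := by
  have h1 : Tendsto (fun n : ℕ => 1 - 1 / (n : ℝ)) atTop (𝓝 (1 - 0)) :=
    tendsto_const_nhds.sub tendsto_one_div_atTop_nhds_zero_nat
  rw [sub_zero] at h1
  exact h1.eventually (lt_mem_nhds h.alpha_lt)

/-- For large `n` the two updates of the threshold exclude each other. -/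
lemma thresholdChange_cases {n : ℕ} (hn : α < 1 - 1 / (n : ℝ)) {p : ℕ → ℝ}
    (hp : p ∈ occupancySpace) (m : ℕ) :
    (thresholdChange α n p m = 0 ∧ p (m + 1) < 1 - 1 / (n : ℝ) ∧ α < p m) ∨
    (thresholdChange α n p m = 1 ∧ 1 - 1 / (n : ℝ) ≤ p (m + 1)) ∨
    (thresholdChange α n p m = -1 ∧ p m ≤ α) := by
  have := hp.2.2 m
  unfold thresholdChange
  by_cases h1 : 1 - 1 / (n : ℝ) ≤ p (m + 1)
  · have h2 : ¬ p m ≤ α := by linarith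
    rw [if_pos h1, if_neg h2]
    exact Or.inr (Or.inl ⟨by norm_num, h1⟩)
  · by_cases h2 : p m ≤ α
    · rw [if_neg h1, if_pos h2]
      exact Or.inr (Or.inr ⟨by norm_num, h2⟩)
    · simp only [h1, h2, if_false, sub_self, true_and]
      exact Or.inl ⟨not_le.1 h1, not_le.1 h2⟩

/-- As the arrivals near a quiet time do not change the threshold, they see level `m + 1` not full
and level `m` above `α`. -/
lemma IsQuiet.bounds {t : ℝ} {m : ℕ} (hQ : IsQuiet U α clock q ℓ t m)
    (hx : IsOccupancyLimit lam U q₀ q x) (h : GoodRun lam α clock u q₀ ℓ₀ q ℓ) :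
    ∃ δ : ℝ, 0 < δ ∧ ∀ᶠ n in U, ∀ j, 1 ≤ j → |arrivalTime (clock 0) n j - t| < δ →
      Function.leftLim (ℓ n) (arrivalTime (clock 0) n j) = m ∧
      Function.leftLim (q n) (arrivalTime (clock 0) n j) ∈ occupancySpace ∧
      Function.leftLim (q n) (arrivalTime (clock 0) n j) (m + 1) < 1 ∧
      α < Function.leftLim (q n) (arrivalTime (clock 0) n j) m := by
  obtain ⟨δ, hδ, hQ⟩ := hQ
  refine ⟨δ, hδ, ?_⟩
  filter_upwards [hQ, hx.eventually_one_le, Eventually.filter_mono hx.le_atTop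
    (eventually_alpha_lt h)] with n h1 h2 h3 j hj hjt
  obtain ⟨e1, e2⟩ := h1 j hj hjt
  have hp := (h.sys n h2).leftLim_mem (h.arr.arrivalTime_pos h2 hj)
  refine ⟨e1, hp, ?_⟩
  rcases thresholdChange_cases h3 hp m with h4 | h4 | h4
  · refine ⟨h4.2.1.trans_le ?_, h4.2.2⟩
    have : (0 : ℝ) ≤ 1 / n := by positivity
    linarith
  · omega
  · omega

/-- All the arrivals counted by the increment of the arrival process over a short interval `(s, s']`
around a quiet time see the threshold `m`, level `m + 1` not full, and level `m` above `α`. -/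
lemma IsQuiet.exists_window {t : ℝ} {m : ℕ} (hQ : IsQuiet U α clock q ℓ t m) (ht : 0 < t)
    (hx : IsOccupancyLimit lam U q₀ q x) (h : GoodRun lam α clock u q₀ ℓ₀ q ℓ) :
    ∃ δ : ℝ, 0 < δ ∧ δ ≤ t ∧ ∀ᶠ n in U, ∀ s s', t - δ < s → s ≤ s' → s' < t + δ →
      ∀ j ∈ Finset.Ioc (arrivalCount (clock 0) n s) (arrivalCount (clock 0) n s'),
        1 ≤ j ∧ |arrivalTime (clock 0) n j - t| < δ ∧
        Function.leftLim (ℓ n) (arrivalTime (clock 0) n j) = m ∧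
        Function.leftLim (q n) (arrivalTime (clock 0) n j) ∈ occupancySpace ∧
        Function.leftLim (q n) (arrivalTime (clock 0) n j) (m + 1) < 1 ∧
        α < Function.leftLim (q n) (arrivalTime (clock 0) n j) m := by
  obtain ⟨δ, hδ, hB⟩ := hQ.bounds hx h
  refine ⟨min δ t, lt_min hδ ht, min_le_right _ _, ?_⟩
  filter_upwards [hB, hx.eventually_one_le] with n hn h1 s s' hs hss hs' j hj
  have hs0 : 0 ≤ s := by linarith [min_le_right δ t]
  obtain ⟨e1, e2, e3⟩ := mem_Ioc_arrivalTime h.arr h1 hs0 hss hj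
  have e4 : |arrivalTime (clock 0) n j - t| < min δ t := by
    rw [abs_lt]; constructor <;> linarith
  exact ⟨e1, e4, hn j e1 (e4.trans_le (min_le_left _ _))⟩

/-- No fluid arrives to server pools with more than `m` tasks. -/
lemma IsQuiet.hasDerivAt_fluidArrivals_of_lt {t : ℝ} {m : ℕ} (hQ : IsQuiet U α clock q ℓ t m)
    (ht : 0 < t) (hx : IsOccupancyLimit lam U q₀ q x) (h : GoodRun lam α clock u q₀ ℓ₀ q ℓ)
    {i : ℕ} (hi : m + 1 < i) : HasDerivAt (fluidArrivals x i) 0 t := by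
  obtain ⟨δ, hδ, hδt, hW⟩ := hQ.exists_window ht hx h
  refine hasDerivAt_of_increments fun ε hε => ⟨δ, hδ, fun s s' hs hss hs' => ?_⟩
  have hs0 : 0 ≤ s := by linarith
  have hT := (hx.tendsto_arrivals h i (hs0.trans hss)).sub (hx.tendsto_arrivals h i hs0)
  have h0 : fluidArrivals x i s' - fluidArrivals x i s = 0 := by
    refine tendsto_nhds_unique hT (tendsto_const_nhds.congr' ?_)
    filter_upwards [hW] with n hn
    rw [IsDiscreteSystem.arrivals_sub h.arr.mono hss (by omega), Finset.sum_eq_zero, zero_div]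
    intro j hj
    obtain ⟨-, -, e1, -, e2, -⟩ := hn s s' hs hss hs' j hj
    rw [e1]
    exact routing_of_full e2 hi
  rw [h0, zero_mul, sub_zero, abs_zero]
  exact mul_nonneg hε.le (by linarith)

/-- All the fluid arrives to server pools with at most `m` tasks. -/
lemma IsQuiet.hasDerivAt_sum_fluidArrivals {t : ℝ} {m : ℕ} (hQ : IsQuiet U α clock q ℓ t m)
    (ht : 0 < t) (hx : IsOccupancyLimit lam U q₀ q x) (h : GoodRun lam α clock u q₀ ℓ₀ q ℓ) :
    HasDerivAt (fun s => ∑ i ∈ Finset.Icc 1 (m + 1), fluidArrivals x i s) lam t := by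
  obtain ⟨δ, hδ, hδt, hW⟩ := hQ.exists_window ht hx h
  refine hasDerivAt_of_increments fun ε hε => ⟨δ, hδ, fun s s' hs hss hs' => ?_⟩
  have hs0 : 0 ≤ s := by linarith
  have hT : Tendsto (fun n => ∑ i ∈ Finset.Icc 1 (m + 1),
      (arrivals n (clock 0) u (q n) (ℓ n) s' i - arrivals n (clock 0) u (q n) (ℓ n) s i)) U
      (𝓝 (∑ i ∈ Finset.Icc 1 (m + 1), (fluidArrivals x i s' - fluidArrivals x i s))) :=
    tendsto_finsetSum _ fun i _ =>
      (hx.tendsto_arrivals h i (hs0.trans hss)).sub (hx.tendsto_arrivals h i hs0)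
  have hC := (hx.tendsto_arrivalCount h (hs0.trans hss)).sub (hx.tendsto_arrivalCount h hs0)
  have heq := tendsto_nhds_unique hT (hC.congr' ?_)
  · rw [← Finset.sum_sub_distrib, heq, ← mul_sub, sub_self, abs_zero]
    exact mul_nonneg hε.le (by linarith)
  · filter_upwards [hW] with n hn
    have hle := arrivalCount_mono h.arr.mono n hss
    rw [Finset.sum_congr rfl fun i hi => IsDiscreteSystem.arrivals_sub (u := u) (q := q n)
      (ℓ := ℓ n) h.arr.mono hss (i := i) (by have := (Finset.mem_Icc.1 hi).1; omega)]
    rw [← Finset.sum_div, ← sub_div, Finset.sum_comm]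
    congr 1
    rw [Finset.sum_congr rfl (g := fun _ => (1 : ℝ))]
    · rw [Finset.sum_const, Nat.card_Ioc, nsmul_eq_mul, mul_one, Nat.cast_sub hle]
    · intro j hj
      obtain ⟨-, -, e1, e2, e3, -⟩ := hn s s' hs hss hs' j hj
      rw [e1]
      exact sum_routing_eq_one (h.sel_mem j) e2 e3

lemma GoodRun.empirical_clamp (h : GoodRun lam α clock u q₀ ℓ₀ q ℓ) (c : ℝ) (m : ℕ) :
    empirical u c m = empirical u (max 0 (min c 1)) m := by
  refine Finset.sum_congr rfl fun j _ => ?_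
  have := h.sel_mem j
  have hiff : u j < c ↔ u j < max 0 (min c 1) := by
    rw [lt_max_iff, lt_min_iff]
    constructor
    · exact fun h1 => Or.inr ⟨h1, this.2⟩
    · rintro (h1 | h1)
      · exact absurd h1 (not_lt.2 this.1)
      · exact h1.1
  simp only [indicator, mem_Iio, hiff]

/-- The fraction of the arrivals up to time `s` whose selection variable is below `c`. -/
lemma IsOccupancyLimit.tendsto_empirical (hx : IsOccupancyLimit lam U q₀ q x)
    (h : GoodRun lam α clock u q₀ ℓ₀ q ℓ) (c : ℝ) {s : ℝ} (hs : 0 ≤ s) :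
    Tendsto (fun n => empirical u c (arrivalCount (clock 0) n s) / n) U
      (𝓝 (max 0 (min c 1) * (lam * s))) := by
  rcases eq_or_lt_of_le hs with rfl | hs'
  · simp [arrivalCount, h.arr.zero, empirical]
  have h1 := hx.tendsto_arrivalCount h hs
  have hcl : max 0 (min c 1) ∈ Icc (0 : ℝ) 1 :=
    ⟨le_max_left _ _, max_le zero_le_one (min_le_right _ _)⟩
  have hinf : Tendsto (fun n => arrivalCount (clock 0) n s) U atTop := by
    rw [← tendsto_natCast_atTop_iff (R := ℝ)]
    have hn : Tendsto (fun n : ℕ => (n : ℝ)) U atTop :=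
      tendsto_natCast_atTop_atTop.mono_left hx.le_atTop
    refine (h1.pos_mul_atTop (mul_pos h.lam_pos hs') hn).congr' ?_
    filter_upwards [hx.eventually_one_le] with n hn
    have : (n : ℝ) ≠ 0 := by positivity
    field_simp
  have h2 := ((h.sel_lln _ hcl).comp hinf).mul h1
  refine h2.congr' ?_
  filter_upwards [hinf.eventually_ge_atTop 1] with n hn
  have : (arrivalCount (clock 0) n s : ℝ) ≠ 0 := by
    have : 0 < arrivalCount (clock 0) n s := hn
    positivity
  simp only [Function.comp]
  rw [h.empirical_clamp c]
  field_simp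

lemma empirical_sub {c : ℝ} {k k' : ℕ} (hk : k ≤ k') :
    empirical u c k' - empirical u c k
      = ∑ j ∈ Finset.Ioc k k', (Iio c).indicator (fun _ => (1 : ℝ)) (u j) := by
  have hsub : Finset.Icc 1 k ⊆ Finset.Icc 1 k' := Finset.Icc_subset_Icc le_rfl hk
  rw [empirical, empirical, ← Finset.sum_sdiff hsub]
  have : Finset.Icc 1 k' \ Finset.Icc 1 k = Finset.Ioc k k' := by
    ext j; simp only [Finset.mem_sdiff, Finset.mem_Icc, Finset.mem_Ioc]; omega
  rw [this]
  ring

lemma routing_eq_indicator_sub {v : ℝ} {p : ℕ → ℝ} (hp : p ∈ occupancySpace) {m i : ℕ}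
    (hi : i ≤ m) (hm : p m < 1) :
    routing v p m i = (Iio ((1 - p i) / (1 - p m))).indicator (fun _ => (1 : ℝ)) v
      - (Iio ((1 - p (i - 1)) / (1 - p m))).indicator (fun _ => (1 : ℝ)) v := by
  have hpos : 0 < 1 - p m := by linarith
  have hle : (1 - p (i - 1)) / (1 - p m) ≤ (1 - p i) / (1 - p m) := by
    have := occupancySpace_antitone hp (Nat.sub_le i 1)
    gcongr
  unfold routing
  rw [if_pos hi]
  simp only [hm, true_and, mem_Ico, indicator, mem_Iio]
  by_cases h1 : v < (1 - p (i - 1)) / (1 - p m)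
  · simp [h1, h1.trans_le hle]
  · simp [h1, not_lt.1 h1]

/-- Fluid is split among the server pools with fewer than `m` tasks uniformly at random: by the law
of large numbers for the selection variables, as the selection intervals are nearly constant over a
short window. -/
lemma IsQuiet.hasDerivAt_fluidArrivals_of_le {t : ℝ} {m : ℕ} (hQ : IsQuiet U α clock q ℓ t m)
    (ht : 0 < t) (hx : IsOccupancyLimit lam U q₀ q x) (h : GoodRun lam α clock u q₀ ℓ₀ q ℓ)
    (hm : x t m < 1) {i : ℕ} (hi1 : 1 ≤ i) (hi : i ≤ m) :
    HasDerivAt (fluidArrivals x i) (lam * ((x t (i - 1) - x t i) / (1 - x t m))) t := by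
  obtain ⟨δ₀, hδ₀, hδt, hW⟩ := hQ.exists_window ht hx h
  have hpos : 0 < 1 - x t m := by linarith
  have hxt := hx.mem h ht.le
  -- near time `t` the ends of the selection intervals are close to those for the state `x t`
  have key : ∀ i' ≤ m, ∀ ε : ℝ, 0 < ε → ∃ δ : ℝ, 0 < δ ∧ ∀ᶠ n in U, ∀ s, 0 < s → |s - t| < δ →
      |(1 - Function.leftLim (q n) s i') / (1 - Function.leftLim (q n) s m)
        - (1 - x t i') / (1 - x t m)| < ε ∧ Function.leftLim (q n) s m < 1 := by
    intro i' _ ε hε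
    have hc : ContinuousAt (fun ab : ℝ × ℝ => (1 - ab.1) / (1 - ab.2)) (x t i', x t m) :=
      (continuousAt_const.sub continuousAt_fst).div (continuousAt_const.sub continuousAt_snd)
        hpos.ne'
    obtain ⟨η, hη, hcη⟩ := Metric.continuousAt_iff.1 hc ε hε
    obtain ⟨δ₁, hδ₁, h1⟩ := hx.leftLim_near h t i' hη
    obtain ⟨δ₂, hδ₂, h2⟩ := hx.leftLim_near h t m (lt_min hη hpos)
    refine ⟨min δ₁ δ₂, lt_min hδ₁ hδ₂, ?_⟩
    filter_upwards [h1, h2] with n e1 e2 s hs hst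
    have f1 := e1 s hs (hst.trans_le (min_le_left _ _))
    have f2 := e2 s hs (hst.trans_le (min_le_right _ _))
    constructor
    · refine hcη (x := (Function.leftLim (q n) s i', Function.leftLim (q n) s m)) ?_
      rw [Prod.dist_eq]
      exact max_lt f1 (f2.trans_le (min_le_left _ _))
    · have := (abs_lt.1 (f2.trans_le (min_le_right _ _))).2
      linarith
  set L := (1 - x t (i - 1)) / (1 - x t m) with hL
  set R := (1 - x t i) / (1 - x t m) with hR
  have hanti := occupancySpace_antitone hxt
  have hL01 : L ∈ Icc (0 : ℝ) 1 := by
    refine ⟨div_nonneg (by linarith [(hxt.2.1 (i - 1)).2]) hpos.le, (div_le_one hpos).2 ?_⟩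
    linarith [hanti ((Nat.sub_le i 1).trans hi)]
  have hR01 : R ∈ Icc (0 : ℝ) 1 := by
    refine ⟨div_nonneg (by linarith [(hxt.2.1 i).2]) hpos.le, (div_le_one hpos).2 ?_⟩
    linarith [hanti hi]
  have hval : (x t (i - 1) - x t i) / (1 - x t m) = R - L := by
    rw [hL, hR, ← sub_div]; congr 1; ring
  rw [hval]
  refine hasDerivAt_of_increments fun ε' hε' => ?_
  set ε := ε' / (2 * lam) with hε
  have hlam := h.lam_pos
  have hε0 : 0 < ε := by positivity
  obtain ⟨δ₁, hδ₁, h1⟩ := key (i - 1) ((Nat.sub_le _ _).trans hi) ε hε0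
  obtain ⟨δ₂, hδ₂, h2⟩ := key i hi ε hε0
  refine ⟨min δ₀ (min δ₁ δ₂), lt_min hδ₀ (lt_min hδ₁ hδ₂), fun s s' hs hss hs' => ?_⟩
  have m0 := min_le_left δ₀ (min δ₁ δ₂)
  have m1 := (min_le_right δ₀ (min δ₁ δ₂)).trans (min_le_left _ _)
  have m2 := (min_le_right δ₀ (min δ₁ δ₂)).trans (min_le_right _ _)
  have hs0 : 0 ≤ s := by linarith
  have hs0' := hs0.trans hss
  have hT := (hx.tendsto_arrivals h i hs0').sub (hx.tendsto_arrivals h i hs0)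
  have hE : ∀ c, Tendsto (fun n => (empirical u c (arrivalCount (clock 0) n s')
      - empirical u c (arrivalCount (clock 0) n s)) / n) U
      (𝓝 (max 0 (min c 1) * (lam * (s' - s)))) := by
    intro c
    have := (hx.tendsto_empirical h c hs0').sub (hx.tendsto_empirical h c hs0)
    rw [← mul_sub, ← mul_sub] at this
    refine this.congr fun n => ?_
    rw [sub_div]
  -- the routing indicator of each arrival in the window lies between two fixed indicators
  have hroute : ∀ᶠ n in U,
      ∀ j ∈ Finset.Ioc (arrivalCount (clock 0) n s) (arrivalCount (clock 0) n s'),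
      (Iio (R - ε)).indicator (fun _ => (1 : ℝ)) (u j)
          - (Iio (L + ε)).indicator (fun _ => (1 : ℝ)) (u j)
        ≤ routing (u j) (Function.leftLim (q n) (arrivalTime (clock 0) n j))
            (Function.leftLim (ℓ n) (arrivalTime (clock 0) n j)) i ∧
      routing (u j) (Function.leftLim (q n) (arrivalTime (clock 0) n j))
            (Function.leftLim (ℓ n) (arrivalTime (clock 0) n j)) i
        ≤ (Iio (R + ε)).indicator (fun _ => (1 : ℝ)) (u j)
          - (Iio (L - ε)).indicator (fun _ => (1 : ℝ)) (u j) := by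
    filter_upwards [hW, h1, h2, hx.eventually_one_le] with n w1 w2 w3 hn j hj
    obtain ⟨e1, -, e3, e4, -, -⟩ := w1 s s' (by linarith) hss (by linarith) j hj
    obtain ⟨-, g1, g2⟩ := mem_Ioc_arrivalTime h.arr hn hs0 hss hj
    have hσ := h.arr.arrivalTime_pos hn e1
    obtain ⟨f1, f2⟩ := w2 _ hσ (by rw [abs_lt]; constructor <;> linarith)
    obtain ⟨f3, -⟩ := w3 _ hσ (by rw [abs_lt]; constructor <;> linarith)
    rw [e3, routing_eq_indicator_sub e4 hi f2]
    rw [abs_lt] at f1 f3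
    have hmono : ∀ {a b : ℝ}, a ≤ b → (Iio a).indicator (fun _ => (1 : ℝ)) (u j)
        ≤ (Iio b).indicator (fun _ => (1 : ℝ)) (u j) := fun hab =>
      indicator_le_indicator_of_subset (Iio_subset_Iio hab) (fun _ => zero_le_one) _
    constructor
    · exact sub_le_sub (hmono (by linarith)) (hmono (by linarith))
    · exact sub_le_sub (hmono (by linarith)) (hmono (by linarith))
  have hup : fluidArrivals x i s' - fluidArrivals x i s
      ≤ (max 0 (min (R + ε) 1) - max 0 (min (L - ε) 1)) * (lam * (s' - s)) := by
    rw [sub_mul]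
    refine le_of_tendsto_of_tendsto hT ((hE (R + ε)).sub (hE (L - ε))) (hroute.mono fun n hn => ?_)
    have hle := arrivalCount_mono h.arr.mono n hss
    beta_reduce
    rw [IsDiscreteSystem.arrivals_sub h.arr.mono hss (by omega), empirical_sub hle,
      empirical_sub hle, ← sub_div, ← Finset.sum_sub_distrib]
    exact div_le_div_of_nonneg_right (Finset.sum_le_sum fun j hj => (hn j hj).2)
      (Nat.cast_nonneg _)
  have hlo : (max 0 (min (R - ε) 1) - max 0 (min (L + ε) 1)) * (lam * (s' - s))
      ≤ fluidArrivals x i s' - fluidArrivals x i s := by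
    rw [sub_mul]
    refine le_of_tendsto_of_tendsto ((hE (R - ε)).sub (hE (L + ε))) hT (hroute.mono fun n hn => ?_)
    have hle := arrivalCount_mono h.arr.mono n hss
    beta_reduce
    rw [IsDiscreteSystem.arrivals_sub h.arr.mono hss (by omega), empirical_sub hle,
      empirical_sub hle, ← sub_div, ← Finset.sum_sub_distrib]
    exact div_le_div_of_nonneg_right (Finset.sum_le_sum fun j hj => (hn j hj).1)
      (Nat.cast_nonneg _)
  have b1 : max 0 (min (R + ε) 1) ≤ R + ε := max_le (by linarith [hR01.1]) (min_le_left _ _)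
  have b2 : L - ε ≤ max 0 (min (L - ε) 1) :=
    le_max_of_le_right (le_min le_rfl (by linarith [hL01.2]))
  have b3 : max 0 (min (L + ε) 1) ≤ L + ε := max_le (by linarith [hL01.1]) (min_le_left _ _)
  have b4 : R - ε ≤ max 0 (min (R - ε) 1) :=
    le_max_of_le_right (le_min le_rfl (by linarith [hR01.2]))
  have hls : 0 ≤ lam * (s' - s) := mul_nonneg hlam.le (by linarith)
  have hee : 2 * ε * (lam * (s' - s)) = ε' * (s' - s) := by
    rw [hε]; field_simp
  have c1 := hup.trans (mul_le_mul_of_nonneg_right (by linarith :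
    max 0 (min (R + ε) 1) - max 0 (min (L - ε) 1) ≤ R - L + 2 * ε) hls)
  have c2 := le_trans (mul_le_mul_of_nonneg_right (by linarith :
    R - L - 2 * ε ≤ max 0 (min (R - ε) 1) - max 0 (min (L + ε) 1)) hls) hlo
  rw [abs_le]
  constructor <;> linarith

/-- If level `m` is not full, then all the fluid arrives to server pools with fewer than `m` tasks, and
none is left for those with exactly `m` tasks. -/
lemma IsQuiet.hasDerivAt_fluidArrivals_succ {t : ℝ} {m : ℕ} (hQ : IsQuiet U α clock q ℓ t m)
    (ht : 0 < t) (hx : IsOccupancyLimit lam U q₀ q x) (h : GoodRun lam α clock u q₀ ℓ₀ q ℓ)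
    (hm : x t m < 1) : HasDerivAt (fluidArrivals x (m + 1)) 0 t := by
  have h1 := hQ.hasDerivAt_sum_fluidArrivals ht hx h
  have h2 : HasDerivAt (fun s => ∑ i ∈ Finset.Icc 1 m, fluidArrivals x i s)
      (∑ i ∈ Finset.Icc 1 m, lam * ((x t (i - 1) - x t i) / (1 - x t m))) t :=
    HasDerivAt.fun_sum fun i hi =>
      hQ.hasDerivAt_fluidArrivals_of_le ht hx h hm (Finset.mem_Icc.1 hi).1 (Finset.mem_Icc.1 hi).2
  have hpos : 1 - x t m ≠ 0 := by linarith
  have htel : ∀ k, ∑ i ∈ Finset.Icc 1 k, (x t (i - 1) - x t i) = 1 - x t k := by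
    intro k
    induction k with
    | zero => simp [(hx.mem h ht.le).1]
    | succ k ih => rw [Finset.sum_Icc_succ_top (by omega), ih, Nat.add_sub_cancel]; ring
  have hsum : ∑ i ∈ Finset.Icc 1 m, lam * ((x t (i - 1) - x t i) / (1 - x t m)) = lam := by
    rw [← Finset.mul_sum, ← Finset.sum_div, htel, div_self hpos, mul_one]
  rw [hsum] at h2
  have h3 := h1.sub h2
  rw [sub_self] at h3
  refine h3.congr_of_eventuallyEq (Eventually.of_forall fun s => ?_)
  simp only [Pi.sub_apply]
  rw [Finset.sum_Icc_succ_top (by omega)]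
  ring

lemma IsOccupancyLimit.hasDerivAt_intensity (hx : IsOccupancyLimit lam U q₀ q x) (i : ℕ) (t : ℝ) :
    HasDerivAt (intensity x i) (i * (x t i - x t (i + 1))) t := by
  have hc : Continuous fun s => (i : ℝ) * (x s i - x s (i + 1)) :=
    continuous_const.mul ((hx.continuous i).sub (hx.continuous (i + 1)))
  exact (hc.integral_hasStrictDerivAt 0 t).hasDerivAt

lemma IsOccupancyLimit.hasDerivAt_of_fluidArrivals (hx : IsOccupancyLimit lam U q₀ q x) {i : ℕ}
    {t a : ℝ} (h : HasDerivAt (fluidArrivals x i) a t) :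
    HasDerivAt (fun s => x s i) (a - i * (x t i - x t (i + 1))) t := by
  have h1 := (h.add_const (x 0 i)).sub (hx.hasDerivAt_intensity i t)
  refine h1.congr_of_eventuallyEq (Eventually.of_forall fun s => ?_)
  simp only [Pi.sub_apply, fluidArrivals]
  ring

lemma IsOccupancyLimit.hasDerivAt_fluidArrivals (hx : IsOccupancyLimit lam U q₀ q x) {i : ℕ}
    {t a : ℝ} (h : HasDerivAt (fun s => x s i) a t) :
    HasDerivAt (fluidArrivals x i) (a + i * (x t i - x t (i + 1))) t :=
  (h.sub_const (x 0 i)).add (hx.hasDerivAt_intensity i t)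

/-- Level `m` does not fall below `α` at a quiet time: arrivals occur at all times, and those near `t`
see level `m` above `α`. -/
lemma IsQuiet.alpha_le {t : ℝ} {m : ℕ} (hQ : IsQuiet U α clock q ℓ t m)
    (ht : 0 < t) (hx : IsOccupancyLimit lam U q₀ q x) (h : GoodRun lam α clock u q₀ ℓ₀ q ℓ) :
    α ≤ x t m := by
  obtain ⟨δ₀, hδ₀, hδt, hW⟩ := hQ.exists_window ht hx h
  refine le_of_forall_pos_le_add fun η hη => ?_
  obtain ⟨δ₁, hδ₁, h1⟩ := hx.leftLim_near h t m hη
  set δ := min δ₀ δ₁ / 2 with hδ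
  have hmin := lt_min hδ₀ hδ₁
  have hδ0 : 0 < δ := by positivity
  -- arrivals occur in the window `(t, t + δ]`, and they all see an occupancy above `α`
  have hC := (hx.tendsto_arrivalCount h (by linarith : 0 ≤ t + δ)).sub
    (hx.tendsto_arrivalCount h ht.le)
  have hpos : 0 < lam * (t + δ) - lam * t := by nlinarith [h.lam_pos]
  obtain ⟨n, w1, w2, w3, hn⟩ := (hW.and (h1.and ((hC.eventually (lt_mem_nhds hpos)).and
    hx.eventually_one_le))).exists
  have hlt : arrivalCount (clock 0) n t < arrivalCount (clock 0) n (t + δ) := by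
    rw [← sub_div] at w3
    have hn' : (0 : ℝ) < n := by exact_mod_cast hn
    have := (div_pos_iff_of_pos_right hn').1 w3
    exact_mod_cast sub_pos.1 this
  have hδs : δ < δ₀ := by linarith [min_le_left δ₀ δ₁]
  have hj := Finset.mem_Ioc.2 ⟨hlt, le_refl (arrivalCount (clock 0) n (t + δ))⟩
  obtain ⟨e1, -, -, -, -, e2⟩ := w1 t (t + δ) (by linarith) (by linarith) (by linarith) _ hj
  obtain ⟨-, g1, g2⟩ := mem_Ioc_arrivalTime h.arr hn ht.le (by linarith) hj
  have := w2 _ (h.arr.arrivalTime_pos hn e1)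
    (by rw [abs_lt]; constructor <;> linarith [min_le_right δ₀ δ₁])
  linarith [(abs_lt.1 this).2]

lemma IsOccupancyLimit.eventually_mem (hx : IsOccupancyLimit lam U q₀ q x)
    (h : GoodRun lam α clock u q₀ ℓ₀ q ℓ) {t : ℝ} (ht : 0 < t) :
    ∀ᶠ s in 𝓝 t, x s ∈ occupancySpace :=
  (lt_mem_nhds ht).mono fun _ hs => hx.mem h (le_of_lt hs)

/-- The fluid equations at a quiet time. When `x t m = 1`, the coordinates up to `m` have a local
maximum at `t`, so that their derivatives vanish; this determines the fluid arrivals. -/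
theorem IsQuiet.dynamics {t : ℝ} {m : ℕ} (hQ : IsQuiet U α clock q ℓ t m)
    (ht : 0 < t) (hx : IsOccupancyLimit lam U q₀ q x) (h : GoodRun lam α clock u q₀ ℓ₀ q ℓ)
    (hdiff : ∀ i, DifferentiableAt ℝ (fun s => x s i) t) (hlt : x t (m + 1) < 1) {i : ℕ}
    (hi : 1 ≤ i) :
    HasDerivAt (fluidArrivals x i) (lam * fluidRouting lam (x t) m i) t ∧
      fluidRouting lam (x t) m i ∈ Icc (0 : ℝ) 1 := by
  have hxt := hx.mem h ht.le
  have hanti := occupancySpace_antitone hxt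
  by_cases hm : x t m < 1
  · by_cases him : i ≤ m
    · have hv : fluidRouting lam (x t) m i = (x t (i - 1) - x t i) / (1 - x t m) := by
        simp [fluidRouting, hm, him]
      rw [hv]
      have hpos : 0 < 1 - x t m := by linarith
      refine ⟨hQ.hasDerivAt_fluidArrivals_of_le ht hx h hm hi him, ?_, ?_⟩
      · exact div_nonneg (by linarith [hanti (Nat.sub_le i 1)]) hpos.le
      · rw [div_le_one hpos]
        linarith [hanti him, (hxt.2.1 (i - 1)).2]
    · have hv : fluidRouting lam (x t) m i = 0 := by
        simp [fluidRouting, hm, him]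
      rw [hv, mul_zero]
      refine ⟨?_, by simp⟩
      rcases eq_or_lt_of_le (Nat.succ_le_of_lt (not_le.1 him)) with h1 | h1
      · rw [← h1]; exact hQ.hasDerivAt_fluidArrivals_succ ht hx h hm
      · exact hQ.hasDerivAt_fluidArrivals_of_lt ht hx h h1
  · have hm1 : x t m = 1 := le_antisymm (hxt.2.1 m).2 (not_lt.1 hm)
    have hone : ∀ k ≤ m, x t k = 1 := fun k hk =>
      le_antisymm (hxt.2.1 k).2 (hm1.symm.le.trans (hanti hk))
    have hzero : ∀ k ≤ m, HasDerivAt (fun s => x s k) 0 t := by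
      intro k hk
      have hmax : IsLocalMax (fun s => x s k) t :=
        (hx.eventually_mem h ht).mono fun s hs => by
          show x s k ≤ x t k
          rw [hone k hk]; exact (hs.2.1 k).2
      have hd := (hdiff k).hasDerivAt
      rwa [hmax.hasDerivAt_eq_zero hd] at hd
    have hA : ∀ k ≤ m, HasDerivAt (fluidArrivals x k) (k * (x t k - x t (k + 1))) t := by
      intro k hk
      have := hx.hasDerivAt_fluidArrivals (hzero k hk)
      rwa [zero_add] at this
    have hlow : ∀ k < m, HasDerivAt (fluidArrivals x k) 0 t := by
      intro k hk
      have := hA k hk.le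
      rwa [hone k hk.le, hone (k + 1) hk, sub_self, mul_zero] at this
    have hsum : HasDerivAt (fun s => ∑ k ∈ Finset.Icc 1 m, fluidArrivals x k s)
        (m * (1 - x t (m + 1))) t := by
      have h1 : HasDerivAt (fun s => ∑ k ∈ Finset.Icc 1 m, fluidArrivals x k s)
          (∑ k ∈ Finset.Icc 1 m, k * (x t k - x t (k + 1))) t :=
        HasDerivAt.fun_sum fun k hk => hA k (Finset.mem_Icc.1 hk).2
      have h2 : ∑ k ∈ Finset.Icc 1 m, (k : ℝ) * (x t k - x t (k + 1))
          = m * (1 - x t (m + 1)) := by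
        rw [Finset.sum_eq_single m]
        · rw [hm1]
        · intro k hk hkm
          have hk' : k < m := lt_of_le_of_ne (Finset.mem_Icc.1 hk).2 hkm
          rw [hone k hk'.le, hone (k + 1) hk', sub_self, mul_zero]
        · intro hm0
          have : m = 0 := by simp only [Finset.mem_Icc] at hm0; omega
          simp [this]
      rwa [h2] at h1
    have htop : HasDerivAt (fluidArrivals x (m + 1)) (lam - m * (1 - x t (m + 1))) t := by
      refine ((hQ.hasDerivAt_sum_fluidArrivals ht hx h).sub hsum).congr_of_eventuallyEq
        (Eventually.of_forall fun s => ?_)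
      simp only [Pi.sub_apply]
      rw [Finset.sum_Icc_succ_top (by omega)]
      ring
    -- the fluid arrivals are nondecreasing, so that the fraction left for level `m + 1` is nonnegative
    have hnn : 0 ≤ lam - m * (1 - x t (m + 1)) := by
      have hmono : MonotoneOn (fluidArrivals x (m + 1)) (Ioi 0) := fun a ha b _ hab =>
        hx.fluidArrivals_mono h (by omega) (le_of_lt ha) hab
      have := hmono.derivWithin_nonneg (x := t)
      rwa [(htop.hasDerivWithinAt (s := Ioi 0)).derivWithin
        (isOpen_Ioi.uniqueDiffWithinAt ht)] at this
    have hlam := h.lam_pos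
    have hp0 : 0 ≤ (m : ℝ) / lam * (1 - x t (m + 1)) :=
      mul_nonneg (div_nonneg (Nat.cast_nonneg _) hlam.le) (by linarith)
    have hp1 : (m : ℝ) / lam * (1 - x t (m + 1)) ≤ 1 := by
      rw [div_mul_eq_mul_div, div_le_one hlam]; linarith
    rcases lt_trichotomy i m with him | him | him
    · have hv : fluidRouting lam (x t) m i = 0 := by
        have h2 : i ≠ m + 1 := by omega
        simp [fluidRouting, hm, hlt, him.ne, h2]
      rw [hv, mul_zero]
      exact ⟨hlow i him, by simp⟩
    · subst him
      have hv : fluidRouting lam (x t) i i = i / lam * (1 - x t (i + 1)) := by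
        simp [fluidRouting, hm1, hlt]
      rw [hv]
      refine ⟨?_, hp0, hp1⟩
      have := hA i le_rfl
      rw [hm1] at this
      convert this using 1
      field_simp
    · rcases eq_or_lt_of_le (Nat.succ_le_of_lt him) with h1 | h1
      · subst h1
        have hv : fluidRouting lam (x t) m (m + 1) = 1 - m / lam * (1 - x t (m + 1)) := by
          simp [fluidRouting, hm1, hlt]
        rw [Nat.succ_eq_add_one, hv]
        refine ⟨?_, by linarith, by linarith⟩
        convert htop using 1
        field_simp
      · have hv : fluidRouting lam (x t) m i = 0 := by
          have h2 : i ≠ m + 1 := by omega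
          simp [fluidRouting, hm1, hlt, him.ne', h2]
        rw [hv, mul_zero]
        exact ⟨hQ.hasDerivAt_fluidArrivals_of_lt ht hx h h1, by simp⟩

end ThresholdBalancing

namespace ThresholdBalancing

variable {lam α : ℝ} {clock : ℕ → ℝ≥0 → ℕ} {u : ℕ → ℝ} {q₀ : ℕ → ℝ} {ℓ₀ : ℕ}
  {q : ℕ → ℝ → ℕ → ℝ} {ℓ : ℕ → ℝ → ℕ} {U : Ultrafilter ℕ} {x : ℝ → ℕ → ℝ}

/-! ### The fluid equations between two updates -/

lemma monotoneOn_of_hasDerivAt {f f' : ℝ → ℝ} {a b : ℝ} (hc : ContinuousOn f (Icc a b))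
    (hd : ∀ t ∈ Ioo a b, HasDerivAt f (f' t) t) (h0 : ∀ t ∈ Ioo a b, 0 ≤ f' t) :
    MonotoneOn f (Icc a b) := by
  refine monotoneOn_of_deriv_nonneg (convex_Icc a b) hc ?_ ?_
  · rw [interior_Icc]
    exact fun t ht => (hd t ht).differentiableAt.differentiableWithinAt
  · rw [interior_Icc]
    intro t ht
    rw [(hd t ht).deriv]
    exact h0 t ht

lemma eq_of_hasDerivAt_zero {f : ℝ → ℝ} {a b : ℝ} (hab : a ≤ b) (hc : ContinuousOn f (Icc a b))
    (hd : ∀ t ∈ Ioo a b, HasDerivAt f 0 t) : f a = f b := by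
  have h1 := monotoneOn_of_hasDerivAt hc hd (fun _ _ => le_rfl)
  have h2 := monotoneOn_of_hasDerivAt hc.neg (fun t ht => (hd t ht).neg)
    (fun _ _ => by simp)
  have ha := left_mem_Icc.2 hab
  have hb := right_mem_Icc.2 hab
  exact le_antisymm (h1 ha hb hab) (neg_le_neg_iff.1 (h2 ha hb hab))

/-- Grönwall's inequality backwards in time: a nonnegative function with `g' ≥ -C g` that vanishes at
`b` vanishes on `[a, b]`. -/
lemma eq_zero_of_gronwall {g g' : ℝ → ℝ} {a b C : ℝ} (hc : Continuous g)
    (hd : ∀ t ∈ Ioo a b, HasDerivAt g (g' t) t) (hC : ∀ t ∈ Ioo a b, -C * g t ≤ g' t)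
    (h0 : ∀ t ∈ Icc a b, 0 ≤ g t) (hb : g b = 0) : ∀ t ∈ Icc a b, g t = 0 := by
  intro t ht
  have hm : MonotoneOn (fun s => Real.exp (C * s) * g s) (Icc a b) := by
    refine monotoneOn_of_hasDerivAt
      (f' := fun s => Real.exp (C * s) * (C * 1) * g s + Real.exp (C * s) * g' s) ?_ ?_ ?_
    · exact ((Real.continuous_exp.comp (continuous_const.mul continuous_id)).mul hc).continuousOn
    · intro s hs
      exact (((hasDerivAt_id s).const_mul C).exp).mul (hd s hs)
    · intro s hs
      have h1 := hC s hs
      have h2 := Real.exp_pos (C * s)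
      nlinarith
  have h1 := hm ht (right_mem_Icc.2 (ht.1.trans ht.2)) ht.2
  simp only [hb, mul_zero] at h1
  have h2 := h0 t ht
  have h3 := Real.exp_pos (C * t)
  by_contra hne
  have : 0 < g t := lt_of_le_of_ne h2 (Ne.symm hne)
  nlinarith [mul_pos h3 this]

section Period

variable {a b : ℝ} {m : ℕ}

/-- No tasks arrive to the levels above `m + 1`, so these only decrease by departures. -/
lemma hasDerivAt_above (hx : IsOccupancyLimit lam U q₀ q x)
    (h : GoodRun lam α clock u q₀ ℓ₀ q ℓ) (ha : 0 ≤ a)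
    (hQ : ∀ t ∈ Ioo a b, IsQuiet U α clock q ℓ t m) {i : ℕ} (hi : m + 1 < i) :
    ∀ t ∈ Ioo a b, HasDerivAt (fun s => x s i) (-(i * (x t i - x t (i + 1)))) t := by
  intro t ht
  have := hx.hasDerivAt_of_fluidArrivals
    ((hQ t ht).hasDerivAt_fluidArrivals_of_lt (ha.trans_lt ht.1) hx h hi)
  rwa [zero_sub] at this

lemma antitoneOn_above (hx : IsOccupancyLimit lam U q₀ q x)
    (h : GoodRun lam α clock u q₀ ℓ₀ q ℓ) (ha : 0 ≤ a)
    (hQ : ∀ t ∈ Ioo a b, IsQuiet U α clock q ℓ t m) {i : ℕ} (hi : m + 1 < i) :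
    AntitoneOn (fun s => x s i) (Icc a b) := by
  have := monotoneOn_of_hasDerivAt (hx.continuous i).neg.continuousOn
    (fun t ht => (hasDerivAt_above hx h ha hQ hi t ht).neg) (fun t ht => by
      rw [neg_neg]
      have := (hx.mem h (ha.trans ht.1.le)).2.2 i
      exact mul_nonneg (Nat.cast_nonneg _) (by linarith))
  exact fun s hs t ht hst => neg_le_neg_iff.1 (this hs ht hst)

lemma sum_mul_sub (p : ℕ → ℝ) (k : ℕ) :
    ∑ i ∈ Finset.Icc 1 k, (i : ℝ) * (p i - p (i + 1))
      = ∑ i ∈ Finset.Icc 1 k, p i - k * p (k + 1) := by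
  induction k with
  | zero => simp
  | succ k ih =>
    rw [Finset.sum_Icc_succ_top (by omega), Finset.sum_Icc_succ_top (by omega), ih]
    push_cast
    ring

/-- The total number of tasks in the first `m + 1` levels solves a linear equation. -/
lemma hasDerivAt_sum_occupancy (hx : IsOccupancyLimit lam U q₀ q x)
    (h : GoodRun lam α clock u q₀ ℓ₀ q ℓ) {t : ℝ} (ht : 0 < t)
    (hQ : IsQuiet U α clock q ℓ t m) :
    HasDerivAt (fun s => ∑ i ∈ Finset.Icc 1 (m + 1), x s i)
      (lam - ∑ i ∈ Finset.Icc 1 (m + 1), x t i + (m + 1) * x t (m + 2)) t := by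
  have h1 := hQ.hasDerivAt_sum_fluidArrivals ht hx h
  have h2 : HasDerivAt (fun s => ∑ i ∈ Finset.Icc 1 (m + 1), (x 0 i - intensity x i s))
      (∑ i ∈ Finset.Icc 1 (m + 1), -((i : ℝ) * (x t i - x t (i + 1)))) t :=
    HasDerivAt.fun_sum fun i _ => (hx.hasDerivAt_intensity i t).const_sub _
  have h3 := h1.add h2
  rw [Finset.sum_neg_distrib, sum_mul_sub] at h3
  have h4 : lam + -(∑ i ∈ Finset.Icc 1 (m + 1), x t i - ((m + 1 : ℕ) : ℝ) * x t (m + 1 + 1))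
      = lam - ∑ i ∈ Finset.Icc 1 (m + 1), x t i + (m + 1) * x t (m + 2) := by
    push_cast; ring
  rw [h4] at h3
  refine h3.congr_of_eventuallyEq (Eventually.of_forall fun s => ?_)
  simp only [Pi.add_apply]
  rw [← Finset.sum_add_distrib]
  refine Finset.sum_congr rfl fun i _ => ?_
  rw [fluidArrivals]
  ring

lemma sum_occupancy_eq_iff {p : ℕ → ℝ} (hp : p ∈ occupancySpace) (k : ℕ) :
    ∑ i ∈ Finset.Icc 1 (k + 1), p i ≤ k + 1 ∧
      (∑ i ∈ Finset.Icc 1 (k + 1), p i = k + 1 ↔ p (k + 1) = 1) := by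
  have hanti := occupancySpace_antitone hp
  have hcard : ∑ i ∈ Finset.Icc 1 (k + 1), (1 : ℝ) = k + 1 := by simp
  refine ⟨?_, fun heq => ?_, fun h1 => ?_⟩
  · rw [← hcard]; exact Finset.sum_le_sum fun i _ => (hp.2.1 i).2
  · rw [← hcard] at heq
    exact (Finset.sum_eq_sum_iff_of_le fun i _ => (hp.2.1 i).2).1 heq (k + 1) (by simp)
  · rw [← hcard]
    refine Finset.sum_congr rfl fun i hi => le_antisymm (hp.2.1 i).2 ?_
    rw [← h1]
    exact hanti (Finset.mem_Icc.1 hi).2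

/-- Between updates the level `m + 1` is full at one time at most. At two such times the total
number of tasks in the first `m + 1` levels is maximal, hence stationary; this forces level `m + 2`
to be constant in between and then, by Grönwall's inequality, since the beginning of the period; but
then the total number of tasks solves an equation that never reaches its maximum. -/
theorem subsingleton_full (hx : IsOccupancyLimit lam U q₀ q x)
    (h : GoodRun lam α clock u q₀ ℓ₀ q ℓ) (ha : 0 ≤ a)
    (hQ : ∀ t ∈ Ioo a b, IsQuiet U α clock q ℓ t m) (hlt : x a (m + 1) < 1) :
    {t ∈ Ioo a b | x t (m + 1) = 1}.Subsingleton := by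
  have key : ∀ t₁ ∈ Ioo a b, ∀ t₂ ∈ Ioo a b, t₁ < t₂ → x t₁ (m + 1) = 1 → x t₂ (m + 1) ≠ 1 := by
    intro t₁ ht₁ t₂ ht₂ h12 e1 e2
    have hpos : ∀ t ∈ Ioo a b, 0 < t := fun t ht => ha.trans_lt ht.1
    set y : ℝ → ℝ := fun s => ∑ i ∈ Finset.Icc 1 (m + 1), x s i with hy
    have hyc : Continuous y := continuous_finsetSum _ fun i _ => hx.continuous i
    have hstat : ∀ t ∈ Ioo a b, x t (m + 1) = 1 → (m + 1) * x t (m + 2) = m + 1 - lam := by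
      intro t ht e
      have hyt : y t = m + 1 := (sum_occupancy_eq_iff (hx.mem h (hpos t ht).le) m).2.2 e
      have hmax : IsLocalMax y t := (hx.eventually_mem h (hpos t ht)).mono fun s hs => by
        show y s ≤ y t
        rw [hyt]; exact (sum_occupancy_eq_iff hs m).1
      have hd := hasDerivAt_sum_occupancy hx h (hpos t ht) (hQ t ht)
      have h0 := hmax.hasDerivAt_eq_zero hd
      have : ∑ i ∈ Finset.Icc 1 (m + 1), x t i = m + 1 := hyt
      rw [this] at h0
      linarith
    have hanti := antitoneOn_above hx h ha hQ (i := m + 2) (by omega)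
    have hm1 : (0 : ℝ) < m + 1 := by positivity
    have hxeq : x t₁ (m + 2) = x t₂ (m + 2) := by
      have := (hstat t₁ ht₁ e1).trans (hstat t₂ ht₂ e2).symm
      exact mul_left_cancel₀ hm1.ne' this
    -- level `m + 2` is constant on `[t₁, t₂]`
    have hconst : ∀ s ∈ Ioo t₁ t₂, x s (m + 2) = x t₁ (m + 2) := by
      intro s hs
      have hs' : s ∈ Icc a b := ⟨ht₁.1.le.trans hs.1.le, hs.2.le.trans ht₂.2.le⟩
      have f1 := hanti (Ioo_subset_Icc_self ht₁) hs' hs.1.le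
      have f2 := hanti hs' (Ioo_subset_Icc_self ht₂) hs.2.le
      simp only at f1 f2
      linarith
    obtain ⟨s, hs⟩ := exists_between h12
    have hsab : s ∈ Ioo a b := ⟨ht₁.1.trans hs.1, hs.2.trans ht₂.2⟩
    have hg0 : x s (m + 2) - x s (m + 3) = 0 := by
      have d1 := hasDerivAt_above hx h ha hQ (i := m + 2) (by omega) s hsab
      have d2 : HasDerivAt (fun r => x r (m + 2)) 0 s := by
        refine (hasDerivAt_const s (x t₁ (m + 2))).congr_of_eventuallyEq ?_
        filter_upwards [Ioo_mem_nhds hs.1 hs.2] with r hr using hconst r hr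
      have := d1.unique d2
      rw [neg_eq_zero] at this
      rcases mul_eq_zero.1 this with h3 | h3
      · exact absurd h3 (by positivity)
      · exact h3
    -- levels `m + 2` and `m + 3` coincide at time `s`, and therefore at all earlier times
    have hg : ∀ t ∈ Icc a s, x t (m + 2) - x t (m + 3) = 0 := by
      refine eq_zero_of_gronwall (g := fun t => x t (m + 2) - x t (m + 3)) (C := ((m + 2 : ℕ) : ℝ))
        ((hx.continuous _).sub (hx.continuous _)) (fun t ht =>
          (hasDerivAt_above hx h ha hQ (i := m + 2) (by omega) t
            ⟨ht.1, ht.2.trans hsab.2⟩).sub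
          (hasDerivAt_above hx h ha hQ (i := m + 3) (by omega) t ⟨ht.1, ht.2.trans hsab.2⟩))
        (fun t ht => ?_) (fun t ht => ?_) hg0
      · have := (hx.mem h (ha.trans ht.1.le)).2.2 (m + 3)
        have h5 : 0 ≤ ((m + 3 : ℕ) : ℝ) * (x t (m + 3) - x t (m + 3 + 1)) :=
          mul_nonneg (Nat.cast_nonneg _) (by linarith)
        show -((m + 2 : ℕ) : ℝ) * (x t (m + 2) - x t (m + 3)) ≤ _
        linarith
      · have := (hx.mem h (ha.trans ht.1)).2.2 (m + 2)
        show 0 ≤ x t (m + 2) - x t (m + 3)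
        linarith
    have hlow : ∀ t ∈ Icc a t₁, x t (m + 2) = x t₁ (m + 2) := by
      intro t ht
      refine eq_of_hasDerivAt_zero (f := fun r => x r (m + 2)) ht.2
        (hx.continuous _).continuousOn fun r hr => ?_
      have hra : a < r := ht.1.trans_lt hr.1
      have d1 := hasDerivAt_above hx h ha hQ (i := m + 2) (by omega) r
        ⟨hra, hr.2.trans ht₁.2⟩
      rwa [show x r (m + 2) - x r (m + 2 + 1) = 0 from hg r ⟨hra.le, (hr.2.trans hs.1).le⟩,
        mul_zero, neg_zero] at d1
    -- hence `m + 1 - y` decays exponentially on `[a, t₁]`, and vanishes at `a` if it does at `t₁`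
    have hE : Real.exp a * (m + 1 - y a) = Real.exp t₁ * (m + 1 - y t₁) := by
      refine eq_of_hasDerivAt_zero (f := fun r => Real.exp r * (m + 1 - y r)) ht₁.1.le
        (Real.continuous_exp.mul (continuous_const.sub hyc)).continuousOn fun r hr => ?_
      have hr' : r ∈ Ioo a b := ⟨hr.1, hr.2.trans ht₁.2⟩
      have d1 := (Real.hasDerivAt_exp r).mul
        ((hasDerivAt_sum_occupancy hx h (hpos r hr') (hQ r hr')).const_sub ((m : ℝ) + 1))
      refine d1.congr_deriv ?_
      have f1 := hlow r ⟨hr.1.le, hr.2.le⟩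
      have f2 := hstat t₁ ht₁ e1
      rw [f1, f2]
      ring
    have hy1 : y t₁ = m + 1 := (sum_occupancy_eq_iff (hx.mem h (hpos t₁ ht₁).le) m).2.2 e1
    rw [hy1, sub_self, mul_zero] at hE
    have hya : y a = m + 1 := by
      rcases mul_eq_zero.1 hE with h3 | h3
      · exact absurd h3 (Real.exp_pos a).ne'
      · linarith
    exact hlt.ne ((sum_occupancy_eq_iff (hx.mem h ha) m).2.1 hya)
  intro t₁ h1 t₂ h2
  rcases lt_trichotomy t₁ t₂ with h3 | h3 | h3
  · exact absurd h2.2 (key t₁ h1.1 t₂ h2.1 h3 h1.2)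
  · exact h3
  · exact absurd h1.2 (key t₂ h2.1 t₁ h1.1 h3 h2.2)

/-- The state right after an update that lowers the threshold is again in the interior: the levels
`m - 1` and `m` do not reach `α` simultaneously. Otherwise Grönwall's inequality, applied backwards in
time to their difference for as long as level `m` is away from `1`, shows that they coincide; then both
are constant, although level `m` was above `α` before. -/
theorem alpha_lt_of_update_down (hx : IsOccupancyLimit lam U q₀ q x)
    (h : GoodRun lam α clock u q₀ ℓ₀ q ℓ) (ha : 0 ≤ a) (hab : a < b)
    (hQ : ∀ t ∈ Ioo a b, IsQuiet U α clock q ℓ t m) (hma : α < x a m) (hmb : x b m = α) :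
    ∃ k, m = k + 1 ∧ α < x b k := by
  have hb : 0 ≤ b := ha.trans hab.le
  have hxb := hx.mem h hb
  have hα := h.alpha_lt
  rcases m with _ | _ | k
  · rw [hxb.1] at hmb; linarith
  · exact ⟨0, rfl, by rw [hxb.1]; exact hα⟩
  refine ⟨k + 1, rfl, ?_⟩
  by_contra! hle
  have hkb : x b (k + 1) = α := le_antisymm hle (hmb ▸ hxb.2.2 (k + 1))
  -- after time `s₁` level `k + 2` stays away from `1`, and at time `s₁` it is above `α`
  set β := (1 + α) / 2 with hβ
  obtain ⟨s₁, hs₁, hs₁α, hs₁β⟩ : ∃ s₁ ∈ Ico a b, α < x s₁ (k + 2) ∧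
      ∀ s ∈ Ioc s₁ b, x s (k + 2) < β := by
    set S := {s ∈ Icc a b | β ≤ x s (k + 2)} with hS
    rcases S.eq_empty_or_nonempty with hE | hne
    · refine ⟨a, ⟨le_rfl, hab⟩, hma, fun s hs => ?_⟩
      by_contra! h1
      have : s ∈ S := ⟨⟨hs.1.le, hs.2⟩, h1⟩
      rw [hE] at this
      exact this
    · have hcomp : IsCompact S :=
        isCompact_Icc.inter_right (isClosed_le continuous_const (hx.continuous (k + 2)))
      have hmem := hcomp.sSup_mem hne
      refine ⟨sSup S, ⟨hmem.1.1, lt_of_le_of_ne hmem.1.2 ?_⟩, ?_, fun s hs => ?_⟩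
      · intro hEq
        have := hmem.2
        rw [hEq, hmb] at this
        linarith
      · linarith [hmem.2]
      · by_contra! h1
        exact absurd (le_csSup hcomp.bddAbove ⟨⟨hmem.1.1.trans hs.1.le, hs.2⟩, h1⟩) (not_le.2 hs.1)
  have hin : ∀ t ∈ Ioo s₁ b, t ∈ Ioo a b := fun t ht => ⟨hs₁.1.trans_lt ht.1, ht.2⟩
  have hpos : ∀ t ∈ Ioo s₁ b, 0 < t := fun t ht => ha.trans_lt (hin t ht).1
  have hlt1 : ∀ t ∈ Ioo s₁ b, x t (k + 2) < 1 := fun t ht => by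
    linarith [hs₁β t ⟨ht.1, ht.2.le⟩]
  have d1 : ∀ t ∈ Ioo s₁ b, HasDerivAt (fun s => x s (k + 1))
      (lam * ((x t k - x t (k + 1)) / (1 - x t (k + 2)))
        - ((k + 1 : ℕ) : ℝ) * (x t (k + 1) - x t (k + 2))) t := fun t ht =>
    hx.hasDerivAt_of_fluidArrivals ((hQ t (hin t ht)).hasDerivAt_fluidArrivals_of_le (hpos t ht)
      hx h (hlt1 t ht) (i := k + 1) (by omega) (by omega))
  have d2 : ∀ t ∈ Ioo s₁ b, HasDerivAt (fun s => x s (k + 2))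
      (lam * ((x t (k + 1) - x t (k + 2)) / (1 - x t (k + 2)))
        - ((k + 2 : ℕ) : ℝ) * (x t (k + 2) - x t (k + 3))) t := fun t ht =>
    hx.hasDerivAt_of_fluidArrivals ((hQ t (hin t ht)).hasDerivAt_fluidArrivals_of_le (hpos t ht)
      hx h (hlt1 t ht) (i := k + 2) (by omega) (by omega))
  have hlam := h.lam_pos
  have hβ1 : 0 < 1 - β := by linarith
  have hg : ∀ t ∈ Icc s₁ b, x t (k + 1) - x t (k + 2) = 0 := by
    refine eq_zero_of_gronwall (g := fun t => x t (k + 1) - x t (k + 2))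
      (C := ((k + 1 : ℕ) : ℝ) + lam / (1 - β))
      ((hx.continuous _).sub (hx.continuous _)) (fun t ht => (d1 t ht).sub (d2 t ht))
      (fun t ht => ?_) (fun t ht => ?_) (by rw [hkb, hmb, sub_self])
    · have hxt := hx.mem h (hpos t ht).le
      have o1 := hxt.2.2 k
      have o2 := hxt.2.2 (k + 1)
      have o3 := hxt.2.2 (k + 2)
      have p1 : 0 < 1 - x t (k + 2) := by linarith [hlt1 t ht]
      have p2 : 0 ≤ lam * ((x t k - x t (k + 1)) / (1 - x t (k + 2))) :=
        mul_nonneg hlam.le (div_nonneg (by linarith) p1.le)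
      have p3 : 0 ≤ ((k + 2 : ℕ) : ℝ) * (x t (k + 2) - x t (k + 3)) :=
        mul_nonneg (Nat.cast_nonneg _) (by linarith)
      have p4 : lam * ((x t (k + 1) - x t (k + 2)) / (1 - x t (k + 2)))
          ≤ lam / (1 - β) * (x t (k + 1) - x t (k + 2)) := by
        rw [div_mul_eq_mul_div, mul_div_assoc]
        have : 0 ≤ x t (k + 1) - x t (k + 2) := by linarith
        have := hs₁β t ⟨ht.1, ht.2.le⟩
        gcongr
      show -(((k + 1 : ℕ) : ℝ) + lam / (1 - β)) * (x t (k + 1) - x t (k + 2)) ≤ _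
      linarith
    · have := (hx.mem h (ha.trans (hs₁.1.trans ht.1))).2.2 (k + 1)
      show 0 ≤ x t (k + 1) - x t (k + 2)
      linarith
  have hzero : ∀ t ∈ Ioo s₁ b, HasDerivAt (fun s => x s (k + 2)) 0 t := by
    intro t ht
    have e0 := hg t ⟨ht.1.le, ht.2.le⟩
    have e1 := d1 t ht
    have e2 := d2 t ht
    rw [e0, mul_zero, sub_zero] at e1
    rw [e0, zero_div, mul_zero, zero_sub] at e2
    have hxt := hx.mem h (hpos t ht).le
    -- the levels coincide, so their derivatives agree; one is nonnegative and one is nonpositive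
    have heq : (fun s => x s (k + 1)) =ᶠ[𝓝 t] fun s => x s (k + 2) := by
      filter_upwards [Ioo_mem_nhds ht.1 ht.2] with s hs
      have := hg s ⟨hs.1.le, hs.2.le⟩
      linarith
    have e3 := e1.unique (e2.congr_of_eventuallyEq heq)
    have p1 : 0 < 1 - x t (k + 2) := by linarith [hlt1 t ht]
    have p2 : 0 ≤ lam * ((x t k - x t (k + 1)) / (1 - x t (k + 2))) :=
      mul_nonneg hlam.le (div_nonneg (by linarith [hxt.2.2 k]) p1.le)
    have p3 : 0 ≤ ((k + 2 : ℕ) : ℝ) * (x t (k + 2) - x t (k + 3)) :=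
      mul_nonneg (Nat.cast_nonneg _) (by linarith [hxt.2.2 (k + 2)])
    have p4 : -(((k + 2 : ℕ) : ℝ) * (x t (k + 2) - x t (k + 3))) = 0 := by linarith
    rwa [p4] at e2
  have := eq_of_hasDerivAt_zero hs₁.2.le (hx.continuous (k + 2)).continuousOn hzero
  rw [hmb] at this
  linarith

end Period

end ThresholdBalancing

namespace ThresholdBalancing

variable {lam α : ℝ} {clock : ℕ → ℝ≥0 → ℕ} {u : ℕ → ℝ} {q₀ : ℕ → ℝ} {ℓ₀ : ℕ}
  {q : ℕ → ℝ → ℕ → ℝ} {ℓ : ℕ → ℝ → ℕ} {U : Ultrafilter ℕ} {x : ℝ → ℕ → ℝ}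

/-! ### From one update to the next -/

/-- An update in the limit: the limiting time, the new threshold, and the index `idx n` of the
arrival at which the update occurs in the `n`-th system (`0` for the initial condition). -/
structure UpdateState where
  time : ℝ
  thr : ℕ
  idx : ℕ → ℕ

/-- The update `st` is the limit of updates of the systems with `n` pools, and the limiting state
lies in the interior of the region where the threshold does not change. -/
structure UpdateState.IsGood (U : Ultrafilter ℕ) (α : ℝ) (clock : ℕ → ℝ≥0 → ℕ) (ℓ : ℕ → ℝ → ℕ)
    (x : ℝ → ℕ → ℝ) (st : UpdateState) : Prop where
  nonneg : 0 ≤ st.time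
  tendsto : Tendsto (fun n => arrivalTime (clock 0) n (st.idx n)) U (𝓝 st.time)
  thr_eq : ∀ᶠ n in U, ℓ n (arrivalTime (clock 0) n (st.idx n)) = st.thr
  alpha_lt : α < x st.time st.thr
  lt_one : x st.time (st.thr + 1) < 1

/-- The threshold is not updated on any compact time interval after `st`, for almost all `n`. -/
def UpdateState.IsLast (U : Ultrafilter ℕ) (clock : ℕ → ℝ≥0 → ℕ) (ℓ : ℕ → ℝ → ℕ)
    (st : UpdateState) : Prop :=
  ∀ M : ℝ, ∀ᶠ n in U, ∀ j, st.idx n ≤ j → arrivalTime (clock 0) n j ≤ M →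
    ℓ n (arrivalTime (clock 0) n j) = st.thr

/-- `st'` is the first update after `st`. -/
structure UpdateState.IsNext (U : Ultrafilter ℕ) (α : ℝ) (clock : ℕ → ℝ≥0 → ℕ)
    (ℓ : ℕ → ℝ → ℕ) (x : ℝ → ℕ → ℝ) (st st' : UpdateState) : Prop where
  time_lt : st.time < st'.time
  no_update : ∀ᶠ n in U, ∀ j, st.idx n ≤ j → j < st'.idx n →
    ℓ n (arrivalTime (clock 0) n j) = st.thr
  update : (st'.thr = st.thr + 1 ∧ x st'.time (st.thr + 1) = 1) ∨
    (st.thr = st'.thr + 1 ∧ x st'.time st.thr = α)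

lemma isQuiet_of_no_update (hx : IsOccupancyLimit lam U q₀ q x)
    (h : GoodRun lam α clock u q₀ ℓ₀ q ℓ) {st : UpdateState} (hst : st.IsGood U α clock ℓ x)
    {t δ : ℝ} (ht : st.time < t) (hδ : 0 < δ)
    (hno : ∀ᶠ n in U, ∀ j, st.idx n ≤ j → arrivalTime (clock 0) n j < t + δ →
      ℓ n (arrivalTime (clock 0) n j) = st.thr) : IsQuiet U α clock q ℓ t st.thr := by
  refine ⟨min δ ((t - st.time) / 2), lt_min hδ (by linarith), ?_⟩
  have hm1 := min_le_left δ ((t - st.time) / 2)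
  have hm2 := min_le_right δ ((t - st.time) / 2)
  filter_upwards [hno, hx.eventually_one_le, hst.tendsto.eventually
    (gt_mem_nhds (by linarith : st.time < t - (t - st.time) / 2))] with n h1 hn h2 j hj hjt
  rw [abs_lt] at hjt
  have hidx : st.idx n < j :=
    (h.arr.arrivalTime_strictMono hn).lt_iff_lt.1 (h2.trans (by linarith))
  obtain ⟨k, rfl⟩ := Nat.exists_eq_add_of_le' hj
  have hk : arrivalTime (clock 0) n k < arrivalTime (clock 0) n (k + 1) :=
    h.arr.arrivalTime_strictMono hn (Nat.lt_succ_self k)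
  have e1 := h1 k (by omega) (by linarith)
  have e2 := h1 (k + 1) (by omega) (by linarith)
  have e3 := (h.sys n hn).leftLim_threshold h.arr hn k
  have e4 := (h.sys n hn).threshold_succ h.arr hn k
  rw [e1] at e3 e4
  rw [e2] at e4
  exact ⟨e3, by omega⟩

lemma UpdateState.IsLast.isQuiet {st : UpdateState} (hl : st.IsLast U clock ℓ)
    (hx : IsOccupancyLimit lam U q₀ q x)
    (h : GoodRun lam α clock u q₀ ℓ₀ q ℓ) (hst : st.IsGood U α clock ℓ x) {t : ℝ}
    (ht : st.time < t) : IsQuiet U α clock q ℓ t st.thr :=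
  isQuiet_of_no_update hx h hst ht one_pos
    ((hl (t + 1)).mono fun _ hn j h1 h2 => hn j h1 h2.le)

lemma isQuiet_of_tendsto (hx : IsOccupancyLimit lam U q₀ q x)
    (h : GoodRun lam α clock u q₀ ℓ₀ q ℓ) {st : UpdateState} (hst : st.IsGood U α clock ℓ x)
    {idx' : ℕ → ℕ} {b : ℝ}
    (hb : Tendsto (fun n => arrivalTime (clock 0) n (idx' n)) U (𝓝 b))
    (hno : ∀ᶠ n in U, ∀ j, st.idx n ≤ j → j < idx' n →
      ℓ n (arrivalTime (clock 0) n j) = st.thr) :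
    ∀ t ∈ Ioo st.time b, IsQuiet U α clock q ℓ t st.thr := by
  intro t ht
  refine isQuiet_of_no_update hx h hst ht.1 (δ := (b - t) / 2) (by linarith [ht.2]) ?_
  filter_upwards [hno, hx.eventually_one_le, hb.eventually
    (lt_mem_nhds (by linarith [ht.2] : t + (b - t) / 2 < b))] with n h1 hn h2 j hj hjt
  exact h1 j hj ((h.arr.arrivalTime_strictMono hn).lt_iff_lt.1 (hjt.trans h2))

/-- In the interior region no arrival changes the threshold for a positive amount of time. -/
lemma no_change_near (hx : IsOccupancyLimit lam U q₀ q x)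
    (h : GoodRun lam α clock u q₀ ℓ₀ q ℓ) {t : ℝ} {m : ℕ} (h1 : α < x t m)
    (h2 : x t (m + 1) < 1) :
    ∃ δ : ℝ, 0 < δ ∧ ∀ᶠ n in U, ∀ s, 0 < s → |s - t| < δ →
      thresholdChange α n (Function.leftLim (q n) s) m = 0 := by
  obtain ⟨δ₁, hδ₁, e1⟩ := hx.leftLim_near h t m (sub_pos.2 h1)
  obtain ⟨δ₂, hδ₂, e2⟩ := hx.leftLim_near h t (m + 1)
    (half_pos (sub_pos.2 h2))
  refine ⟨min δ₁ δ₂, lt_min hδ₁ hδ₂, ?_⟩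
  have hlim : Tendsto (fun n : ℕ => 1 - 1 / (n : ℝ)) U (𝓝 (1 - 0)) :=
    tendsto_const_nhds.sub (tendsto_one_div_atTop_nhds_zero_nat.mono_left hx.le_atTop)
  filter_upwards [e1, e2, hx.eventually_one_le,
    Eventually.filter_mono hx.le_atTop (eventually_alpha_lt h),
    hlim.eventually (lt_mem_nhds (by linarith : (1 + x t (m + 1)) / 2 < 1 - 0))]
    with n f1 f2 hn f3 f4 s hs hst
  have g1 := abs_lt.1 (f1 s hs (hst.trans_le (min_le_left _ _)))
  have g2 := abs_lt.1 (f2 s hs (hst.trans_le (min_le_right _ _)))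
  rcases thresholdChange_cases f3 ((h.sys n hn).leftLim_mem hs) m with h3 | h3 | h3
  · exact h3.1
  · linarith [h3.2, g2.2]
  · linarith [h3.2, g1.1]

lemma tendsto_leftLim_occupancy (hx : IsOccupancyLimit lam U q₀ q x)
    (h : GoodRun lam α clock u q₀ ℓ₀ q ℓ) {σ : ℕ → ℝ} {t : ℝ} (hσ : Tendsto σ U (𝓝 t))
    (hpos : ∀ᶠ n in U, 0 < σ n) (i : ℕ) :
    Tendsto (fun n => Function.leftLim (q n) (σ n) i) U (𝓝 (x t i)) := by
  rw [Metric.tendsto_nhds]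
  intro ε hε
  obtain ⟨δ, hδ, h1⟩ := hx.leftLim_near h t i hε
  filter_upwards [h1, hpos, Metric.tendsto_nhds.1 hσ δ hδ] with n e1 e2 e3
  exact e1 _ e2 e3

/-- From a good update one passes either to no further update or to a good next one: take the first
arrival that changes the threshold. Its time has a limit along `U`, unless it escapes to infinity, and
the ultrafilter decides the direction of the change. -/
theorem UpdateState.IsGood.step {st : UpdateState} (hst : st.IsGood U α clock ℓ x)
    (hx : IsOccupancyLimit lam U q₀ q x) (h : GoodRun lam α clock u q₀ ℓ₀ q ℓ) :
    st.IsLast U clock ℓ ∨ ∃ st' : UpdateState, st'.IsGood U α clock ℓ x ∧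
      st.IsNext U α clock ℓ x st' := by
  by_cases hl : st.IsLast U clock ℓ
  · exact Or.inl hl
  refine Or.inr ?_
  obtain ⟨M, hM⟩ : ∃ M : ℝ, ∀ᶠ n in U, ∃ j, st.idx n ≤ j ∧ arrivalTime (clock 0) n j ≤ M ∧
      ℓ n (arrivalTime (clock 0) n j) ≠ st.thr := by
    unfold UpdateState.IsLast at hl
    simp only [not_forall, ← Ultrafilter.eventually_not] at hl
    obtain ⟨M, hM⟩ := hl
    refine ⟨M, hM.mono fun n hn => ?_⟩
    obtain ⟨j, h1, h2, h3⟩ := hn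
    exact ⟨j, h1, h2, h3⟩
  -- the index of the first arrival that changes the threshold
  set idx' : ℕ → ℕ := fun n =>
    sInf {j | st.idx n ≤ j ∧ ℓ n (arrivalTime (clock 0) n j) ≠ st.thr} with hidx'
  have hfirst : ∀ᶠ n in U, st.idx n < idx' n ∧ arrivalTime (clock 0) n (idx' n) ≤ M ∧
      ℓ n (arrivalTime (clock 0) n (idx' n)) ≠ st.thr := by
    filter_upwards [hM, hst.thr_eq, hx.eventually_one_le] with n ⟨j, h1, h2, h3⟩ h4 hn
    have hmem : st.idx n ≤ idx' n ∧ ℓ n (arrivalTime (clock 0) n (idx' n)) ≠ st.thr :=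
      Nat.sInf_mem (s := {j | st.idx n ≤ j ∧
        ℓ n (arrivalTime (clock 0) n j) ≠ st.thr}) ⟨j, h1, h3⟩
    have hle : idx' n ≤ j := Nat.sInf_le (s := {j | st.idx n ≤ j ∧
        ℓ n (arrivalTime (clock 0) n j) ≠ st.thr}) ⟨h1, h3⟩
    refine ⟨lt_of_le_of_ne hmem.1 fun heq => hmem.2 ?_, ?_, hmem.2⟩
    · rw [← heq]; exact h4
    · exact ((h.arr.arrivalTime_strictMono hn).monotone hle).trans h2
  have hno : ∀ᶠ n in U, ∀ j, st.idx n ≤ j → j < idx' n →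
      ℓ n (arrivalTime (clock 0) n j) = st.thr := by
    refine Eventually.of_forall fun n j h1 h2 => ?_
    by_contra h3
    exact Nat.notMem_of_lt_sInf h2 ⟨h1, h3⟩
  have hpos : ∀ᶠ n in U, 0 < arrivalTime (clock 0) n (idx' n) := by
    filter_upwards [hfirst, hx.eventually_one_le] with n h1 hn
    exact h.arr.arrivalTime_pos hn (by omega)
  obtain ⟨b, hb⟩ : ∃ b, Tendsto (fun n => arrivalTime (clock 0) n (idx' n)) U (𝓝 b) := by
    have hmem : ↑(U.map fun n => arrivalTime (clock 0) n (idx' n)) ≤ 𝓟 (Icc (0 : ℝ) M) := by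
      rw [le_principal_iff]
      exact (hpos.and hfirst).mono fun n hn => ⟨hn.1.le, hn.2.2.1⟩
    obtain ⟨b, -, hb⟩ := isCompact_Icc.ultrafilter_le_nhds _ hmem
    exact ⟨b, hb⟩
  -- the change of the threshold at that arrival
  have hchange : ∀ᶠ n in U, (ℓ n (arrivalTime (clock 0) n (idx' n)) : ℤ) = st.thr +
      thresholdChange α n (Function.leftLim (q n) (arrivalTime (clock 0) n (idx' n))) st.thr ∧
      thresholdChange α n (Function.leftLim (q n) (arrivalTime (clock 0) n (idx' n))) st.thr
        ≠ 0 := by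
    filter_upwards [hfirst, hno, hx.eventually_one_le] with n h1 h2 hn
    obtain ⟨k, hk⟩ := Nat.exists_eq_add_of_le' (by omega : 1 ≤ idx' n)
    have e1 := (h.sys n hn).threshold_succ h.arr hn k
    rw [← hk, h2 k (by omega) (by omega)] at e1
    refine ⟨e1, fun h0 => h1.2.2 ?_⟩
    rw [h0] at e1
    omega
  have hab : st.time < b := by
    obtain ⟨δ, hδ, hnc⟩ := no_change_near hx h hst.alpha_lt hst.lt_one
    have hge : ∀ᶠ n in U, st.time + δ ≤ arrivalTime (clock 0) n (idx' n) := by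
      filter_upwards [hnc, hchange, hpos, hfirst, hx.eventually_one_le,
        hst.tendsto.eventually (lt_mem_nhds (by linarith : st.time - δ < st.time))]
        with n h1 h2 h3 h4 hn h5
      by_contra! hlt
      have := (h.arr.arrivalTime_strictMono hn) h4.1
      exact h2.2 (h1 _ h3 (by rw [abs_lt]; constructor <;> linarith))
    linarith [ge_of_tendsto hb hge]
  have hQ := isQuiet_of_tendsto hx h hst hb hno
  have hb0 : 0 ≤ b := hst.nonneg.trans hab.le
  have hxb := hx.mem h hb0
  have hcases : (∀ᶠ n in U, ℓ n (arrivalTime (clock 0) n (idx' n)) = st.thr + 1 ∧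
        1 - 1 / (n : ℝ) ≤ Function.leftLim (q n) (arrivalTime (clock 0) n (idx' n)) (st.thr + 1)) ∨
      (∀ᶠ n in U, ℓ n (arrivalTime (clock 0) n (idx' n)) + 1 = st.thr ∧
        Function.leftLim (q n) (arrivalTime (clock 0) n (idx' n)) st.thr ≤ α) := by
    rw [← Ultrafilter.eventually_or]
    filter_upwards [hchange, hpos, hx.eventually_one_le,
      Eventually.filter_mono hx.le_atTop (eventually_alpha_lt h)] with n h1 h2 hn h3
    rcases thresholdChange_cases h3 ((h.sys n hn).leftLim_mem h2) st.thr with h4 | h4 | h4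
    · exact absurd h4.1 h1.2
    · exact Or.inl ⟨by omega, h4.2⟩
    · exact Or.inr ⟨by omega, h4.2⟩
  rcases hcases with hup | hdown
  · have hone : x b (st.thr + 1) = 1 := by
      refine le_antisymm (hxb.2.1 _).2 ?_
      have hlim : Tendsto (fun n : ℕ => 1 - 1 / (n : ℝ)) U (𝓝 (1 - 0)) :=
        tendsto_const_nhds.sub (tendsto_one_div_atTop_nhds_zero_nat.mono_left hx.le_atTop)
      rw [sub_zero] at hlim
      exact le_of_tendsto_of_tendsto hlim (tendsto_leftLim_occupancy hx h hb hpos _)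
        (hup.mono fun n hn => hn.2)
    refine ⟨⟨b, st.thr + 1, idx'⟩, ⟨hb0, hb, hup.mono fun n hn => hn.1, ?_, ?_⟩,
      ⟨hab, hno, Or.inl ⟨rfl, hone⟩⟩⟩
    · show α < x b (st.thr + 1)
      rw [hone]; exact h.alpha_lt
    · have h1 := antitoneOn_above hx h hst.nonneg hQ (i := st.thr + 2) (by omega)
        (left_mem_Icc.2 hab.le) (right_mem_Icc.2 hab.le) hab.le
      have h2 := (hx.mem h hst.nonneg).2.2 (st.thr + 1)
      exact h1.trans_lt (h2.trans_lt hst.lt_one)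
  · have hle : x b st.thr ≤ α :=
      le_of_tendsto (tendsto_leftLim_occupancy hx h hb hpos _) (hdown.mono fun n hn => hn.2)
    have hge : α ≤ x b st.thr := by
      refine ge_of_tendsto (((hx.continuous st.thr).tendsto b).mono_left
        (nhdsWithin_le_nhds (s := Iio b))) ?_
      filter_upwards [Ioo_mem_nhdsLT hab] with t ht
      exact (hQ t ht).alpha_le (hst.nonneg.trans_lt ht.1) hx h
    have heq := le_antisymm hle hge
    obtain ⟨k, hk, hαk⟩ := alpha_lt_of_update_down hx h hst.nonneg hab hQ hst.alpha_lt heq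
    refine ⟨⟨b, k, idx'⟩, ⟨hb0, hb, hdown.mono fun n hn => ?_, hαk, ?_⟩,
      ⟨hab, hno, Or.inr ⟨hk, heq⟩⟩⟩
    · have := hn.1
      show ℓ n (arrivalTime (clock 0) n (idx' n)) = k
      omega
    · show x b (k + 1) < 1
      rw [← hk, heq]; exact h.alpha_lt

/-- The limit of the initial conditions, as the update state that precedes all updates. -/
def initialState (ℓ₀ : ℕ) : UpdateState := ⟨0, ℓ₀, fun _ => 0⟩

lemma initialState_isGood (hx : IsOccupancyLimit lam U q₀ q x)
    (h : GoodRun lam α clock u q₀ ℓ₀ q ℓ) : (initialState ℓ₀).IsGood U α clock ℓ x := by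
  have h0 : ∀ᶠ n in U, arrivalTime (clock 0) n 0 = 0 :=
    hx.eventually_one_le.mono fun n hn => h.arr.arrivalTime_zero hn
  refine ⟨le_rfl, tendsto_const_nhds.congr' (h0.mono fun n hn => hn.symm), ?_, ?_, ?_⟩
  · filter_upwards [h0, Eventually.filter_mono hx.le_atTop h.ℓ_init] with n h1 h2
    show ℓ n (arrivalTime (clock 0) n 0) = ℓ₀
    rw [h1, h2]
  · show α < x 0 ℓ₀
    rw [hx.init]; exact h.alpha_lt_init
  · show x 0 (ℓ₀ + 1) < 1
    rw [hx.init]; exact h.init_lt_one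

/-- The updates in the limit, one after the other. -/
theorem exists_updates (hx : IsOccupancyLimit lam U q₀ q x)
    (h : GoodRun lam α clock u q₀ ℓ₀ q ℓ) :
    ∃ s : ℕ → UpdateState, s 0 = initialState ℓ₀ ∧ (∀ j, (s j).IsGood U α clock ℓ x) ∧
      ∀ j, (s j).IsLast U clock ℓ ∨ (s j).IsNext U α clock ℓ x (s (j + 1)) := by
  have hstep : ∀ st : {st : UpdateState // st.IsGood U α clock ℓ x},
      ∃ st' : {st : UpdateState // st.IsGood U α clock ℓ x},
        st.1.IsLast U clock ℓ ∨ st.1.IsNext U α clock ℓ x st'.1 := by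
    rintro ⟨st, hst⟩
    rcases hst.step hx h with h1 | ⟨st', h1, h2⟩
    · exact ⟨⟨st, hst⟩, Or.inl h1⟩
    · exact ⟨⟨st', h1⟩, Or.inr h2⟩
  choose f hf using hstep
  set s : ℕ → {st : UpdateState // st.IsGood U α clock ℓ x} :=
    fun j => Nat.rec ⟨initialState ℓ₀, initialState_isGood hx h⟩ (fun _ st => f st) j
  exact ⟨fun j => (s j).1, rfl, fun j => (s j).2, fun j => hf (s j)⟩

/-! ### The update times do not accumulate -/

/-- Raising the threshold requires filling a level, and the number of levels that the arrivals up to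
a given time can fill is bounded. -/
lemma threshold_le (hx : IsOccupancyLimit lam U q₀ q x)
    (h : GoodRun lam α clock u q₀ ℓ₀ q ℓ) {t : ℝ} (ht : 0 ≤ t) {m : ℕ} (hm : x t m = 1) :
    (m : ℝ) ≤ ℓ₀ + lam * t / (1 - q₀ (ℓ₀ + 1)) := by
  have hpos : 0 < 1 - q₀ (ℓ₀ + 1) := by linarith [h.init_lt_one]
  have hq0 : q₀ ∈ occupancySpace := hx.init ▸ hx.mem h le_rfl
  have hanti := occupancySpace_antitone hq0
  have hantit := occupancySpace_antitone (hx.mem h ht)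
  rcases le_or_gt m ℓ₀ with hml | hml
  · have h1 : (m : ℝ) ≤ ℓ₀ := by exact_mod_cast hml
    have : 0 ≤ lam * t / (1 - q₀ (ℓ₀ + 1)) := div_nonneg (mul_nonneg h.lam_pos.le ht) hpos.le
    linarith
  · have hsum := hx.sum_fluidArrivals_le h m le_rfl ht
    have hI : ∀ i, 0 ≤ intensity x i t := by
      intro i
      have := (intensity_bounds (q := x) (fun s hs => hx.mem h hs)
        (fun i s t _ _ => (hx.continuous i).intervalIntegrable _ _) i le_rfl ht).1
      simpa [intensity] using this
    have hterm : ∀ i, fluidArrivals x i t - fluidArrivals x i 0 = x t i - q₀ i + intensity x i t := by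
      intro i
      simp [fluidArrivals, intensity, hx.init]
    have hmono : ∀ i ∈ Finset.Icc 1 m, 0 ≤ fluidArrivals x i t - fluidArrivals x i 0 := fun i hi =>
      sub_nonneg.2 (hx.fluidArrivals_mono h (Finset.mem_Icc.1 hi).1 le_rfl ht)
    have hsub : Finset.Icc (ℓ₀ + 1) m ⊆ Finset.Icc 1 m := Finset.Icc_subset_Icc (by omega) le_rfl
    have h1 : ∑ i ∈ Finset.Icc (ℓ₀ + 1) m, (1 - q₀ (ℓ₀ + 1)) ≤ lam * (t - 0) := by
      refine le_trans (Finset.sum_le_sum fun i hi => ?_)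
        ((Finset.sum_le_sum_of_subset_of_nonneg hsub fun i hi _ => hmono i hi).trans hsum)
      rw [hterm]
      have e1 : x t m ≤ x t i := hantit (Finset.mem_Icc.1 hi).2
      have e2 : q₀ i ≤ q₀ (ℓ₀ + 1) := hanti (Finset.mem_Icc.1 hi).1
      linarith [hI i]
    rw [Finset.sum_const, Nat.card_Icc, nsmul_eq_mul, sub_zero] at h1
    have h2 : ((m + 1 - (ℓ₀ + 1) : ℕ) : ℝ) = m - ℓ₀ := by
      rw [Nat.add_sub_add_right, Nat.cast_sub hml.le]
    rw [h2, ← le_div_iff₀ hpos] at h1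
    linarith

/-- If there are infinitely many updates, then their times diverge. Otherwise the thresholds are
bounded, and by Lipschitz continuity no level can be full and then at `α` within a short time, so
that eventually all the updates go in the same direction. -/
theorem exists_lt_time (hx : IsOccupancyLimit lam U q₀ q x)
    (h : GoodRun lam α clock u q₀ ℓ₀ q ℓ) {s : ℕ → UpdateState}
    (hgood : ∀ j, (s j).IsGood U α clock ℓ x)
    (hnext : ∀ j, (s j).IsNext U α clock ℓ x (s (j + 1))) (M : ℝ) : ∃ j, M < (s j).time := by
  by_contra! hM
  have hmono : StrictMono fun j => (s j).time := strictMono_nat_of_lt_succ fun j => (hnext j).time_lt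
  have hM0 : 0 ≤ M := (hgood 0).nonneg.trans (hM 0)
  have hpos : 0 < 1 - q₀ (ℓ₀ + 1) := by linarith [h.init_lt_one]
  set B : ℝ := ℓ₀ + lam * M / (1 - q₀ (ℓ₀ + 1)) with hB
  have hle : ∀ j m, x (s j).time m = 1 → (m : ℝ) ≤ B := by
    intro j m hm
    refine (threshold_le hx h (hgood j).nonneg hm).trans ?_
    have := h.lam_pos
    have := hM j
    rw [hB]
    gcongr
  have hconv : Tendsto (fun j => (s j).time) atTop (𝓝 (⨆ j, (s j).time)) :=
    tendsto_atTop_ciSup hmono.monotone ⟨M, by rintro _ ⟨j, rfl⟩; exact hM j⟩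
  have hα := h.alpha_lt
  have hlam := h.lam_pos
  have hB0 : 0 ≤ B := add_nonneg (Nat.cast_nonneg _)
    (div_nonneg (mul_nonneg hlam.le hM0) hpos.le)
  have hgap : Tendsto (fun j => (lam + B) * ((s (j + 1)).time - (s j).time)) atTop (𝓝 0) := by
    have := ((hconv.comp (tendsto_add_atTop_nat 1)).sub hconv).const_mul (lam + B)
    simpa using this
  obtain ⟨J, hJ⟩ := eventually_atTop.1 (hgap.eventually (gt_mem_nhds (sub_pos.2 hα)))
  -- from the update `J` on, an increase is followed by an increase
  have hup : ∀ j, J ≤ j → (s (j + 1)).thr = (s j).thr + 1 → (s (j + 2)).thr = (s (j + 1)).thr + 1 := by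
    intro j hj hinc
    rcases (hnext (j + 1)).update with h1 | h1
    · exact h1.1
    · exfalso
      have e1 : x (s (j + 1)).time (s (j + 1)).thr = 1 := by
        rcases (hnext j).update with h2 | h2
        · rw [hinc]; exact h2.2
        · omega
      have e2 : x (s (j + 2)).time (s (j + 1)).thr = α := h1.2
      have e3 := hx.lipschitz (s (j + 1)).thr (s (j + 1)).time (s (j + 2)).time
      have e4 := hle (j + 1) _ e1
      have e5 := (hnext (j + 1)).time_lt
      rw [e1, e2, abs_of_pos (sub_pos.2 e5)] at e3
      have e6 := hJ (j + 1) (by omega)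
      have e7 := neg_abs_le (α - 1)
      have e8 : (lam + ((s (j + 1)).thr : ℝ)) * ((s (j + 1 + 1)).time - (s (j + 1)).time)
          ≤ (lam + B) * ((s (j + 1 + 1)).time - (s (j + 1)).time) := by
        refine mul_le_mul_of_nonneg_right (by linarith) (by linarith)
      have e9 : (s (j + 2)).time = (s (j + 1 + 1)).time := rfl
      rw [e9] at e3
      linarith
  by_cases hex : ∃ j, J ≤ j ∧ (s (j + 1)).thr = (s j).thr + 1
  · obtain ⟨j, hj, hinc⟩ := hex
    have hall : ∀ k, (s (j + k + 1)).thr = (s (j + k)).thr + 1 := by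
      intro k
      induction k with
      | zero => exact hinc
      | succ k ih => exact hup (j + k) (by omega) ih
    have hlin : ∀ k, (s (j + k)).thr = (s j).thr + k := by
      intro k
      induction k with
      | zero => rfl
      | succ k ih => rw [← Nat.add_assoc, hall k, ih]; omega
    obtain ⟨k, hk⟩ := exists_nat_gt B
    have h1 : x (s (j + k + 1)).time ((s (j + k)).thr + 1) = 1 := by
      rcases (hnext (j + k)).update with h2 | h2
      · exact h2.2
      · have := hall k; omega
    have h2 := hle _ _ h1
    rw [hlin k] at h2
    push_cast at h2
    have : (0 : ℝ) ≤ (s j).thr := Nat.cast_nonneg _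
    linarith
  · push Not at hex
    have hdec : ∀ k, (s (J + k)).thr + k ≤ (s J).thr := by
      intro k
      induction k with
      | zero => simp
      | succ k ih =>
        rcases (hnext (J + k)).update with h2 | h2
        · exact absurd h2.1 (hex (J + k) (by omega))
        · have := h2.1
          have h3 : (s (J + k + 1)).thr + (k + 1) ≤ (s J).thr := by omega
          exact h3
    have := hdec ((s J).thr + 1)
    omega

end ThresholdBalancing

namespace ThresholdBalancing

variable {lam α : ℝ} {clock : ℕ → ℝ≥0 → ℕ} {u : ℕ → ℝ} {q₀ : ℕ → ℝ} {ℓ₀ : ℕ}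
  {q : ℕ → ℝ → ℕ → ℝ} {ℓ : ℕ → ℝ → ℕ} {U : Ultrafilter ℕ} {x : ℝ → ℕ → ℝ}

/-! ### The limit is a fluid system -/

/-- The thresholds of the systems with `n` pools converge to that of `F` along `U`: the `k`-th
update time `θ k n` of the `n`-th system tends to the `k`-th update time of `F`, and between these
times the thresholds are those of `F`. -/
structure ThresholdsConverge (U : Ultrafilter ℕ) (ℓ : ℕ → ℝ → ℕ) (F : FluidSystem lam α)
    (θ : ℕ → ℕ → ℝ) : Prop where
  zero : ∀ᶠ n in U, θ 0 n = 0
  tendsto : ∀ k : ℕ, (k : ℕ∞) < F.η → Tendsto (θ k) U (𝓝 (F.τ k))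
  before : ∀ k : ℕ, ((k + 1 : ℕ) : ℕ∞) < F.η →
    ∀ᶠ n in U, ∀ t ∈ Ico (θ k n) (θ (k + 1) n), ℓ n t = F.thr k
  after : ∀ k : ℕ, (k : ℕ∞) < F.η → ∀ t ∈ fluidPeriod F.η F.τ k, F.τ k < t →
    ∀ᶠ n in U, ∀ s ∈ Icc (θ k n) t, ℓ n s = F.thr k

section Periods

variable {η : ℕ∞} {τ : ℕ → ℝ}

lemma natCast_succ_lt_of_lt {j k : ℕ} (hjk : j < k) (hk : (k : ℕ∞) < η) : ((j + 1 : ℕ) : ℕ∞) < η :=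
  lt_of_le_of_lt (by exact_mod_cast hjk) hk

lemma tau_le_of_le (hτ : ∀ j : ℕ, ((j + 1 : ℕ) : ℕ∞) < η → τ j < τ (j + 1)) {j k : ℕ}
    (hjk : j ≤ k) (hk : (k : ℕ∞) < η) : τ j ≤ τ k := by
  induction k, hjk using Nat.le_induction with
  | base => exact le_rfl
  | succ k hjk ih =>
    exact (ih (lt_of_le_of_lt (by exact_mod_cast Nat.le_succ k) hk)).trans (hτ k hk).le

lemma fluidPeriod_unique (hτ : ∀ j : ℕ, ((j + 1 : ℕ) : ℕ∞) < η → τ j < τ (j + 1)) {j k : ℕ}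
    (hj : (j : ℕ∞) < η) (hk : (k : ℕ∞) < η) {t : ℝ} (htj : t ∈ fluidPeriod η τ j)
    (htk : t ∈ fluidPeriod η τ k) : j = k := by
  have key : ∀ j k : ℕ, (k : ℕ∞) < η → t ∈ fluidPeriod η τ j → t ∈ fluidPeriod η τ k →
      ¬ j < k := fun j k hk htj htk hjk => by
    have h1 := htj.2 (natCast_succ_lt_of_lt hjk hk)
    have h2 := tau_le_of_le hτ (Nat.succ_le_of_lt hjk) hk
    exact absurd (h1.trans_le (h2.trans htk.1)) (lt_irrefl t)
  rcases lt_trichotomy j k with h | h | h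
  · exact absurd h (key j k hk htj htk)
  · exact h
  · exact absurd h (key k j hj htk htj)

open Classical in
/-- The step function with value `thr j` on the period `j`. -/
def periodValue (η : ℕ∞) (τ : ℕ → ℝ) (thr : ℕ → ℕ) (t : ℝ) : ℕ :=
  if h : ∃ j : ℕ, (j : ℕ∞) < η ∧ t ∈ fluidPeriod η τ j then thr h.choose else 0

lemma periodValue_eq (hτ : ∀ j : ℕ, ((j + 1 : ℕ) : ℕ∞) < η → τ j < τ (j + 1)) (thr : ℕ → ℕ)
    {j : ℕ} (hj : (j : ℕ∞) < η) {t : ℝ} (ht : t ∈ fluidPeriod η τ j) :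
    periodValue η τ thr t = thr j := by
  have hex : ∃ j : ℕ, (j : ℕ∞) < η ∧ t ∈ fluidPeriod η τ j := ⟨j, hj, ht⟩
  rw [periodValue, dif_pos hex]
  rw [fluidPeriod_unique hτ hex.choose_spec.1 hj hex.choose_spec.2 ht]

end Periods

/-- The number `η` of periods is determined by the first index with the property `L`, that of being
the last period; it is infinite if there is none. -/
lemma exists_eta {L N : ℕ → Prop} (h : ∀ j, L j ∨ N j) :
    ∃ η : ℕ∞, 1 ≤ η ∧ (∀ j : ℕ, ((j + 1 : ℕ) : ℕ∞) < η → N j) ∧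
      (∀ j : ℕ, (j : ℕ∞) < η → ¬ ((j + 1 : ℕ) : ℕ∞) < η → L j) := by
  classical
  by_cases hex : ∃ j, L j
  · refine ⟨((Nat.find hex + 1 : ℕ) : ℕ∞), by exact_mod_cast Nat.le_add_left 1 _, ?_, ?_⟩
    · intro j hj
      have : j + 1 < Nat.find hex + 1 := by exact_mod_cast hj
      exact (h j).resolve_left (Nat.find_min hex (by omega))
    · intro j hj hj'
      have h1 : j < Nat.find hex + 1 := by exact_mod_cast hj
      have h2 : ¬ j + 1 < Nat.find hex + 1 := by exact_mod_cast hj'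
      have : j = Nat.find hex := by omega
      rw [this]
      exact Nat.find_spec hex
  · push Not at hex
    exact ⟨⊤, le_top, fun j _ => (h j).resolve_left (hex j), fun j _ hj =>
      absurd (ENat.natCast_lt_top (j + 1)) hj⟩

/-- If finitely many periods exhaust `η`, or if the update times diverge, then every nonnegative
time belongs to some period. -/
lemma mem_fluidDomain {η : ℕ∞} {τ : ℕ → ℝ} (h1 : 1 ≤ η) (h0 : τ 0 = 0)
    (hinf : (∀ j : ℕ, ((j + 1 : ℕ) : ℕ∞) < η) → ∀ M, ∃ j, M < τ j) {t : ℝ} (ht : 0 ≤ t) :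
    t ∈ fluidDomain η τ := by
  classical
  by_contra hnot
  have hall : ∀ j : ℕ, (j : ℕ∞) < η ∧ τ j ≤ t := by
    intro j
    induction j with
    | zero => exact ⟨lt_of_lt_of_le (by norm_num) h1, h0.le.trans ht⟩
    | succ j ih =>
      by_contra hcon
      refine hnot ⟨j, ih.1, ih.2, fun hlt => ?_⟩
      by_contra hle
      exact hcon ⟨hlt, not_lt.1 hle⟩
  obtain ⟨j, hj⟩ := hinf (fun j => (hall (j + 1)).1) t
  exact absurd hj (not_lt.2 (hall j).2)

lemma threshold_eq_of_arrivals (h : GoodRun lam α clock u q₀ ℓ₀ q ℓ) {n : ℕ} (hn : 1 ≤ n) {t : ℝ}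
    (ht : 0 ≤ t) : ∃ j, j = arrivalCount (clock 0) n t ∧ arrivalTime (clock 0) n j ≤ t ∧
      t < arrivalTime (clock 0) n (j + 1) ∧ ℓ n t = ℓ n (arrivalTime (clock 0) n j) := by
  have h1 := (h.arr.le_arrivalCount_iff hn ht).1 le_rfl
  have h2 : t < arrivalTime (clock 0) n (arrivalCount (clock 0) n t + 1) := by
    by_contra! hle
    have := (h.arr.le_arrivalCount_iff hn ht).2 hle
    omega
  exact ⟨_, rfl, h1, h2, (h.sys n hn).threshold_eq h.arr hn h1 h2⟩

/-- Every limit along an ultrafilter is an admissible fluid system, defined at all times. -/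
theorem exists_fluidSystem (hx : IsOccupancyLimit lam U q₀ q x)
    (h : GoodRun lam α clock u q₀ ℓ₀ q ℓ) :
    ∃ F : FluidSystem lam α, F.IsAdmissible ∧ F.q = x ∧ F.q 0 = q₀ ∧ F.ℓ 0 = ℓ₀ ∧
      (∀ t, 0 ≤ t → t ∈ F.domain) ∧ ∃ θ, ThresholdsConverge U ℓ F θ := by
  obtain ⟨s, hs0, hgood, hstep⟩ := exists_updates hx h
  obtain ⟨η, hη1, hηN, hηL⟩ := exists_eta hstep
  set τ : ℕ → ℝ := fun j => (s j).time with hτdef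
  set thr : ℕ → ℕ := fun j => (s j).thr with hthr
  have hτ : ∀ j : ℕ, ((j + 1 : ℕ) : ℕ∞) < η → τ j < τ (j + 1) := fun j hj => (hηN j hj).time_lt
  have hτ0 : τ 0 = 0 := by simp [hτdef, hs0, initialState]
  have hη0 : ((0 : ℕ) : ℕ∞) < η := lt_of_lt_of_le (by norm_num) hη1
  have hcover : ∀ t, 0 ≤ t → t ∈ fluidDomain η τ := fun t ht =>
    mem_fluidDomain hη1 hτ0 (fun hall => exists_lt_time hx h hgood fun j => hηN j (hall j)) ht
  have hnn : ∀ t ∈ fluidDomain η τ, 0 ≤ t := by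
    rintro t ⟨j, -, ht⟩
    exact (hgood j).nonneg.trans ht.1
  -- the times strictly inside a period are quiet
  have hquiet : ∀ j : ℕ, (j : ℕ∞) < η → ∀ b, τ j < b → (((j + 1 : ℕ) : ℕ∞) < η → b ≤ τ (j + 1)) →
      ∀ t ∈ Ioo (τ j) b, IsQuiet U α clock q ℓ t (thr j) := by
    intro j hj b hjb hb t ht
    by_cases hlt : ((j + 1 : ℕ) : ℕ∞) < η
    · exact isQuiet_of_tendsto hx h (hgood j) (hgood (j + 1)).tendsto (hηN j hlt).no_update t
        ⟨ht.1, ht.2.trans_le (hb hlt)⟩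
    · exact (hηL j hj hlt).isQuiet hx h (hgood j) ht.1
  have hquiet' : ∀ j : ℕ, (j : ℕ∞) < η → ∀ t ∈ fluidPeriod η τ j, τ j < t →
      IsQuiet U α clock q ℓ t (thr j) := by
    intro j hj t ht hjt
    by_cases hlt : ((j + 1 : ℕ) : ℕ∞) < η
    · exact hquiet j hj (τ (j + 1)) (hτ j hlt) (fun _ => le_rfl) t ⟨hjt, ht.2 hlt⟩
    · exact hquiet j hj (t + 1) (by linarith) (fun hc => absurd hc hlt) t ⟨hjt, by linarith⟩
  -- at almost all times of a period, its level `thr j + 1` is not full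
  have hae : ∀ᵐ t : ℝ, ∀ j : ℕ, (j : ℕ∞) < η → t ∈ fluidPeriod η τ j →
      τ j < t ∧ x t (thr j + 1) < 1 ∧ ∀ i, DifferentiableAt ℝ (fun r => x r i) t := by
    rw [ae_all_iff]
    intro j
    by_cases hj : (j : ℕ∞) < η
    swap
    · exact Eventually.of_forall fun t hc => absurd hc hj
    have hfull : {t | t ∈ fluidPeriod η τ j ∧ τ j < t ∧ x t (thr j + 1) = 1}.Subsingleton := by
      rintro t₁ ⟨h1, h1', e1⟩ t₂ ⟨h2, h2', e2⟩
      obtain ⟨b, hb1, hb2, hb⟩ : ∃ b, t₁ < b ∧ t₂ < b ∧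
          (((j + 1 : ℕ) : ℕ∞) < η → b ≤ τ (j + 1)) := by
        by_cases hlt : ((j + 1 : ℕ) : ℕ∞) < η
        · exact ⟨τ (j + 1), h1.2 hlt, h2.2 hlt, fun _ => le_rfl⟩
        · exact ⟨max t₁ t₂ + 1, (le_max_left _ _).trans_lt (lt_add_one _),
            (le_max_right _ _).trans_lt (lt_add_one _), fun hc => absurd hc hlt⟩
      exact subsingleton_full hx h (hgood j).nonneg (hquiet j hj b (h1'.trans hb1) hb)
        (hgood j).lt_one ⟨⟨h1', hb1⟩, e1⟩ ⟨⟨h2', hb2⟩, e2⟩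
    have hdiff : ∀ᵐ t : ℝ, ∀ i, DifferentiableAt ℝ (fun r => x r i) t :=
      ae_all_iff.2 fun i => (hx.lipschitzWith i).ae_differentiableAt
    have hne : ∀ᵐ t : ℝ, t ≠ τ j := by
      have := (countable_singleton (τ j)).ae_notMem (volume : Measure ℝ)
      exact this
    filter_upwards [hfull.finite.countable.ae_notMem (volume : Measure ℝ), hdiff, hne]
      with t h1 h2 h3 _ ht
    have hjt : τ j < t := lt_of_le_of_ne ht.1 (Ne.symm h3)
    exact ⟨hjt, lt_of_le_of_ne ((hx.mem h ((hgood j).nonneg.trans ht.1)).2.1 _).2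
      fun h4 => h1 ⟨ht, hjt, h4⟩, h2⟩
  have hdyn : ∀ᵐ t : ℝ, ∀ j : ℕ, (j : ℕ∞) < η → t ∈ fluidPeriod η τ j → ∀ i : ℕ, 1 ≤ i →
      HasDerivAt (fluidArrivals x i) (lam * fluidRouting lam (x t) (thr j) i) t ∧
      fluidRouting lam (x t) (thr j) i ∈ Icc (0 : ℝ) 1 := by
    filter_upwards [hae] with t ht j hj htj i hi
    obtain ⟨h1, h2, h3⟩ := ht j hj htj
    exact (hquiet' j hj t htj h1).dynamics ((hgood j).nonneg.trans_lt h1) hx h h3 h2 hi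
  have hval := fun {j : ℕ} (hj : (j : ℕ∞) < η) {t : ℝ} (ht : t ∈ fluidPeriod η τ j) =>
    periodValue_eq hτ thr hj ht
  set F : FluidSystem lam α :=
    { η := η
      τ := τ
      thr := thr
      q := x
      ℓ := periodValue η τ thr
      one_le_eta := hη1
      tau_zero := hτ0
      tau_lt := hτ
      threshold_eq := fun j hj t ht => hval hj ht
      mem := fun t ht => hx.mem h (hnn t ht)
      alpha_le := by
        rintro t ⟨j, hj, ht⟩
        rw [hval hj ht]
        rcases eq_or_lt_of_le ht.1 with h1 | h1
        · rw [← h1]; exact (hgood j).alpha_lt.le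
        · exact (hquiet' j hj t ht h1).alpha_le ((hgood j).nonneg.trans_lt h1) hx h
      lt_one := by
        filter_upwards [hae] with t ht
        rintro ⟨j, hj, htj⟩
        rw [hval hj htj]
        exact (ht j hj htj).2.1
      update := by
        intro j hj
        have hα := h.alpha_lt
        have hmono := (hx.mem h (hgood (j + 1)).nonneg).2.2 (s j).thr
        rcases (hηN j hj).update with h1 | h1
        · have h2 : x (s (j + 1)).time (s j).thr ≠ α := fun hc => by
            rw [h1.2, hc] at hmono; linarith
          exact ⟨Or.inr h1.2, fun hc => absurd hc h2, fun _ => h1.1⟩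
        · have h2 : x (s (j + 1)).time ((s j).thr + 1) ≠ 1 := fun hc => by
            rw [h1.2, hc] at hmono; linarith
          refine ⟨Or.inl h1.2, fun _ => ?_, fun hc => absurd hc h2⟩
          show (((s (j + 1)).thr : ℕ) : ℤ) = ((s j).thr : ℕ) - 1
          have := h1.1
          omega
      abs_cont := fun t _ i =>
        ((hx.lipschitzWith i).lipschitzOnWith).absolutelyContinuousOnInterval
      dynamics := by
        intro j hj
        filter_upwards [hdyn] with t ht htj i hi
        exact hx.hasDerivAt_of_fluidArrivals (ht j hj htj i hi).1 } with hF
  refine ⟨F, ?_, rfl, hx.init, ?_, hcover,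
    fun k n => arrivalTime (clock 0) n ((s k).idx n), ?_, ?_, ?_, ?_⟩
  · show ∀ᵐ t : ℝ, t ∈ fluidDomain η τ → ∀ i : ℕ, 1 ≤ i →
      fluidRouting lam (x t) (periodValue η τ thr t) i ∈ Icc (0 : ℝ) 1
    filter_upwards [hdyn] with t ht
    rintro ⟨j, hj, htj⟩ i hi
    rw [hval hj htj]
    exact (ht j hj htj i hi).2
  · show periodValue η τ thr 0 = ℓ₀
    have h0 : (0 : ℝ) ∈ fluidPeriod η τ 0 := ⟨hτ0.le, fun hlt => by
      have := hτ 0 hlt; rwa [hτ0] at this⟩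
    rw [hval hη0 h0]
    simp [hthr, hs0, initialState]
  · filter_upwards [hx.eventually_one_le] with n hn
    rw [hs0]
    exact h.arr.arrivalTime_zero hn
  · exact fun k _ => (hgood k).tendsto
  · intro k hk
    filter_upwards [(hηN k hk).no_update, hx.eventually_one_le] with n h1 hn t ht
    have ht0 : 0 ≤ t := (h.arr.arrivalTime_nonneg hn _).trans ht.1
    obtain ⟨j, hj, e1, e2, e3⟩ := threshold_eq_of_arrivals h hn ht0
    rw [e3]
    refine h1 j ?_ ((h.arr.arrivalTime_strictMono hn).lt_iff_lt.1 (e1.trans_lt ht.2))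
    rw [hj]
    exact (h.arr.le_arrivalCount_iff hn ht0).2 ht.1
  · intro k hk t ht hkt
    have hgoal : ∀ᶠ n in U, ∀ j, (s k).idx n ≤ j → arrivalTime (clock 0) n j ≤ t →
        ℓ n (arrivalTime (clock 0) n j) = (s k).thr := by
      by_cases hlt : ((k + 1 : ℕ) : ℕ∞) < η
      · filter_upwards [(hηN k hlt).no_update, hx.eventually_one_le,
          (hgood (k + 1)).tendsto.eventually (lt_mem_nhds (ht.2 hlt))] with n h1 hn h2 j hj hjt
        exact h1 j hj ((h.arr.arrivalTime_strictMono hn).lt_iff_lt.1 (hjt.trans_lt h2))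
      · exact hηL k hk hlt t
    filter_upwards [hgoal, hx.eventually_one_le] with n h1 hn r hr
    have hr0 : 0 ≤ r := (h.arr.arrivalTime_nonneg hn _).trans hr.1
    obtain ⟨j, hj, e1, e2, e3⟩ := threshold_eq_of_arrivals h hn hr0
    rw [e3]
    refine h1 j ?_ (e1.trans hr.2)
    rw [hj]
    exact (h.arr.le_arrivalCount_iff hn hr0).2 hr.1

end ThresholdBalancing

namespace ThresholdBalancing

/-! ### The uniform and Skorokhod distances -/

lemma productDist_term_nonneg (a b : ℕ → ℝ) (i : ℕ) : 0 ≤ min |a i - b i| 1 / 2 ^ i :=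
  div_nonneg (le_min (abs_nonneg _) zero_le_one) (by positivity)

lemma productDist_term_le (a b : ℕ → ℝ) (i : ℕ) : min |a i - b i| 1 / 2 ^ i ≤ (1 / 2 : ℝ) ^ i := by
  rw [one_div_pow]
  exact div_le_div_of_nonneg_right (min_le_right _ _) (by positivity)

lemma summable_productDist (a b : ℕ → ℝ) : Summable fun i : ℕ => min |a i - b i| 1 / 2 ^ i :=
  Summable.of_nonneg_of_le (productDist_term_nonneg a b) (productDist_term_le a b)
    summable_geometric_two

lemma productDist_le (a b : ℕ → ℝ) (K : ℕ) :
    productDist a b ≤ ∑ i ∈ Finset.range K, |a i - b i| + 2 * (1 / 2 : ℝ) ^ K := by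
  rw [productDist, ← (summable_productDist a b).sum_add_tsum_nat_add K]
  refine add_le_add (Finset.sum_le_sum fun i _ => ?_) ?_
  · rw [div_le_iff₀ (by positivity)]
    refine (min_le_left _ _).trans (le_mul_of_one_le_right (abs_nonneg _) ?_)
    exact one_le_pow₀ (by norm_num)
  · have h1 : Summable fun i : ℕ => (1 / 2 : ℝ) ^ (i + K) :=
      (summable_nat_add_iff K).2 summable_geometric_two
    refine (((summable_nat_add_iff K).2 (summable_productDist a b)).tsum_le_tsum
      (fun i => productDist_term_le a b (i + K)) h1).trans (le_of_eq ?_)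
    simp_rw [pow_add]
    rw [tsum_mul_right, tsum_geometric_two]

lemma min_le_productDist (a b : ℕ → ℝ) (i : ℕ) : min |a i - b i| 1 / 2 ^ i ≤ productDist a b :=
  (summable_productDist a b).le_tsum i fun j _ => productDist_term_nonneg a b j

lemma tendsto_rhoUniform {ι : Type*} {f : Filter ι} {p : ι → ℝ → ℕ → ℝ} {x : ℝ → ℕ → ℝ} {T : ℝ}
    (h : ∀ i : ℕ, ∀ ε : ℝ, 0 < ε → ∀ᶠ n in f, ∀ t ∈ Icc 0 T, |p n t i - x t i| ≤ ε) :
    Tendsto (fun n => rhoUniform T (p n) x) f (𝓝 0) := by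
  rw [ENNReal.tendsto_nhds_zero]
  intro ε hε
  rcases eq_or_ne ε ⊤ with rfl | hε'
  · exact Eventually.of_forall fun _ => le_top
  set e := ε.toReal with he
  have he0 : 0 < e := ENNReal.toReal_pos hε.ne' hε'
  obtain ⟨K, hK⟩ := exists_pow_lt_of_lt_one (by positivity : 0 < e / 4)
    (by norm_num : (1 / 2 : ℝ) < 1)
  have hfin : ∀ᶠ n in f, ∀ i ∈ Finset.range K, ∀ t ∈ Icc 0 T, |p n t i - x t i| ≤ e / (2 * (K + 1)) :=
    (Filter.eventually_all_finset _).2 fun i _ => h i _ (by positivity)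
  filter_upwards [hfin] with n hn
  refine iSup_le fun t => ?_
  rw [← ENNReal.ofReal_toReal hε']
  refine ENNReal.ofReal_le_ofReal ((productDist_le _ _ K).trans ?_)
  have h1 : ∑ i ∈ Finset.range K, |p n t i - x t i| ≤ e / 2 := by
    refine (Finset.sum_le_card_nsmul _ _ _ fun i hi => hn i hi t t.2).trans ?_
    rw [Finset.card_range, nsmul_eq_mul]
    have : (K : ℝ) * (e / (2 * (K + 1))) = e / 2 * (K / (K + 1)) := by field_simp
    rw [this]
    refine mul_le_of_le_one_right (by positivity) ?_
    rw [div_le_one (by positivity)]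
    linarith
  linarith

lemma tendsto_coord_of_rhoUniform {ι : Type*} {f : Filter ι} {p : ι → ℝ → ℕ → ℝ} {x : ℝ → ℕ → ℝ}
    {T : ℝ} (h : Tendsto (fun n => rhoUniform T (p n) x) f (𝓝 0)) {t : ℝ} (ht : t ∈ Icc 0 T)
    (i : ℕ) : Tendsto (fun n => p n t i) f (𝓝 (x t i)) := by
  rw [Metric.tendsto_nhds]
  intro ε hε
  have h2 : (0 : ℝ) < 2 ^ i := by positivity
  have hpos : 0 < min ε 1 / 2 ^ i := div_pos (lt_min hε one_pos) h2
  filter_upwards [h.eventually (gt_mem_nhds (ENNReal.ofReal_pos.2 hpos))] with n hn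
  have h1 : ENNReal.ofReal (productDist (p n t) (x t)) ≤ rhoUniform T (p n) x :=
    le_iSup (fun t : Icc (0 : ℝ) T => ENNReal.ofReal (productDist (p n t) (x t))) ⟨t, ht⟩
  have h3 := (ENNReal.ofReal_lt_ofReal_iff hpos).1 (h1.trans_lt hn)
  have h4 := (min_le_productDist (p n t) (x t) i).trans_lt h3
  rw [div_lt_div_iff_of_pos_right h2] at h4
  rw [Real.dist_eq]
  rcases min_lt_iff.1 h4 with h5 | h5
  · exact h5.trans_le (min_le_left _ _)
  · exact absurd (h5.trans_le (min_le_right _ _)) (lt_irrefl _)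

/-- A perturbation of the identity with a small Lipschitz constant is a time change of small norm. -/
lemma exists_timeChange {T κ : ℝ} (hT : 0 ≤ T) (hκ : κ ≤ 1 / 2) {γ : ℝ → ℝ}
    (hγ : ∀ s t, |γ t - γ s - (t - s)| ≤ κ * |t - s|) (h0 : γ 0 = 0) (h1 : γ T = T) :
    ∃ f : Icc (0 : ℝ) T ≃o Icc (0 : ℝ) T, (∀ t, (f t : ℝ) = γ t) ∧
      timeChangeNorm f ≤ ENNReal.ofReal (2 * κ) := by
  have hbd : ∀ s t, s < t → (1 - κ) * (t - s) ≤ γ t - γ s ∧ γ t - γ s ≤ (1 + κ) * (t - s) := by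
    intro s t hst
    have := abs_le.1 (hγ s t)
    rw [abs_of_pos (sub_pos.2 hst)] at this
    constructor <;> linarith
  have hmono : StrictMono γ := by
    intro s t hst
    have := (hbd s t hst).1
    nlinarith
  have hcont : Continuous γ := by
    have hL : LipschitzWith 2 γ := by
      refine LipschitzWith.of_dist_le_mul fun s t => ?_
      rw [Real.dist_eq, Real.dist_eq]
      have h2 := hγ t s
      have h3 := abs_sub_abs_le_abs_sub (γ s - γ t) (s - t)
      have h4 : κ * |s - t| ≤ 1 / 2 * |s - t| := mul_le_mul_of_nonneg_right hκ (abs_nonneg _)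
      have h5 := abs_nonneg (s - t)
      push_cast
      linarith
    exact hL.continuous
  have hmaps : ∀ t : Icc (0 : ℝ) T, γ t ∈ Icc (0 : ℝ) T := fun t =>
    ⟨by have := hmono.monotone t.2.1; rwa [h0] at this,
      by have := hmono.monotone t.2.2; rwa [h1] at this⟩
  set g : Icc (0 : ℝ) T → Icc (0 : ℝ) T := fun t => ⟨γ t, hmaps t⟩ with hg
  have hgm : StrictMono g := fun s t hst => hmono hst
  have hgs : Function.Surjective g := by
    intro y
    have hy : (y : ℝ) ∈ Icc (γ 0) (γ T) := by rw [h0, h1]; exact y.2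
    obtain ⟨t, ht, hty⟩ := intermediate_value_Icc hT hcont.continuousOn hy
    exact ⟨⟨t, ht⟩, Subtype.ext hty⟩
  refine ⟨hgm.orderIsoOfSurjective g hgs, fun t => rfl, ?_⟩
  refine iSup_le fun s => iSup_le fun t => iSup_le fun hst => ENNReal.ofReal_le_ofReal ?_
  show |Real.log ((γ t - γ s) / ((t : ℝ) - s))| ≤ 2 * κ
  have hst' : (s : ℝ) < t := hst
  have hpos := sub_pos.2 hst'
  obtain ⟨b1, b2⟩ := hbd s t hst'
  have r1 : 1 - κ ≤ (γ t - γ s) / ((t : ℝ) - s) := by rwa [le_div_iff₀ hpos]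
  have r2 : (γ t - γ s) / ((t : ℝ) - s) ≤ 1 + κ := by rwa [div_le_iff₀ hpos]
  set r := (γ t - γ s) / ((t : ℝ) - s)
  have hr : 0 < r := by linarith
  have hκ0 : 0 ≤ κ := by linarith
  have l1 := Real.log_le_sub_one_of_pos hr
  have l2 := Real.one_sub_inv_le_log_of_pos hr
  have l3 : -(2 * κ) ≤ 1 - r⁻¹ := by
    have : r⁻¹ ≤ 1 + 2 * κ := by
      rw [inv_le_iff_one_le_mul₀ hr]
      nlinarith
    linarith
  rw [abs_le]
  constructor <;> linarith

/-- A time change of small norm moves no point by much. -/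
lemma timeChange_close {T ε : ℝ} (hT : 0 ≤ T) (f : Icc (0 : ℝ) T ≃o Icc (0 : ℝ) T)
    (hf : timeChangeNorm f < ENNReal.ofReal ε) (t : Icc (0 : ℝ) T) :
    |(f t : ℝ) - t| ≤ (Real.exp ε - 1) * T := by
  have hε : 0 < ε := ENNReal.ofReal_pos.1 ((zero_le).trans_lt hf)
  have hexp : 1 ≤ Real.exp ε := Real.one_le_exp hε.le
  have hb : (f ⟨0, le_rfl, hT⟩ : ℝ) = 0 := by
    have h1 : f ⟨0, le_rfl, hT⟩ ≤ f (f.symm ⟨0, le_rfl, hT⟩) :=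
      f.monotone (show (0 : ℝ) ≤ f.symm ⟨0, le_rfl, hT⟩ from (f.symm _).2.1)
    rw [f.apply_symm_apply] at h1
    exact le_antisymm h1 (f _).2.1
  rcases eq_or_lt_of_le t.2.1 with h0 | h0
  · have : t = ⟨0, le_rfl, hT⟩ := Subtype.ext h0.symm
    rw [this, hb, sub_zero, abs_zero]
    exact mul_nonneg (by linarith) hT
  · have hlt : (⟨0, le_rfl, hT⟩ : Icc (0 : ℝ) T) < t := h0
    have h1 : ENNReal.ofReal |Real.log (((f t : ℝ) - f ⟨0, le_rfl, hT⟩) / ((t : ℝ) - 0))|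
        ≤ timeChangeNorm f :=
      le_iSup_of_le ⟨0, le_rfl, hT⟩ (le_iSup_of_le t (le_iSup_of_le hlt le_rfl))
    rw [hb, sub_zero, sub_zero] at h1
    have hft : 0 < (f t : ℝ) := by
      have h3 : (f ⟨0, le_rfl, hT⟩ : ℝ) < f t := f.strictMono hlt
      rwa [hb] at h3
    have h2 := abs_lt.1 ((ENNReal.ofReal_lt_ofReal_iff hε).1 (h1.trans_lt hf))
    have hr : 0 < (f t : ℝ) / t := div_pos hft h0
    have u1 : (f t : ℝ) < Real.exp ε * t := by
      have := (Real.log_lt_iff_lt_exp hr).1 h2.2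
      rwa [div_lt_iff₀ h0] at this
    have u2 : Real.exp (-ε) * t < f t := by
      have := (Real.lt_log_iff_exp_lt hr).1 h2.1
      rwa [lt_div_iff₀ h0] at this
    have u3 : 2 - Real.exp ε ≤ Real.exp (-ε) := by
      have h5 : Real.exp ε * Real.exp (-ε) = 1 := by rw [← Real.exp_add]; simp
      nlinarith [Real.exp_pos (-ε), sq_nonneg (Real.exp ε - 1)]
    have htT := t.2.2
    rw [abs_le]
    constructor <;> nlinarith

/-! ### Convergence of the thresholds in the Skorokhod topology -/

/-- The tent function of height `1` and half-width `δ` centred at `c`. -/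
def tent (δ c t : ℝ) : ℝ := max 0 (1 - |t - c| / δ)

lemma tent_self (δ c : ℝ) : tent δ c c = 1 := by simp [tent]

lemma tent_eq_zero {δ c t : ℝ} (hδ : 0 < δ) (h : δ ≤ |t - c|) : tent δ c t = 0 := by
  have : 1 ≤ |t - c| / δ := by rwa [le_div_iff₀ hδ, one_mul]
  exact max_eq_left (by linarith)

lemma tent_lipschitz {δ : ℝ} (hδ : 0 < δ) (c s t : ℝ) :
    |tent δ c t - tent δ c s| ≤ |t - s| / δ := by
  refine (abs_max_sub_max_le_max _ _ _ _).trans (max_le (by simp; positivity) ?_)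
  have h1 : 1 - |t - c| / δ - (1 - |s - c| / δ) = (|s - c| - |t - c|) / δ := by ring
  rw [h1, abs_div, abs_of_pos hδ]
  refine div_le_div_of_nonneg_right ((abs_abs_sub_abs_le _ _).trans (le_of_eq ?_)) hδ.le
  rw [abs_sub_comm]
  congr 1
  ring

/-- A time change that moves finitely many nodes `a k`, at distance `δ` from each other and from the
ends of `[0, T]`, to nearby points `τ k`: add to the identity a tent function at each node. -/
lemma exists_timeChange_of_nodes {T δ : ℝ} (hT : 0 ≤ T) (hδ : 0 < δ) {j : ℕ} {a τ : ℕ → ℝ}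
    (ha0 : ∀ k ∈ Finset.Icc 1 j, δ ≤ a k) (haT : ∀ k ∈ Finset.Icc 1 j, a k + δ ≤ T)
    (hsep : ∀ k ∈ Finset.Icc 1 j, ∀ k' ∈ Finset.Icc 1 j, k ≠ k' → δ ≤ |a k - a k'|)
    (hκ : ∑ k ∈ Finset.Icc 1 j, |τ k - a k| / δ ≤ 1 / 2) :
    ∃ f : Icc (0 : ℝ) T ≃o Icc (0 : ℝ) T,
      (∀ k ∈ Finset.Icc 1 j, ∀ t : Icc (0 : ℝ) T, a k ≤ t → τ k ≤ f t) ∧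
      (∀ k ∈ Finset.Icc 1 j, ∀ t : Icc (0 : ℝ) T, (t : ℝ) < a k → (f t : ℝ) < τ k) ∧
      timeChangeNorm f ≤ ENNReal.ofReal (2 * ∑ k ∈ Finset.Icc 1 j, |τ k - a k| / δ) := by
  set γ : ℝ → ℝ := fun t => t + ∑ k ∈ Finset.Icc 1 j, (τ k - a k) * tent δ (a k) t with hγdef
  have hγ : ∀ s t, |γ t - γ s - (t - s)| ≤ (∑ k ∈ Finset.Icc 1 j, |τ k - a k| / δ) * |t - s| := by
    intro s t
    have h1 : γ t - γ s - (t - s)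
        = ∑ k ∈ Finset.Icc 1 j, (τ k - a k) * (tent δ (a k) t - tent δ (a k) s) := by
      simp only [hγdef, mul_sub, Finset.sum_sub_distrib]
      ring
    rw [h1, Finset.sum_mul]
    refine (Finset.abs_sum_le_sum_abs _ _).trans (Finset.sum_le_sum fun k _ => ?_)
    rw [abs_mul, div_mul_eq_mul_div, mul_div_assoc]
    exact mul_le_mul_of_nonneg_left (tent_lipschitz hδ _ _ _) (abs_nonneg _)
  have h0 : γ 0 = 0 := by
    simp only [hγdef, zero_add]
    refine Finset.sum_eq_zero fun k hk => ?_
    rw [tent_eq_zero hδ, mul_zero]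
    rw [zero_sub, abs_neg]
    exact (ha0 k hk).trans (le_abs_self _)
  have h1 : γ T = T := by
    simp only [hγdef]
    rw [Finset.sum_eq_zero, add_zero]
    intro k hk
    rw [tent_eq_zero hδ, mul_zero]
    exact le_trans (by linarith [haT k hk]) (le_abs_self _)
  have hnode : ∀ k ∈ Finset.Icc 1 j, γ (a k) = τ k := by
    intro k hk
    simp only [hγdef]
    rw [Finset.sum_eq_single k, tent_self]
    · ring
    · intro k' hk' hne
      rw [tent_eq_zero hδ (hsep k hk k' hk' hne.symm), mul_zero]
    · exact fun hc => absurd hk hc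
  obtain ⟨f, hf1, hf2⟩ := exists_timeChange hT hκ hγ h0 h1
  have hmem : ∀ k ∈ Finset.Icc 1 j, a k ∈ Icc (0 : ℝ) T := fun k hk =>
    ⟨hδ.le.trans (ha0 k hk), by linarith [haT k hk]⟩
  refine ⟨f, fun k hk t ht => ?_, fun k hk t ht => ?_, hf2⟩
  · have : f ⟨a k, hmem k hk⟩ ≤ f t := f.monotone ht
    have h3 : (f ⟨a k, hmem k hk⟩ : ℝ) ≤ f t := this
    rwa [hf1, hnode k hk] at h3
  · have h3 : (f t : ℝ) < f ⟨a k, hmem k hk⟩ :=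
      f.strictMono (show t < ⟨a k, hmem k hk⟩ from ht)
    rwa [hf1 ⟨a k, hmem k hk⟩, hnode k hk] at h3

variable {lam α : ℝ} {U : Ultrafilter ℕ} {ℓ : ℕ → ℝ → ℕ} {F : FluidSystem lam α}
  {θ : ℕ → ℕ → ℝ}

lemma FluidSystem.tau_nonneg (F : FluidSystem lam α) {k : ℕ} (hk : (k : ℕ∞) < F.η) : 0 ≤ F.τ k :=
  F.tau_zero ▸ tau_le_of_le F.tau_lt (Nat.zero_le k) hk

/-- At a time that is not an update time, convergence of the update times yields convergence in the
Skorokhod topology: move the update times of the `n`-th system to those of `F` by a small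
piecewise linear time change. -/
theorem ThresholdsConverge.tendsto_rhoSkorokhod (h : ThresholdsConverge U ℓ F θ) {T : ℝ} {j : ℕ}
    (hj : (j : ℕ∞) < F.η) (hTj : T ∈ fluidPeriod F.η F.τ j) (hlt : F.τ j < T) :
    Tendsto (fun n => rhoSkorokhod T (fun t => (ℓ n t : ℝ)) fun t => (F.ℓ t : ℝ)) U (𝓝 0) := by
  have hT0 : 0 ≤ T := (F.tau_nonneg hj).trans hTj.1
  have hη : ∀ k, k ≤ j → (k : ℕ∞) < F.η := fun k hk => lt_of_le_of_lt (by exact_mod_cast hk) hj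
  have hη' : ∀ k, k < j → ((k + 1 : ℕ) : ℕ∞) < F.η := fun k hk => hη (k + 1) hk
  -- a lower bound for the lengths of the periods up to `T`
  obtain ⟨δ, hδ, hδT, hδk⟩ : ∃ δ : ℝ, 0 < δ ∧ 3 * δ ≤ T - F.τ j ∧
      ∀ k < j, 3 * δ ≤ F.τ (k + 1) - F.τ k := by
    have hfin : ∀ᶠ δ in 𝓝[>] (0 : ℝ), ∀ k ∈ Finset.range j, 3 * δ ≤ F.τ (k + 1) - F.τ k := by
      refine (Filter.eventually_all_finset _).2 fun k hk => ?_
      have h1 := F.tau_lt k (hη' k (Finset.mem_range.1 hk))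
      filter_upwards [Ioo_mem_nhdsGT (by linarith : (0 : ℝ) < (F.τ (k + 1) - F.τ k) / 3)] with δ hδ
      linarith [hδ.2]
    have hfin2 : ∀ᶠ δ in 𝓝[>] (0 : ℝ), 0 < δ ∧ 3 * δ ≤ T - F.τ j := by
      filter_upwards [Ioo_mem_nhdsGT (by linarith : (0 : ℝ) < (T - F.τ j) / 3)] with δ hδ
      exact ⟨hδ.1, by linarith [hδ.2]⟩
    obtain ⟨δ, h1, h2⟩ := (hfin.and hfin2).exists
    exact ⟨δ, h2.1, h2.2, fun k hk => h1 k (Finset.mem_range.2 hk)⟩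
  have hsepτ : ∀ k k', k < k' → k' ≤ j → 3 * δ ≤ F.τ k' - F.τ k := by
    intro k k' hkk hk'
    obtain ⟨i, rfl⟩ : ∃ i, k' = i + 1 := ⟨k' - 1, by omega⟩
    have h1 := hδk i (by omega)
    have h2 := tau_le_of_le F.tau_lt (show k ≤ i by omega) (hη i (by omega))
    linarith
  have hτT : ∀ k ≤ j, F.τ k + 3 * δ ≤ T := fun k hk => by
    have := tau_le_of_le F.tau_lt hk hj
    linarith
  set κ : ℕ → ℝ := fun n => ∑ k ∈ Finset.Icc 1 j, |F.τ k - θ k n| / δ with hκ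
  have hκ0 : Tendsto κ U (𝓝 0) := by
    have : Tendsto κ U (𝓝 (∑ k ∈ Finset.Icc 1 j, |F.τ k - F.τ k| / δ)) :=
      tendsto_finsetSum _ fun k hk => ((tendsto_const_nhds.sub
        (h.tendsto k (hη k (Finset.mem_Icc.1 hk).2))).abs.div_const δ)
    simpa using this
  have hclose : ∀ᶠ n in U, ∀ k ∈ Finset.Icc 1 j, |θ k n - F.τ k| < δ :=
    (Filter.eventually_all_finset _).2 fun k hk =>
      Metric.tendsto_nhds.1 (h.tendsto k (hη k (Finset.mem_Icc.1 hk).2)) δ hδ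
  have hbefore : ∀ᶠ n in U, ∀ k ∈ Finset.range j,
      ∀ t ∈ Ico (θ k n) (θ (k + 1) n), ℓ n t = F.thr k :=
    (Filter.eventually_all_finset _).2 fun k hk => h.before k (hη' k (Finset.mem_range.1 hk))
  have hbound : ∀ᶠ n in U, rhoSkorokhod T (fun t => (ℓ n t : ℝ)) (fun t => (F.ℓ t : ℝ))
      ≤ ENNReal.ofReal (2 * κ n) := by
    filter_upwards [hclose, hbefore, h.after j hj T hTj hlt, h.zero,
      hκ0.eventually (gt_mem_nhds (by norm_num : (0 : ℝ) < 1 / 2))] with n h1 h2 h3 h4 h5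
    obtain ⟨f, hf1, hf2, hf3⟩ := exists_timeChange_of_nodes (T := T) (δ := δ) (j := j)
      (a := fun k => θ k n) (τ := F.τ) hT0 hδ
      (fun k hk => by
        have e1 := abs_lt.1 (h1 k hk)
        have e2 := hsepτ 0 k (Finset.mem_Icc.1 hk).1 (Finset.mem_Icc.1 hk).2
        rw [F.tau_zero] at e2
        linarith)
      (fun k hk => by
        have e1 := abs_lt.1 (h1 k hk)
        have e2 := hτT k (Finset.mem_Icc.1 hk).2
        linarith)
      (fun k hk k' hk' hne => by
        have e1 := abs_lt.1 (h1 k hk)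
        have e2 := abs_lt.1 (h1 k' hk')
        rcases lt_or_gt_of_ne hne with h6 | h6
        · have := hsepτ k k' h6 (Finset.mem_Icc.1 hk').2
          rw [abs_sub_comm]
          exact le_trans (by linarith) (le_abs_self _)
        · have := hsepτ k' k h6 (Finset.mem_Icc.1 hk).2
          exact le_trans (by linarith) (le_abs_self _)) h5.le
    refine (iInf_le _ f).trans (max_le hf3 (iSup_le fun t => ?_))
    have heq : ℓ n t = F.ℓ (f t) := by
      classical
      -- the number of updates of the `n`-th system up to time `t`
      set k := Nat.findGreatest (fun k => θ k n ≤ t) j with hk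
      have hkj : k ≤ j := Nat.findGreatest_le j
      have hspec : θ k n ≤ t := Nat.findGreatest_spec (P := fun k => θ k n ≤ t) (Nat.zero_le j)
        (by show θ 0 n ≤ t; rw [h4]; exact t.2.1)
      have hfk : F.τ k ≤ f t := by
        rcases Nat.eq_zero_or_pos k with h6 | h6
        · rw [h6, F.tau_zero]; exact (f t).2.1
        · exact hf1 k (Finset.mem_Icc.2 ⟨h6, hkj⟩) t hspec
      rcases lt_or_eq_of_le hkj with h6 | h6
      · have hnext : (t : ℝ) < θ (k + 1) n := not_le.1
          (Nat.findGreatest_is_greatest (P := fun k => θ k n ≤ t) (Nat.lt_succ_self k) h6)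
        rw [h2 k (Finset.mem_range.2 h6) t ⟨hspec, hnext⟩]
        exact (F.threshold_eq k (hη k hkj) _ ⟨hfk, fun _ =>
          hf2 (k + 1) (Finset.mem_Icc.2 ⟨by omega, h6⟩) t hnext⟩).symm
      · rw [h6] at hspec hfk
        rw [h3 t ⟨hspec, t.2.2⟩]
        exact (F.threshold_eq j hj _ ⟨hfk, fun hc => (f t).2.2.trans_lt (hTj.2 hc)⟩).symm
    show ENNReal.ofReal |((ℓ n t : ℕ) : ℝ) - ((F.ℓ (f t) : ℕ) : ℝ)| ≤ _
    rw [heq, sub_self, abs_zero, ENNReal.ofReal_zero]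
    exact zero_le
  have hlim : Tendsto (fun n => ENNReal.ofReal (2 * κ n)) U (𝓝 0) := by
    have := ENNReal.tendsto_ofReal (hκ0.const_mul 2)
    rwa [mul_zero, ENNReal.ofReal_zero] at this
  exact tendsto_of_tendsto_of_tendsto_of_le_of_le' tendsto_const_nhds hlim
    (Eventually.of_forall fun _ => zero_le) hbound

/-- A period contains an interval to the right of each of its points. -/
lemma FluidSystem.exists_right (F : FluidSystem lam α) {k : ℕ} {t : ℝ}
    (ht : t ∈ fluidPeriod F.η F.τ k) :
    ∃ b, t < b ∧ ∀ s ∈ Ico t b, s ∈ fluidPeriod F.η F.τ k := by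
  by_cases hlt : ((k + 1 : ℕ) : ℕ∞) < F.η
  · exact ⟨F.τ (k + 1), ht.2 hlt, fun s hs => ⟨ht.1.trans hs.1, fun _ => hs.2⟩⟩
  · exact ⟨t + 1, by linarith, fun s hs => ⟨ht.1.trans hs.1, fun hc => absurd hc hlt⟩⟩

/-- A Skorokhod limit of the thresholds agrees with `F` at all times that are not update times. -/
theorem ThresholdsConverge.eq_of_tendsto (h : ThresholdsConverge U ℓ F θ) {T : ℝ} {y : ℝ → ℝ}
    (hy : Tendsto (fun n => rhoSkorokhod T (fun t => (ℓ n t : ℝ)) y) U (𝓝 0)) {k : ℕ}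
    (hk : (k : ℕ∞) < F.η) {r : ℝ} (hr : r ∈ fluidPeriod F.η F.τ k) (hlt : F.τ k < r)
    (hrT : r ≤ T) : y r = F.thr k := by
  have hr0 : 0 ≤ r := (F.tau_nonneg hk).trans hr.1
  have hT0 : 0 ≤ T := hr0.trans hrT
  obtain ⟨b, hrb, hb⟩ := F.exists_right hr
  set c := (r + b) / 2 with hc
  have hcm : c ∈ fluidPeriod F.η F.τ k := hb c ⟨by linarith, by linarith⟩
  have hafter := h.after k hk c hcm (by linarith)
  set d := min (c - r) ((r - F.τ k) / 2) with hd
  have hd0 : 0 < d := lt_min (by linarith) (by linarith)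
  refine eq_of_forall_dist_le fun ε hε => ?_
  -- choose a bound on the norm of the time change which makes it move points by less than `d`
  obtain ⟨ε₁, hε₁, hε₁ε, hexp⟩ : ∃ ε₁ : ℝ, 0 < ε₁ ∧ ε₁ ≤ ε ∧ (Real.exp ε₁ - 1) * T < d := by
    have hcont : Tendsto (fun e : ℝ => (Real.exp e - 1) * T) (𝓝[>] 0) (𝓝 ((Real.exp 0 - 1) * T)) :=
      (((Real.continuous_exp.tendsto 0).sub_const 1).mul_const T).mono_left nhdsWithin_le_nhds
    rw [Real.exp_zero, sub_self, zero_mul] at hcont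
    obtain ⟨e, h1, h2⟩ := ((hcont.eventually (gt_mem_nhds hd0)).and
      (Ioo_mem_nhdsGT hε)).exists
    exact ⟨e, h2.1, h2.2.le, h1⟩
  obtain ⟨n, hn, hρ, hθ⟩ := (hafter.and ((hy.eventually (gt_mem_nhds
    (ENNReal.ofReal_pos.2 hε₁))).and ((h.tendsto k hk).eventually
    (gt_mem_nhds (by linarith : F.τ k < (r + F.τ k) / 2))))).exists
  obtain ⟨f, hf⟩ := iInf_lt_iff.1 hρ
  rw [max_lt_iff] at hf
  set t := f.symm ⟨r, hr0, hrT⟩ with ht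
  have hft : f t = ⟨r, hr0, hrT⟩ := f.apply_symm_apply _
  have h1 := timeChange_close hT0 f hf.1 t
  rw [hft] at h1
  have h1' := abs_le.1 h1
  have hdl := min_le_left (c - r) ((r - F.τ k) / 2)
  have hdr := min_le_right (c - r) ((r - F.τ k) / 2)
  simp only at h1'
  have h2 := hn t ⟨by linarith, by linarith⟩
  have h3 : ENNReal.ofReal |(ℓ n t : ℝ) - y (f t)| < ENNReal.ofReal ε₁ :=
    (le_iSup (fun t : Icc (0 : ℝ) T => ENNReal.ofReal |(ℓ n t : ℝ) - y (f t)|) t).trans_lt hf.2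
  rw [ENNReal.ofReal_lt_ofReal_iff hε₁, hft, h2, abs_sub_comm] at h3
  rw [Real.dist_eq]
  exact h3.le.trans hε₁ε

lemma isCadlagOn_of_continuous {E : Type*} [TopologicalSpace E] {f : ℝ → E} (hf : Continuous f)
    (s : Set ℝ) : IsCadlagOn f s := fun t _ =>
  ⟨hf.continuousWithinAt, f t, hf.continuousAt.mono_left nhdsWithin_le_nhds⟩

lemma FluidSystem.isCadlagOn_threshold (F : FluidSystem lam α) {T : ℝ}
    (hT : Icc 0 T ⊆ F.domain) : IsCadlagOn (fun t => (F.ℓ t : ℝ)) (Icc 0 T) := by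
  intro t ht
  obtain ⟨k, hk, htk⟩ := hT ht
  have hleft : ∀ i : ℕ, (i : ℕ∞) < F.η → F.τ i < t → (((i + 1 : ℕ) : ℕ∞) < F.η → t ≤ F.τ (i + 1)) →
      ∃ l, Tendsto (fun t => (F.ℓ t : ℝ)) (𝓝[Icc 0 T ∩ Iio t] t) (𝓝 l) := by
    intro i hi h1 h2
    refine ⟨F.thr i, tendsto_const_nhds.congr' ?_⟩
    filter_upwards [mem_nhdsWithin_of_mem_nhds (Ioi_mem_nhds h1), self_mem_nhdsWithin] with s hs hs'
    rw [F.threshold_eq i hi s ⟨le_of_lt hs, fun hc => hs'.2.trans_le (h2 hc)⟩]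
  constructor
  · obtain ⟨b, hb, hper⟩ := F.exists_right htk
    have : Tendsto (fun t => (F.ℓ t : ℝ)) (𝓝[Icc 0 T ∩ Ici t] t) (𝓝 (F.ℓ t)) := by
      refine tendsto_const_nhds.congr' ?_
      filter_upwards [mem_nhdsWithin_of_mem_nhds (Iio_mem_nhds hb), self_mem_nhdsWithin]
        with s hs hs'
      rw [F.threshold_eq k hk t htk, F.threshold_eq k hk s (hper s ⟨hs'.2, hs⟩)]
    exact this
  · rcases eq_or_lt_of_le htk.1 with h1 | h1
    · rcases k with _ | k
      · rw [F.tau_zero] at h1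
        refine ⟨0, ?_⟩
        have : Icc 0 T ∩ Iio t = ∅ := by
          ext s
          simp only [mem_inter_iff, mem_Icc, mem_Iio, mem_empty_iff_false, iff_false]
          rintro ⟨⟨h2, -⟩, h3⟩
          linarith
        rw [this, nhdsWithin_empty]
        exact tendsto_bot
      · have hk' : (k : ℕ∞) < F.η := lt_of_le_of_lt (by exact_mod_cast Nat.le_succ k) hk
        exact hleft k hk' (h1 ▸ F.tau_lt k hk) fun _ => h1.ge
    · exact hleft k hk h1 fun hc => (htk.2 hc).le

end ThresholdBalancing

namespace ThresholdBalancing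

/-! ### Convergent subsequences -/

/-- An ultrafilter that is concentrated on the subsequence `φ`. -/
lemma exists_ultrafilter_le_map {φ : ℕ → ℕ} (hφ : StrictMono φ) :
    ∃ U : Ultrafilter ℕ, (U : Filter ℕ) ≤ map φ atTop ∧ (U : Filter ℕ) ≤ atTop :=
  ⟨Ultrafilter.of (map φ atTop), Ultrafilter.of_le _,
    (Ultrafilter.of_le _).trans hφ.tendsto_atTop⟩

/-- Convergence along an ultrafilter that is concentrated on a subsequence yields convergence of a
further subsequence. -/
lemma exists_subseq_tendsto {g : ℕ → ℝ≥0∞} {U : Ultrafilter ℕ} {φ : ℕ → ℕ}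
    (hU : (U : Filter ℕ) ≤ map φ atTop) (hg : Tendsto g U (𝓝 0)) :
    ∃ ψ : ℕ → ℕ, StrictMono ψ ∧ Tendsto (fun k => g (φ (ψ k))) atTop (𝓝 0) := by
  have hfreq : ∀ m : ℕ, ∃ᶠ k in atTop, g (φ k) < ((m : ℝ≥0∞) + 1)⁻¹ := by
    intro m
    have h1 : ∀ᶠ n in U, g n < ((m : ℝ≥0∞) + 1)⁻¹ :=
      hg.eventually (gt_mem_nhds (ENNReal.inv_pos.2 (by simp)))
    exact h1.frequently.filter_mono hU
  obtain ⟨ψ, hψ, hψ'⟩ := extraction_forall_of_frequently hfreq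
  refine ⟨ψ, hψ, tendsto_of_tendsto_of_tendsto_of_le_of_le tendsto_const_nhds
    ((tendsto_add_atTop_iff_nat 1).2 ENNReal.tendsto_inv_nat_nhds_zero) (fun _ => zero_le)
    fun k => ?_⟩
  exact_mod_cast (hψ' k).le

section Conclusion

variable {lam α : ℝ} {clock : ℕ → ℝ≥0 → ℕ} {u : ℕ → ℝ} {q₀ : ℕ → ℝ} {ℓ₀ : ℕ}
  {q : ℕ → ℝ → ℕ → ℝ} {ℓ : ℕ → ℝ → ℕ} {U : Ultrafilter ℕ} {x : ℝ → ℕ → ℝ} {T : ℝ}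

lemma IsOccupancyLimit.tendsto_rhoUniform (hx : IsOccupancyLimit lam U q₀ q x) (T : ℝ) :
    Tendsto (fun n => rhoUniform T (q n) x) U (𝓝 0) :=
  ThresholdBalancing.tendsto_rhoUniform fun i ε hε => hx.close i T ε hε

lemma IsOccupancyLimit.isCadlagOn (hx : IsOccupancyLimit lam U q₀ q x) (s : Set ℝ) :
    IsCadlagOn x s :=
  isCadlagOn_of_continuous (continuous_pi fun i => hx.continuous i) s

theorem GoodRun.isRelativelyCompactSeq_occupancy (h : GoodRun lam α clock u q₀ ℓ₀ q ℓ) (T : ℝ) :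
    IsRelativelyCompactSeq (fun x => IsCadlagOn x (Icc 0 T)) (rhoUniform T) q := by
  intro φ hφ
  obtain ⟨U, hU, hU'⟩ := exists_ultrafilter_le_map hφ
  obtain ⟨x, hx⟩ := h.exists_limit hU'
  obtain ⟨ψ, hψ, hψ'⟩ := exists_subseq_tendsto hU (hx.tendsto_rhoUniform T)
  exact ⟨ψ, hψ, x, hx.isCadlagOn _, hψ'⟩

/-- A limit point of the systems in the product metric agrees with the fluid system that is
obtained along an ultrafilter. The threshold at `T` is determined if `T` is not an update time. -/
theorem GoodRun.exists_extends (h : GoodRun lam α clock u q₀ ℓ₀ q ℓ) {φ : ℕ → ℕ}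
    (hφ : StrictMono φ) {s : PathPair} (hs : IsCadlagPair T s)
    (hlim : Tendsto (fun k => rhoProduct T (toPair (q (φ k)) (ℓ (φ k))) s) atTop (𝓝 0)) :
    ∃ F : FluidSystem lam α, F.IsAdmissible ∧ F.q 0 = q₀ ∧ F.ℓ 0 = ℓ₀ ∧
      F.ExtendsUpToEndpoint T s ∧
      ∀ j : ℕ, (j : ℕ∞) < F.η → T ∈ fluidPeriod F.η F.τ j → F.τ j < T → (F.ℓ T : ℝ) = s.2 T := by
  obtain ⟨U, hU, hU'⟩ := exists_ultrafilter_le_map hφ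
  obtain ⟨x, hx⟩ := h.exists_limit hU'
  obtain ⟨F, hadm, hFx, hFq, hFℓ, hdom, θ, hθ⟩ := exists_fluidSystem hx h
  have hlimU : Tendsto (fun n => rhoProduct T (toPair (q n) (ℓ n)) s) U (𝓝 0) :=
    Tendsto.mono_left (tendsto_map'_iff.2 hlim) hU
  have h1 : Tendsto (fun n => rhoUniform T (q n) s.1) U (𝓝 0) :=
    tendsto_of_tendsto_of_tendsto_of_le_of_le tendsto_const_nhds hlimU (fun _ => zero_le)
      fun _ => le_max_left _ _
  have h2 : Tendsto (fun n => rhoSkorokhod T (fun t => (ℓ n t : ℝ)) s.2) U (𝓝 0) :=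
    tendsto_of_tendsto_of_tendsto_of_le_of_le tendsto_const_nhds hlimU (fun _ => zero_le)
      fun _ => le_max_right _ _
  refine ⟨F, hadm, hFq, hFℓ, ⟨fun t ht => hdom t ht.1, fun t ht => ?_, fun t ht => ?_⟩,
    fun j hj hTj hlt => ?_⟩
  · rw [hFx]
    exact funext fun i =>
      tendsto_nhds_unique (hx.tendsto ht.1 i) (tendsto_coord_of_rhoUniform h1 ht i)
  · -- on the right of `t` both sides agree, and both are right-continuous
    obtain ⟨k, hk, htk⟩ := hdom t ht.1
    obtain ⟨b, hb, hbk⟩ := F.exists_right htk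
    rw [F.threshold_eq k hk t htk]
    have hright : Tendsto s.2 (𝓝[>] t) (𝓝 (s.2 t)) := by
      have h3 : Tendsto s.2 (𝓝[Icc 0 T ∩ Ici t] t) (𝓝 (s.2 t)) := (hs.2 t (Ico_subset_Icc_self ht)).1
      refine h3.mono_left ?_
      rw [← nhdsWithin_Ioo_eq_nhdsGT ht.2]
      exact nhdsWithin_mono _ fun r hr => ⟨⟨ht.1.trans hr.1.le, hr.2.le⟩, hr.1.le⟩
    have heq : ∀ᶠ r in 𝓝[>] t, s.2 r = F.thr k := by
      filter_upwards [Ioo_mem_nhdsGT (lt_min hb ht.2)] with r hr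
      exact hθ.eq_of_tendsto h2 hk (hbk r ⟨hr.1.le, hr.2.trans_le (min_le_left _ _)⟩)
        (htk.1.trans_lt hr.1) (hr.2.le.trans (min_le_right _ _))
    exact tendsto_nhds_unique (tendsto_const_nhds.congr' (heq.mono fun r hr => hr.symm)) hright
  · rw [F.threshold_eq j hj T hTj, hθ.eq_of_tendsto h2 hj hTj hlt le_rfl]

/-- A time in the domain that is not an update time lies in the interior of its period. -/
lemma FluidSystem.exists_tau_lt (F : FluidSystem lam α) (hT : 0 < T) (hdom : T ∈ F.domain)
    (hup : ¬ F.IsUpdateTime T) :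
    ∃ j : ℕ, (j : ℕ∞) < F.η ∧ T ∈ fluidPeriod F.η F.τ j ∧ F.τ j < T := by
  obtain ⟨j, hj, hTj⟩ := hdom
  refine ⟨j, hj, hTj, lt_of_le_of_ne hTj.1 fun heq => ?_⟩
  rcases j with _ | i
  · rw [F.tau_zero] at heq
    exact hT.ne heq
  · exact hup ⟨i, hj, heq⟩

theorem GoodRun.isRelativelyCompactSeq (h : GoodRun lam α clock u q₀ ℓ₀ q ℓ) (hT : 0 < T)
    (hup : ∀ F : FluidSystem lam α, F.IsAdmissible → F.q 0 = q₀ → F.ℓ 0 = ℓ₀ →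
      ¬ F.IsUpdateTime T) :
    IsRelativelyCompactSeq (IsCadlagPair T) (rhoProduct T) fun n => toPair (q n) (ℓ n) := by
  intro φ hφ
  obtain ⟨U, hU, hU'⟩ := exists_ultrafilter_le_map hφ
  obtain ⟨x, hx⟩ := h.exists_limit hU'
  obtain ⟨F, hadm, -, hFq, hFℓ, hdom, θ, hθ⟩ := exists_fluidSystem hx h
  obtain ⟨j, hj, hTj, hlt⟩ := F.exists_tau_lt hT (hdom T hT.le) (hup F hadm hFq hFℓ)
  have hlim : Tendsto (fun n => rhoProduct T (toPair (q n) (ℓ n)) (x, fun t => (F.ℓ t : ℝ))) U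
      (𝓝 0) := by
    have := (hx.tendsto_rhoUniform T).max (hθ.tendsto_rhoSkorokhod hj hTj hlt)
    rwa [max_self] at this
  obtain ⟨ψ, hψ, hψ'⟩ := exists_subseq_tendsto hU hlim
  exact ⟨ψ, hψ, _, ⟨hx.isCadlagOn _, F.isCadlagOn_threshold fun t ht => hdom t ht.1⟩, hψ'⟩

end Conclusion

/-! ### Almost every realization is good -/

/-- The initial values that appear in the equations are the values of the processes at time `0`. -/
lemma IsDiscreteSystem.initial {α : ℝ} {n : ℕ} {clock : ℕ → ℝ≥0 → ℕ} {u : ℕ → ℝ} {q₀ : ℕ → ℝ}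
    {ℓ₀ : ℕ} {q : ℝ → ℕ → ℝ} {ℓ : ℝ → ℕ} (h : IsDiscreteSystem α n clock u q₀ ℓ₀ q ℓ)
    (hclock : ∀ i, clock i 0 = 0) : q 0 = q₀ ∧ ℓ 0 = ℓ₀ := by
  have hcount : arrivalCount (clock 0) n 0 = 0 := by simp [arrivalCount, hclock]
  constructor
  · funext i
    rw [h.occupancy 0 le_rfl i, arrivals, departures, hcount]
    simp [hclock]
  · have := h.threshold 0 le_rfl
    rw [hcount] at this
    simpa using this

end ThresholdBalancing

end

open ThresholdBalancing in
theorem mainTheorem6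
    {ΩD ΩS ΩI : Type*} [MeasurableSpace ΩD] [MeasurableSpace ΩS] [MeasurableSpace ΩI]
    (PD : Measure ΩD) (PS : Measure ΩS) (PI : Measure ΩI)
    [IsProbabilityMeasure PD] [IsProbabilityMeasure PS] [IsProbabilityMeasure PI]
    (lam α T : ℝ) (hlam : 0 < lam) (hα₀ : 0 < α) (hα₁ : α < 1) (hT : 0 < T)
    -- independent Poisson clocks: `clock 0` for arrivals, `clock i` for departures, `i ≥ 1`
    (clock : ℕ → ℝ≥0 → ΩD → ℕ)
    (harr : IsPoissonProcess (clock 0) lam.toNNReal PD)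
    (hdep : ∀ i, 1 ≤ i → IsPoissonProcess (clock i) 1 PD)
    (hclock : iIndepFun (fun (i : ℕ) (ω : ΩD) (t : ℝ≥0) => clock i t ω) PD)
    -- independent uniform selection variables
    (U : ℕ → ΩS → ℝ) (hU_meas : ∀ j, Measurable (U j))
    (hU_law : ∀ j, PS.map (U j) = (volume : Measure ℝ).restrict (Ico 0 1))
    (hU_indep : iIndepFun U PS)
    -- initial conditions and their limits
    (qInit : ℕ → ΩI → ℕ → ℝ) (ℓInit : ℕ → ΩI → ℕ) (qLim : ΩI → ℕ → ℝ) (ℓLim : ΩI → ℕ)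
    (hqInit_meas : ∀ n, Measurable (qInit n)) (hℓInit_meas : ∀ n, Measurable (ℓInit n))
    (hqLim_meas : Measurable qLim) (hℓLim_meas : Measurable ℓLim)
    (hqInit : ∀ n, 1 ≤ n → ∀ ω, qInit n ω ∈ discreteOccupancySpace n)
    (hqLim : ∀ ω, qLim ω ∈ occupancySpace)
    (hq_conv : ∀ᵐ ω ∂PI, Tendsto (fun n => qInit n ω) atTop (𝓝 (qLim ω)))
    (hℓ_conv : ∀ᵐ ω ∂PI, Tendsto (fun n => ℓInit n ω) atTop (𝓝 (ℓLim ω)))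
    (hnice : ∀ᵐ ω ∂PI, α < qLim ω (ℓLim ω) ∧ qLim ω (ℓLim ω + 1) < 1)
    -- the systems with `n` server pools, on the product space
    (q : ℕ → ΩD × ΩS × ΩI → ℝ → ℕ → ℝ) (ℓ : ℕ → ΩD × ΩS × ΩI → ℝ → ℕ)
    (hsys : ∀ n, 1 ≤ n → ∀ᵐ ω ∂(PD.prod (PS.prod PI)),
      IsDiscreteSystem α n (fun i t => clock i t ω.1) (fun j => U j ω.2.1)
        (qInit n ω.2.2) (ℓInit n ω.2.2) (q n ω) (ℓ n ω)) :
    ∀ᵐ ω ∂(PD.prod (PS.prod PI)),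
      -- the occupancy processes are relatively compact
      IsRelativelyCompactSeq (fun x => IsCadlagOn x (Icc 0 T)) (rhoUniform T) (fun n => q n ω) ∧
      -- all subsequential limits are fluid systems up to the end point
      (∀ φ : ℕ → ℕ, StrictMono φ → ∀ s : PathPair, IsCadlagPair T s →
        Tendsto (fun k => rhoProduct T (toPair (q (φ k) ω) (ℓ (φ k) ω)) s) atTop (𝓝 0) →
        ∃ F : FluidSystem lam α, F.ExtendsUpToEndpoint T s) ∧
      -- the full result, if no fluid system from the limiting initial state has an update at `T`
      ((∀ F : FluidSystem lam α, F.IsAdmissible → F.q 0 = qLim ω.2.2 → F.ℓ 0 = ℓLim ω.2.2 →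
          ¬ F.IsUpdateTime T) →
        IsRelativelyCompactSeq (IsCadlagPair T) (rhoProduct T)
          (fun n => toPair (q n ω) (ℓ n ω)) ∧
        ∀ φ : ℕ → ℕ, StrictMono φ → ∀ s : PathPair, IsCadlagPair T s →
          Tendsto (fun k => rhoProduct T (toPair (q (φ k) ω) (ℓ (φ k) ω)) s) atTop (𝓝 0) →
          ∃ F : FluidSystem lam α, F.Extends T s) := by
  have hD : ∀ᵐ ω ∂PD, IsArrivalClock (fun t => clock 0 t ω) ∧ HasRate (fun t => clock 0 t ω) lam ∧
      (∀ i, 1 ≤ i → HasRate (fun t => clock i t ω) 1) ∧ ∀ i, clock i 0 ω = 0 := by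
    have hzero : ∀ i, ∀ᵐ ω ∂PD, clock i 0 ω = 0 := fun i => by
      rcases Nat.eq_zero_or_pos i with rfl | hi
      · exact harr.zero
      · exact (hdep i hi).zero
    have hrate : ∀ i, ∀ᵐ ω ∂PD, 1 ≤ i → HasRate (fun t => clock i t ω) 1 := fun i => by
      by_cases hi : 1 ≤ i
      · filter_upwards [(hdep i hi).ae_hasRate] with ω hω _
        exact_mod_cast hω
      · exact Eventually.of_forall fun ω hc => absurd hc hi
    filter_upwards [harr.zero, harr.mono, harr.rightCont,
      harr.ae_surjective (Real.toNNReal_pos.2 hlam), harr.ae_hasRate, ae_all_iff.2 hzero,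
      ae_all_iff.2 hrate] with ω h1 h2 h3 h4 h5 h6 h7
    rw [Real.coe_toNNReal _ hlam.le] at h5
    exact ⟨⟨h2, h1, h3, h4⟩, h5, h7, h6⟩
  have hS : ∀ᵐ ω ∂PS, (∀ j, U j ω ∈ Ico (0 : ℝ) 1) ∧ ∀ c ∈ Icc (0 : ℝ) 1,
      Tendsto (fun m : ℕ => empirical (fun j => U j ω) c m / m) atTop (𝓝 c) := by
    filter_upwards [ae_all_iff.2 fun j => ae_uniform_mem (hU_meas j) (hU_law j),
      ae_tendsto_empirical U hU_meas hU_law hU_indep] with ω h1 h2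
    exact ⟨h1, h2⟩
  have hI := hq_conv.and (hℓ_conv.and hnice)
  have hD' := Measure.quasiMeasurePreserving_fst (μ := PD) (ν := PS.prod PI) |>.ae hD
  have hS' := Measure.quasiMeasurePreserving_snd (μ := PD) (ν := PS.prod PI) |>.ae
    ((Measure.quasiMeasurePreserving_fst (μ := PS) (ν := PI)).ae hS)
  have hI' := Measure.quasiMeasurePreserving_snd (μ := PD) (ν := PS.prod PI) |>.ae
    ((Measure.quasiMeasurePreserving_snd (μ := PS) (ν := PI)).ae hI)
  have hsys' : ∀ᵐ ω ∂(PD.prod (PS.prod PI)), ∀ n, 1 ≤ n →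
      IsDiscreteSystem α n (fun i t => clock i t ω.1) (fun j => U j ω.2.1)
        (qInit n ω.2.2) (ℓInit n ω.2.2) (q n ω) (ℓ n ω) :=
    ae_all_iff.2 fun n => eventually_imp_distrib_left.2 (hsys n)
  filter_upwards [hD', hS', hI', hsys'] with ω ⟨harrω, hrateω, hdepω, hzeroω⟩ ⟨hmemω, hllnω⟩
    ⟨hqω, hℓω, hniceω⟩ hsysω
  have hinit : ∀ n, 1 ≤ n → q n ω 0 = qInit n ω.2.2 ∧ ℓ n ω 0 = ℓInit n ω.2.2 :=
    fun n hn => (hsysω n hn).initial hzeroω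
  have hrun : GoodRun lam α (fun i t => clock i t ω.1) (fun j => U j ω.2.1) (qLim ω.2.2)
      (ℓLim ω.2.2) (fun n => q n ω) (fun n => ℓ n ω) :=
    { lam_pos := hlam
      alpha_lt := hα₁
      arr := harrω
      arr_rate := hrateω
      dep_rate := hdepω
      sel_mem := hmemω
      sel_lln := hllnω
      sys := fun n hn => by
        rw [(hinit n hn).1, (hinit n hn).2]
        exact hsysω n hn
      q_init := hqω.congr' ((eventually_ge_atTop 1).mono fun n hn => (hinit n hn).1.symm)
      ℓ_init := by
        rw [nhds_discrete] at hℓω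
        filter_upwards [tendsto_pure.1 hℓω, eventually_ge_atTop 1] with n h1 hn
        rw [(hinit n hn).2, h1]
      alpha_lt_init := hniceω.1
      init_lt_one := hniceω.2 }
  refine ⟨hrun.isRelativelyCompactSeq_occupancy T, fun φ hφ s hs hlim => ?_, fun hup =>
    ⟨hrun.isRelativelyCompactSeq hT hup, fun φ hφ s hs hlim => ?_⟩⟩
  · obtain ⟨F, -, -, -, hF, -⟩ := hrun.exists_extends hφ hs hlim
    exact ⟨F, hF⟩
  · obtain ⟨F, hadm, hFq, hFℓ, hF, hend⟩ := hrun.exists_extends hφ hs hlim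
    refine ⟨F, hF.1, fun t ht => ⟨hF.2.1 t ht, ?_⟩⟩
    rcases lt_or_eq_of_le ht.2 with hlt | rfl
    · exact hF.2.2 t ⟨ht.1, hlt⟩
    · obtain ⟨j, hj, htj, hjt⟩ := F.exists_tau_lt hT (hF.1 ht) (hup F hadm hFq hFℓ)
      exact hend j hj htj hjt
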